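/- Let $k$ be a field and let $A$ and $B$ be DG algebras over $k$ (unital, associative, $\mathbb{Z}$-graded, not necessarily commutative). Write $\mathbf{D}(A)$ for the unbounded derived category of right DG $A$-modules, i.e. the localization of the category of right DG $A$-modules at the quasi-isomorphisms, with its usual triangulated structure; similarly for other DG algebras. Say that an $A$-$B$ DG bimodule $T$ gives a DG Morita equivalence between $A$ and $B$ if the derived tensor product functor $(-)\otimes^{\mathbf{L}}_A T:\mathbf{D}(A)\to\mathbf{D}(B)$ is an equivalence of triangulated categories. For a field extension $k'/k$ put $A_{k'}=A\otimes_k k'$, $B_{k'}=B\otimes_k k'$ and $T_{k'}=T\otimes_k k'$; these are DG algebras over $k'$ and an $A_{k'}$-$B_{k'}$ DG bimodule. If an $A$-$B$ DG bimodule $T$ gives a DG Morita equivalence between $A$ and $B$, then for every field extension $k'/k$ the $A_{k'}$-$B_{k'}$ DG bimodule $T_{k'}$ gives a DG Morita equivalence between $A_{k'}$ and $B_{k'}$. -/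

import Mathlib

open CategoryTheory
open scoped TensorProduct

universe u

noncomputable section

/-! ### DG algebras, DG modules, DG bimodules -/

/-- A (unital, associative) DG algebra over `k`: a cochain complex of `k`-modules with a
`k`-bilinear graded multiplication satisfying the graded Leibniz rule. -/
structure DGAlgebra (k : Type u) [CommRing k] where
  cx : CochainComplex (ModuleCat.{u} k) ℤ
  mul (i j n : ℤ) (h : i + j = n) : cx.X i →ₗ[k] cx.X j →ₗ[k] cx.X n
  one : cx.X 0
  one_mul (i : ℤ) (a : cx.X i) : mul 0 i i (zero_add i) one a = a
  mul_one (i : ℤ) (a : cx.X i) : mul i 0 i (add_zero i) a one = a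
  mul_assoc (i j l r s n : ℤ) (hr : i + j = r) (hs : j + l = s) (h₁ : r + l = n) (h₂ : i + s = n)
    (a : cx.X i) (b : cx.X j) (c : cx.X l) :
    mul r l n h₁ (mul i j r hr a b) c = mul i s n h₂ a (mul j l s hs b c)
  d_mul (i i' j j' n n' : ℤ) (hi : i + 1 = i') (hj : j + 1 = j') (hn : n + 1 = n')
    (h : i + j = n) (a : cx.X i) (b : cx.X j) :
    (cx.d n n').hom (mul i j n h a b) =
      mul i' j n' (by lia) ((cx.d i i').hom a) b +
        i.negOnePow • mul i j' n' (by lia) a ((cx.d j j').hom b)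

/-- A (unital) right DG module over the DG algebra `A`. -/
structure DGModule {k : Type u} [CommRing k] (A : DGAlgebra k) where
  cx : CochainComplex (ModuleCat.{u} k) ℤ
  act (i j n : ℤ) (h : i + j = n) : cx.X i →ₗ[k] A.cx.X j →ₗ[k] cx.X n
  act_one (i : ℤ) (m : cx.X i) : act i 0 i (add_zero i) m A.one = m
  act_mul (i j l r s n : ℤ) (hr : i + j = r) (hs : j + l = s) (h₁ : r + l = n) (h₂ : i + s = n)
    (m : cx.X i) (a : A.cx.X j) (b : A.cx.X l) :
    act r l n h₁ (act i j r hr m a) b = act i s n h₂ m (A.mul j l s hs a b)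
  d_act (i i' j j' n n' : ℤ) (hi : i + 1 = i') (hj : j + 1 = j') (hn : n + 1 = n')
    (h : i + j = n) (m : cx.X i) (a : A.cx.X j) :
    (cx.d n n').hom (act i j n h m a) =
      act i' j n' (by lia) ((cx.d i i').hom m) a +
        i.negOnePow • act i j' n' (by lia) m ((A.cx.d j j').hom a)

/-- An `A`-`B` DG bimodule: a right DG `B`-module with a compatible left DG `A`-action. -/
structure DGBimodule {k : Type u} [CommRing k] (A B : DGAlgebra k) extends DGModule B where
  lact (i j n : ℤ) (h : i + j = n) : A.cx.X i →ₗ[k] cx.X j →ₗ[k] cx.X n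
  one_lact (i : ℤ) (t : cx.X i) : lact 0 i i (zero_add i) A.one t = t
  mul_lact (i j l r s n : ℤ) (hr : i + j = r) (hs : j + l = s) (h₁ : r + l = n) (h₂ : i + s = n)
    (a : A.cx.X i) (b : A.cx.X j) (t : cx.X l) :
    lact r l n h₁ (A.mul i j r hr a b) t = lact i s n h₂ a (lact j l s hs b t)
  lact_act (i j l r s n : ℤ) (hr : i + j = r) (hs : j + l = s) (h₁ : r + l = n) (h₂ : i + s = n)
    (a : A.cx.X i) (t : cx.X j) (b : B.cx.X l) :
    act r l n h₁ (lact i j r hr a t) b = lact i s n h₂ a (act j l s hs t b)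
  d_lact (i i' j j' n n' : ℤ) (hi : i + 1 = i') (hj : j + 1 = j') (hn : n + 1 = n')
    (h : i + j = n) (a : A.cx.X i) (t : cx.X j) :
    (cx.d n n').hom (lact i j n h a t) =
      lact i' j n' (by lia) ((A.cx.d i i').hom a) t +
        i.negOnePow • lact i j' n' (by lia) a ((cx.d j j').hom t)

namespace DGModule

variable {k : Type u} [CommRing k] {A : DGAlgebra k}

/-- Morphisms of right DG modules: closed morphisms of degree `0`, i.e. `A`-linear cochain maps. -/
@[ext]
structure Hom (M N : DGModule A) where
  f : M.cx ⟶ N.cx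
  map_act (i j n : ℤ) (h : i + j = n) (m : M.cx.X i) (a : A.cx.X j) :
    (f.f n).hom (M.act i j n h m a) = N.act i j n h ((f.f i).hom m) a

instance : Category (DGModule A) where
  Hom := Hom
  id M := { f := 𝟙 _, map_act := by intros; simp }
  comp f g := { f := f.f ≫ g.f, map_act := by intros; simp [f.map_act, g.map_act] }

@[ext]
lemma hom_ext {M N : DGModule A} {f g : M ⟶ N} (h : f.f = g.f) : f = g := Hom.ext h

@[simp] lemma id_f (M : DGModule A) : (𝟙 M : M ⟶ M).f = 𝟙 M.cx := rfl

@[simp] lemma comp_f {M N P : DGModule A} (f : M ⟶ N) (g : N ⟶ P) :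
    (f ≫ g).f = f.f ≫ g.f := rfl

/-- The underlying complex of a DG module. -/
@[simps]
def forget (A : DGAlgebra k) : DGModule A ⥤ CochainComplex (ModuleCat.{u} k) ℤ where
  obj M := M.cx
  map f := f.f

/-- Quasi-isomorphisms of DG modules. -/
def quasiIso (A : DGAlgebra k) : MorphismProperty (DGModule A) :=
  (HomologicalComplex.quasiIso (ModuleCat.{u} k) (ComplexShape.up ℤ)).inverseImage (forget A)

/-- The shift `M[1]` of a right DG module: `M[1]ⁱ = Mⁱ⁺¹` with differential `-d`; the right action
carries no sign. -/
@[simps, reducible]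
def shift (M : DGModule A) : DGModule A where
  cx := M.cx⟦(1 : ℤ)⟧
  act i j n h := M.act (i + 1) j (n + 1) (by lia)
  act_one i m := M.act_one (i + 1) m
  act_mul i j l r s n hr hs h₁ h₂ m a b :=
    M.act_mul (i + 1) j l (r + 1) s (n + 1) _ _ _ _ m a b
  d_act i i' j j' n n' hi hj hn h m a := by
    have e (x y : ℤ) : (1 : ℤ).negOnePow • M.cx.d x y = -M.cx.d x y := by simp
    have key (m : M.cx.X (i + 1)) :
        (-M.cx.d (n + 1) (n' + 1)).hom (M.act (i + 1) j (n + 1) (by lia) m a) =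
          M.act (i' + 1) j (n' + 1) (by lia) ((-M.cx.d (i + 1) (i' + 1)).hom m) a +
            i.negOnePow • M.act (i + 1) j' (n' + 1) (by lia) m ((A.cx.d j j').hom a) := by
      have := M.d_act (i + 1) (i' + 1) j j' (n + 1) (n' + 1) (by lia) hj (by lia) (by lia) m a
      rw [ModuleCat.hom_neg, ModuleCat.hom_neg, LinearMap.neg_apply, LinearMap.neg_apply, this,
        Int.negOnePow_succ, Units.neg_smul, map_neg, LinearMap.neg_apply, neg_add, neg_neg]
    rw [← e, ← e] at key
    exact key m

/-- The shift functor `[1]` on right DG modules. -/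
@[simps]
def shiftFunctor (A : DGAlgebra k) : DGModule A ⥤ DGModule A where
  obj M := M.shift
  map f :=
    { f := f.f⟦(1 : ℤ)⟧'
      map_act := fun i j n h m a => f.map_act (i + 1) j (n + 1) (by lia) m a }
  map_id M := by ext1; exact (CategoryTheory.shiftFunctor _ (1 : ℤ)).map_id M.cx
  map_comp f g := by ext1; exact (CategoryTheory.shiftFunctor _ (1 : ℤ)).map_comp f.f g.f


section Cone

variable {M N : DGModule A} (f : M ⟶ N)

/-- The `M`-component of an element of the mapping cone. -/
abbrev coneFst (i j : ℤ) (h : i + 1 = j) :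
    (CochainComplex.mappingCone f.f).X i →ₗ[k] M.cx.X j :=
  ((CochainComplex.mappingCone.fst f.f).1.v i j h).hom

/-- The `N`-component of an element of the mapping cone. -/
abbrev coneSnd (i : ℤ) : (CochainComplex.mappingCone f.f).X i →ₗ[k] N.cx.X i :=
  ((CochainComplex.mappingCone.snd f.f).v i i (add_zero i)).hom

/-- The inclusion of the `M`-component in the mapping cone. -/
abbrev coneInl (i j : ℤ) (h : i + 1 = j) :
    M.cx.X j →ₗ[k] (CochainComplex.mappingCone f.f).X i :=
  ((CochainComplex.mappingCone.inl f.f).v j i (by lia)).hom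

/-- The inclusion of the `N`-component in the mapping cone. -/
abbrev coneInr (i : ℤ) : N.cx.X i →ₗ[k] (CochainComplex.mappingCone f.f).X i :=
  ((CochainComplex.mappingCone.inr f.f).f i).hom

lemma coneFst_inl (i j : ℤ) (h : i + 1 = j) (x : M.cx.X j) :
    coneFst f i j h (coneInl f i j h x) = x :=
  congr($(CochainComplex.mappingCone.inl_v_fst_v f.f j i h).hom x)

lemma coneSnd_inl (i j : ℤ) (h : i + 1 = j) (x : M.cx.X j) :
    coneSnd f i (coneInl f i j h x) = 0 :=
  congr($(CochainComplex.mappingCone.inl_v_snd_v f.f j i (by lia)).hom x)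

lemma coneFst_inr (i j : ℤ) (h : i + 1 = j) (y : N.cx.X i) :
    coneFst f i j h (coneInr f i y) = 0 :=
  congr($(CochainComplex.mappingCone.inr_f_fst_v f.f i j h).hom y)

lemma coneSnd_inr (i : ℤ) (y : N.cx.X i) : coneSnd f i (coneInr f i y) = y :=
  congr($(CochainComplex.mappingCone.inr_f_snd_v f.f i).hom y)

lemma cone_decomp (i j : ℤ) (h : i + 1 = j) (z : (CochainComplex.mappingCone f.f).X i) :
    coneInl f i j h (coneFst f i j h z) + coneInr f i (coneSnd f i z) = z :=
  congr($(CochainComplex.mappingCone.id_X f.f i j h).hom z)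

variable {f} in
lemma cone_ext {i j : ℤ} (h : i + 1 = j) {z w : (CochainComplex.mappingCone f.f).X i}
    (h₁ : coneFst f i j h z = coneFst f i j h w) (h₂ : coneSnd f i z = coneSnd f i w) : z = w := by
  rw [← cone_decomp f i j h z, ← cone_decomp f i j h w, h₁, h₂]

lemma coneFst_d (i j l : ℤ) (hij : i + 1 = j) (hjl : j + 1 = l)
    (z : (CochainComplex.mappingCone f.f).X i) :
    coneFst f j l hjl (((CochainComplex.mappingCone f.f).d i j).hom z) =
      -(M.cx.d j l).hom (coneFst f i j hij z) :=
  congr($(CochainComplex.mappingCone.d_fst_v f.f i j l hij hjl).hom z)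

lemma coneSnd_d (i j : ℤ) (hij : i + 1 = j) (z : (CochainComplex.mappingCone f.f).X i) :
    coneSnd f j (((CochainComplex.mappingCone f.f).d i j).hom z) =
      (f.f.f j).hom (coneFst f i j hij z) + (N.cx.d i j).hom (coneSnd f i z) :=
  congr($(CochainComplex.mappingCone.d_snd_v f.f i j hij).hom z)

/-- The right action of `A` on the mapping cone, componentwise: `(x, y) a = (x a, y a)`. -/
def coneAct (i j n : ℤ) (h : i + j = n) : (CochainComplex.mappingCone f.f).X i →ₗ[k]
    A.cx.X j →ₗ[k] (CochainComplex.mappingCone f.f).X n :=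
  ((M.act (i + 1) j (n + 1) (by lia)).comp (coneFst f i (i + 1) rfl)).compr₂
      (coneInl f n (n + 1) rfl) +
    ((N.act i j n h).comp (coneSnd f i)).compr₂ (coneInr f n)

lemma coneFst_act (i j n i' n' : ℤ) (h : i + j = n) (hi : i + 1 = i') (hn : n + 1 = n')
    (z : (CochainComplex.mappingCone f.f).X i) (a : A.cx.X j) :
    coneFst f n n' hn (coneAct f i j n h z a) =
      M.act i' j n' (by lia) (coneFst f i i' hi z) a := by
  subst hi hn
  simp only [coneAct, LinearMap.add_apply, LinearMap.compr₂_apply, LinearMap.comp_apply, map_add,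
    coneFst_inl, coneFst_inr, add_zero]

lemma coneSnd_act (i j n : ℤ) (h : i + j = n)
    (z : (CochainComplex.mappingCone f.f).X i) (a : A.cx.X j) :
    coneSnd f n (coneAct f i j n h z a) = N.act i j n h (coneSnd f i z) a := by
  simp only [coneAct, LinearMap.add_apply, LinearMap.compr₂_apply, LinearMap.comp_apply, map_add,
    coneSnd_inl, coneSnd_inr, zero_add]

/-- The mapping cone of a morphism `f : M ⟶ N` of right DG modules. -/
@[simps, reducible]
def cone : DGModule A where
  cx := CochainComplex.mappingCone f.f
  act := coneAct f
  act_one i z := by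
    apply cone_ext rfl
    · rw [coneFst_act f _ _ _ _ _ _ rfl rfl, act_one]
    · rw [coneSnd_act, act_one]
  act_mul i j l r s n hr hs h₁ h₂ z a b := by
    apply cone_ext rfl
    · rw [coneFst_act f _ _ _ _ _ _ rfl rfl, coneFst_act f _ _ _ _ _ _ rfl rfl,
        coneFst_act f _ _ _ _ _ _ rfl rfl, M.act_mul (i + 1) j l (r + 1) s (n + 1)]
    · rw [coneSnd_act, coneSnd_act, coneSnd_act, N.act_mul]
  d_act i i' j j' n n' hi hj hn h z a := by
    apply cone_ext rfl
    · rw [coneFst_d f n n' _ hn, coneFst_act f i j n i' n' h hi hn, map_add, map_zsmul_unit,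
        coneFst_act f i' j n' (i' + 1) (n' + 1) _ rfl rfl,
        coneFst_act f i j' n' i' (n' + 1) _ hi rfl, coneFst_d f i i' _ hi,
        M.d_act i' (i' + 1) j j' n' (n' + 1) rfl hj rfl, show i'.negOnePow = -i.negOnePow by
          rw [← hi, Int.negOnePow_succ], Units.neg_smul, map_neg, LinearMap.neg_apply, neg_add, neg_neg]
    · rw [coneSnd_d f n n' hn, coneFst_act f i j n i' n' h hi hn, map_add, map_zsmul_unit,
        coneSnd_act, coneSnd_act, coneSnd_act, coneSnd_d f i i' hi, f.map_act,
        N.d_act i i' j j' n n' hi hj hn, map_add, LinearMap.add_apply, add_assoc]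

/-- The inclusion `N ⟶ cone f`. -/
@[simps]
def coneInclusion : N ⟶ cone f where
  f := CochainComplex.mappingCone.inr f.f
  map_act i j n h y a := by
    apply cone_ext rfl
    · exact (coneFst_inr f _ _ _ _).trans (by
        rw [cone_act, coneFst_act f i j n _ _ h rfl rfl, coneFst_inr, map_zero,
          LinearMap.zero_apply])
    · exact (coneSnd_inr f _ _).trans (by rw [cone_act, coneSnd_act, coneSnd_inr])

lemma triangle_mor₃_f (i : ℤ) (z : (CochainComplex.mappingCone f.f).X i) :
    ((CochainComplex.mappingCone.triangle f.f).mor₃.f i).hom z = -coneFst f i (i + 1) rfl z := by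
  have : (CochainComplex.mappingCone.triangle f.f).mor₃.f i =
      -(CochainComplex.mappingCone.fst f.f).1.v i (i + 1) rfl := by
    refine (CochainComplex.mappingCone.ext_from_iff f.f (i + 1) i rfl _ _).2 ⟨?_, ?_⟩
    · refine (CochainComplex.mappingCone.inl_v_triangle_mor₃_f f.f (i + 1) i (by lia)).trans ?_
      have e : (CochainComplex.mappingCone.inl f.f).v (i + 1) i (by lia) ≫
          (-(CochainComplex.mappingCone.fst f.f).1.v i (i + 1) rfl) = -𝟙 (M.cx.X (i + 1)) := by
        rw [Preadditive.comp_neg, CochainComplex.mappingCone.inl_v_fst_v]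
      exact e.symm
    · refine (CochainComplex.mappingCone.inr_f_triangle_mor₃_f f.f i).trans ?_
      have e : (CochainComplex.mappingCone.inr f.f).f i ≫
          (-(CochainComplex.mappingCone.fst f.f).1.v i (i + 1) rfl) = 0 := by
        rw [Preadditive.comp_neg, CochainComplex.mappingCone.inr_f_fst_v, neg_zero]
      exact e.symm
  exact congr(($this).hom z)

/-- The connecting morphism `cone f ⟶ M[1]`, with the usual sign: minus the projection. -/
@[simps]
def coneProjection : cone f ⟶ M.shift where
  f := (CochainComplex.mappingCone.triangle f.f).mor₃
  map_act i j n h z a := by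
    refine (triangle_mor₃_f f _ _).trans ?_
    refine Eq.trans ?_ (congrArg (fun x => M.act (i + 1) j (n + 1) (by lia) x a)
      (triangle_mor₃_f f i z).symm)
    rw [cone_act, coneFst_act f i j n _ _ h rfl rfl, map_neg, LinearMap.neg_apply]

end Cone


/-! ### The derived category -/

lemma quasiIso_shift {M N : DGModule A} (f : M ⟶ N) (hf : quasiIso A f) :
    quasiIso A ((shiftFunctor A).map f) := by
  have : QuasiIso f.f := hf
  exact (CochainComplex.quasiIso_shift_iff f.f 1).2 this

end DGModule

section Derived

variable {k : Type u} [CommRing k] (A B : DGAlgebra k)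

/-- The derived category `D(A)` of right DG `A`-modules: the localization of the category of right
DG modules at the quasi-isomorphisms. -/
abbrev DGDerived := (DGModule.quasiIso A).Localization

namespace DGDerived

/-- The localization functor from DG modules to the derived category. -/
abbrev Q : DGModule A ⥤ DGDerived A := (DGModule.quasiIso A).Q

lemma shift_Q_inverts :
    (DGModule.quasiIso A).IsInvertedBy (DGModule.shiftFunctor A ⋙ Q A) := fun _ _ f hf =>
  Localization.inverts (Q A) (DGModule.quasiIso A) _ (DGModule.quasiIso_shift f hf)

/-- The shift functor `[1]` on the derived category, induced by the shift of DG modules. -/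
def shiftFunctor : DGDerived A ⥤ DGDerived A :=
  Localization.lift (DGModule.shiftFunctor A ⋙ Q A) (shift_Q_inverts A) (Q A)

/-- The localization functor commutes with the shifts. -/
def shiftIso : Q A ⋙ shiftFunctor A ≅ DGModule.shiftFunctor A ⋙ Q A :=
  Localization.fac (DGModule.shiftFunctor A ⋙ Q A) (shift_Q_inverts A) (Q A)

/-- Triangles `X ⟶ Y ⟶ Z ⟶ X[1]` in the derived category. -/
structure Triangle where
  {X Y Z : DGDerived A}
  f : X ⟶ Y
  g : Y ⟶ Z
  h : Z ⟶ (shiftFunctor A).obj X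

variable {A B}

/-- A triangle is distinguished if it is isomorphic to the image of a standard triangle
`M ⟶ N ⟶ cone φ ⟶ M[1]` for some morphism `φ : M ⟶ N` of DG modules. -/
def Triangle.IsDistinguished (t : Triangle A) : Prop :=
  ∃ (M N : DGModule A) (φ : M ⟶ N) (eX : t.X ≅ (Q A).obj M) (eY : t.Y ≅ (Q A).obj N)
    (eZ : t.Z ≅ (Q A).obj (DGModule.cone φ)),
    t.f ≫ eY.hom = eX.hom ≫ (Q A).map φ ∧
    t.g ≫ eZ.hom = eY.hom ≫ (Q A).map (DGModule.coneInclusion φ) ∧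
    t.h ≫ (shiftFunctor A).map eX.hom =
      eZ.hom ≫ (Q A).map (DGModule.coneProjection φ) ≫ (shiftIso A).inv.app M

/-- The image of a triangle under a functor which commutes with the shifts. -/
def Triangle.map (t : Triangle A) (F : DGDerived A ⥤ DGDerived B)
    (c : shiftFunctor A ⋙ F ≅ F ⋙ shiftFunctor B) : Triangle B where
  f := F.map t.f
  g := F.map t.g
  h := F.map t.h ≫ c.hom.app t.X

/-- A functor between derived categories is triangulated if it commutes with the shifts, up to a
natural isomorphism, in such a way that distinguished triangles are sent to distinguished
triangles. -/
def IsTriangulated (F : DGDerived A ⥤ DGDerived B) : Prop :=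
  ∃ c : shiftFunctor A ⋙ F ≅ F ⋙ shiftFunctor B,
    ∀ t : Triangle A, t.IsDistinguished → (t.map F c).IsDistinguished

end DGDerived

end Derived

/-! ### The tensor product over a DG algebra -/

namespace DGModule

section Tensor

variable {k : Type u} [CommRing k] {A B : DGAlgebra k} (M : DGModule A) (T : DGBimodule A B)

/-- Degree `n` of the tensor product over `k`: the direct sum of `Mⁱ ⊗ Tʲ` over `i + j = n`. -/
abbrev PreTensor (n : ℤ) : Type u :=
  DirectSum {p : ℤ × ℤ // p.1 + p.2 = n} fun p => M.cx.X p.1.1 ⊗[k] T.cx.X p.1.2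

/-- The bilinear map `Mⁱ × Tʲ → (M ⊗ T)ⁿ` for `i + j = n`. -/
def preTmul (i j n : ℤ) (h : i + j = n) : M.cx.X i →ₗ[k] T.cx.X j →ₗ[k] PreTensor M T n :=
  (TensorProduct.mk k (M.cx.X i) (T.cx.X j)).compr₂
    (DirectSum.lof k {p : ℤ × ℤ // p.1 + p.2 = n}
      (fun p => M.cx.X p.1.1 ⊗[k] T.cx.X p.1.2) ⟨(i, j), h⟩)

/-- The relations `m a ⊗ t = m ⊗ a t` in degree `n`. -/
def tensorRel (n : ℤ) : Submodule k (PreTensor M T n) :=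
  Submodule.span k {x | ∃ (i j l r s : ℤ) (hr : i + j = r) (hs : j + l = s) (h₁ : r + l = n)
    (h₂ : i + s = n) (m : M.cx.X i) (a : A.cx.X j) (t : T.cx.X l),
    x = preTmul M T r l n h₁ (M.act i j r hr m a) t - preTmul M T i s n h₂ m (T.lact j l s hs a t)}

/-- Degree `n` of `M ⊗_A T`. -/
abbrev TensorX (n : ℤ) : Type u := PreTensor M T n ⧸ tensorRel M T n

/-- The bilinear map `Mⁱ × Tʲ → (M ⊗_A T)ⁿ`, `(m, t) ↦ m ⊗ t`, for `i + j = n`. -/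
def tmul (i j n : ℤ) (h : i + j = n) : M.cx.X i →ₗ[k] T.cx.X j →ₗ[k] TensorX M T n :=
  (preTmul M T i j n h).compr₂ (tensorRel M T n).mkQ

lemma tmul_act (i j l r s n : ℤ) (hr : i + j = r) (hs : j + l = s) (h₁ : r + l = n)
    (h₂ : i + s = n) (m : M.cx.X i) (a : A.cx.X j) (t : T.cx.X l) :
    tmul M T r l n h₁ (M.act i j r hr m a) t = tmul M T i s n h₂ m (T.lact j l s hs a t) :=
  (Submodule.Quotient.eq _).2 (Submodule.subset_span
    ⟨i, j, l, r, s, hr, hs, h₁, h₂, m, a, t, rfl⟩)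

variable {M T}

/-- Linear maps out of `(M ⊗_A T)ⁿ` are determined by their values on the elements `m ⊗ t`. -/
lemma tensor_hom_ext {n : ℤ} {P : Type*} [AddCommGroup P] [Module k P]
    {φ ψ : TensorX M T n →ₗ[k] P}
    (H : ∀ (i j : ℤ) (h : i + j = n) (m : M.cx.X i) (t : T.cx.X j),
      φ (tmul M T i j n h m t) = ψ (tmul M T i j n h m t)) : φ = ψ := by
  apply Submodule.linearMap_qext
  apply DirectSum.linearMap_ext
  rintro ⟨⟨i, j⟩, h⟩
  exact TensorProduct.ext' fun m t => H i j h m t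

/-- Balanced families of bilinear maps induce linear maps out of `(M ⊗_A T)ⁿ`. -/
def tensorDesc {n : ℤ} {P : Type*} [AddCommGroup P] [Module k P]
    (φ : ∀ i j : ℤ, i + j = n → M.cx.X i →ₗ[k] T.cx.X j →ₗ[k] P)
    (hφ : ∀ (i j l r s : ℤ) (hr : i + j = r) (hs : j + l = s) (h₁ : r + l = n)
      (h₂ : i + s = n) (m : M.cx.X i) (a : A.cx.X j) (t : T.cx.X l),
      φ r l h₁ (M.act i j r hr m a) t = φ i s h₂ m (T.lact j l s hs a t)) :
    TensorX M T n →ₗ[k] P :=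
  (tensorRel M T n).liftQ
    (DirectSum.toModule k _ _ fun p => TensorProduct.lift (φ p.1.1 p.1.2 p.2)) (by
      refine Submodule.span_le.2 ?_
      rintro _ ⟨i, j, l, r, s, hr, hs, h₁, h₂, m, a, t, rfl⟩
      simpa [preTmul, sub_eq_zero] using hφ i j l r s hr hs h₁ h₂ m a t)

@[simp]
lemma tensorDesc_tmul {n : ℤ} {P : Type*} [AddCommGroup P] [Module k P]
    (φ : ∀ i j : ℤ, i + j = n → M.cx.X i →ₗ[k] T.cx.X j →ₗ[k] P)
    (hφ : ∀ (i j l r s : ℤ) (hr : i + j = r) (hs : j + l = s) (h₁ : r + l = n)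
      (h₂ : i + s = n) (m : M.cx.X i) (a : A.cx.X j) (t : T.cx.X l),
      φ r l h₁ (M.act i j r hr m a) t = φ i s h₂ m (T.lact j l s hs a t))
    (i j : ℤ) (h : i + j = n) (m : M.cx.X i) (t : T.cx.X j) :
    tensorDesc φ hφ (tmul M T i j n h m t) = φ i j h m t := by
  refine (Submodule.liftQ_apply (tensorRel M T n) _ (preTmul M T i j n h m t)).trans ?_
  simp [preTmul]

variable (M T)

/-- The differential of `M ⊗_A T`: `d (m ⊗ t) = d m ⊗ t + (-1) ^ |m| • m ⊗ d t`. -/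
def tensorD (n n' : ℤ) (hn : n + 1 = n') : TensorX M T n →ₗ[k] TensorX M T n' :=
  tensorDesc
    (fun i j h => (tmul M T (i + 1) j n' (by lia)).comp (M.cx.d i (i + 1)).hom +
      i.negOnePow • (tmul M T i (j + 1) n' (by lia)).compl₂ (T.cx.d j (j + 1)).hom)
    (by
      intro i j l r s hr hs h₁ h₂ m a t
      simp only [LinearMap.add_apply, LinearMap.comp_apply, LinearMap.smul_apply,
        LinearMap.compl₂_apply]
      rw [M.d_act i (i + 1) j (j + 1) r (r + 1) rfl rfl rfl,
        T.d_lact j (j + 1) l (l + 1) s (s + 1) rfl rfl rfl, map_add, map_add, LinearMap.add_apply,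
        map_zsmul_unit, map_zsmul_unit, LinearMap.smul_apply,
        tmul_act M T (i + 1) j l (r + 1) s n' (by lia) hs (by lia) (by lia),
        tmul_act M T i (j + 1) l (r + 1) (s + 1) n' (by lia) (by lia) (by lia) (by lia),
        tmul_act M T i j (l + 1) r (s + 1) n' (by lia) (by lia) (by lia) (by lia),
        smul_add, smul_smul, ← Int.negOnePow_add, hr, add_assoc])

lemma tensorD_tmul (n n' : ℤ) (hn : n + 1 = n') (i i' j j' : ℤ) (h : i + j = n) (hi : i + 1 = i')
    (hj : j + 1 = j') (m : M.cx.X i) (t : T.cx.X j) :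
    tensorD M T n n' hn (tmul M T i j n h m t) =
      tmul M T i' j n' (by lia) ((M.cx.d i i').hom m) t +
        i.negOnePow • tmul M T i j' n' (by lia) m ((T.cx.d j j').hom t) := by
  subst hi hj
  exact tensorDesc_tmul _ _ _ _ _ _ _

/-- The complex underlying `M ⊗_A T`. -/
@[simps, reducible]
def tensorCx : CochainComplex (ModuleCat.{u} k) ℤ where
  X n := ModuleCat.of k (TensorX M T n)
  d n n' := if hn : n + 1 = n' then ModuleCat.ofHom (tensorD M T n n' hn) else 0
  shape n n' h := dif_neg h
  d_comp_d' n n' n'' h h' := by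
    have h : n + 1 = n' := h
    have h' : n' + 1 = n'' := h'
    rw [dif_pos h, dif_pos h']
    ext1
    apply tensor_hom_ext
    intro i j hij m t
    have e₁ := congr($(M.cx.d_comp_d i (i + 1) (i + 1 + 1)).hom m)
    have e₂ := congr($(T.cx.d_comp_d j (j + 1) (j + 1 + 1)).hom t)
    simp only [ModuleCat.hom_comp, LinearMap.comp_apply, ModuleCat.hom_zero,
      LinearMap.zero_apply] at e₁ e₂
    simp only [ModuleCat.hom_comp, ModuleCat.hom_ofHom, LinearMap.comp_apply, ModuleCat.hom_zero,
      LinearMap.zero_apply]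
    rw [tensorD_tmul M T n n' h i (i + 1) j (j + 1) hij rfl rfl, map_add, map_zsmul_unit,
      tensorD_tmul M T n' n'' h' (i + 1) (i + 1 + 1) j (j + 1) (by lia) rfl rfl,
      tensorD_tmul M T n' n'' h' i (i + 1) (j + 1) (j + 1 + 1) (by lia) rfl rfl, e₁, e₂,
      Int.negOnePow_succ]
    simp

lemma tensorCx_d_tmul (n n' : ℤ) (hn : n + 1 = n') (i i' j j' : ℤ) (h : i + j = n)
    (hi : i + 1 = i') (hj : j + 1 = j') (m : M.cx.X i) (t : T.cx.X j) :
    ((tensorCx M T).d n n').hom (tmul M T i j n h m t) =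
      tmul M T i' j n' (by lia) ((M.cx.d i i').hom m) t +
        i.negOnePow • tmul M T i j' n' (by lia) m ((T.cx.d j j').hom t) := by
  rw [← tensorD_tmul M T n n' hn i i' j j' h hi hj, tensorCx_d, dif_pos hn]
  rfl

/-- The right action of `B` on `M ⊗_A T`: `(m ⊗ t) b = m ⊗ t b`. -/
def tensorAct (n l n' : ℤ) (hn : n + l = n') :
    TensorX M T n →ₗ[k] B.cx.X l →ₗ[k] TensorX M T n' :=
  tensorDesc
    (fun i j h => LinearMap.mk₂ k
      (fun m t => (tmul M T i (j + l) n' (by lia) m).comp (T.act j l (j + l) rfl t))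
      (by intros; ext; simp) (by intros; ext; simp) (by intros; ext; simp) (by intros; ext; simp))
    (by
      intro i j q r s hr hs h₁ h₂ m a t
      ext b
      simp only [LinearMap.mk₂_apply, LinearMap.comp_apply]
      rw [tmul_act M T i j (q + l) r (s + l) n' hr (by lia) (by lia) (by lia),
        T.lact_act j q l s (q + l) (s + l) hs rfl rfl])

lemma tensorAct_tmul (n l n' : ℤ) (hn : n + l = n') (i j s : ℤ) (h : i + j = n) (hs : j + l = s)
    (m : M.cx.X i) (t : T.cx.X j) (b : B.cx.X l) :
    tensorAct M T n l n' hn (tmul M T i j n h m t) b =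
      tmul M T i s n' (by lia) m (T.act j l s hs t b) := by
  subst hs
  simp [tensorAct]

/-- The right DG `B`-module `M ⊗_A T`. -/
@[simps, reducible]
def tensor : DGModule B where
  cx := tensorCx M T
  act := tensorAct M T
  act_one n x := by
    suffices (tensorAct M T n 0 n (add_zero n)).flip B.one = LinearMap.id from
      congr($this x)
    apply tensor_hom_ext
    intro i j h m t
    rw [LinearMap.flip_apply, tensorAct_tmul M T n 0 n _ i j j h (add_zero j), T.act_one,
      LinearMap.id_apply]
  act_mul n j l r s n' hr hs h₁ h₂ x a b := by
    suffices ((tensorAct M T r l n' h₁).flip b).comp ((tensorAct M T n j r hr).flip a) =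
        (tensorAct M T n s n' h₂).flip (B.mul j l s hs a b) from congr($this x)
    apply tensor_hom_ext
    intro p q h m t
    simp only [LinearMap.comp_apply, LinearMap.flip_apply]
    rw [tensorAct_tmul M T n j r _ p q (q + j) h rfl,
      tensorAct_tmul M T r l n' _ p (q + j) (q + j + l) (by lia) rfl,
      tensorAct_tmul M T n s n' _ p q (q + j + l) h (by lia),
      T.act_mul q j l (q + j) s (q + j + l) rfl hs rfl]
  d_act i i' j j' n n' hi hj hn h x b := by
    suffices ((tensorCx M T).d n n').hom.comp ((tensorAct M T i j n h).flip b) =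
        ((tensorAct M T i' j n' (by lia)).flip b).comp ((tensorCx M T).d i i').hom +
          i.negOnePow • (tensorAct M T i j' n' (by lia)).flip ((B.cx.d j j').hom b) from
      congr($this x)
    apply tensor_hom_ext
    intro p q hpq m t
    simp only [LinearMap.comp_apply, LinearMap.flip_apply, LinearMap.add_apply,
      LinearMap.smul_apply]
    rw [tensorAct_tmul M T i j n _ p q (q + j) hpq rfl,
      tensorCx_d_tmul M T n n' hn p (p + 1) (q + j) (q + j + 1) (by lia) rfl rfl,
      tensorCx_d_tmul M T i i' hi p (p + 1) q (q + 1) hpq rfl rfl, map_add, map_zsmul_unit,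
      LinearMap.add_apply, LinearMap.smul_apply,
      tensorAct_tmul M T i' j n' _ (p + 1) q (q + j) (by lia) rfl,
      tensorAct_tmul M T i' j n' _ p (q + 1) (q + j + 1) (by lia) (by lia),
      tensorAct_tmul M T i j' n' _ p q (q + j + 1) (by lia) (by lia),
      T.d_act q (q + 1) j j' (q + j) (q + j + 1) rfl hj rfl, map_add, map_zsmul_unit, smul_add,
      smul_smul, ← Int.negOnePow_add, hpq]
    exact (add_assoc _ _ _).symm

variable {M} in
/-- The map `f ⊗ 1` in degree `n`. -/
def tensorMapX {N : DGModule A} (f : M ⟶ N) (n : ℤ) : TensorX M T n →ₗ[k] TensorX N T n :=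
  tensorDesc (fun i j h => (tmul N T i j n h).comp (f.f.f i).hom) (by
    intro i j l r s hr hs h₁ h₂ m a t
    simp only [LinearMap.comp_apply]
    rw [f.map_act, tmul_act N T i j l r s n hr hs h₁ h₂])

variable {M} in
@[simp]
lemma tensorMapX_tmul {N : DGModule A} (f : M ⟶ N) (n i j : ℤ) (h : i + j = n) (m : M.cx.X i)
    (t : T.cx.X j) :
    tensorMapX T f n (tmul M T i j n h m t) = tmul N T i j n h ((f.f.f i).hom m) t :=
  tensorDesc_tmul _ _ _ _ _ _ _

variable {M} in
/-- The morphism `f ⊗ 1 : M ⊗_A T ⟶ N ⊗_A T`. -/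
@[simps]
def tensorMap {N : DGModule A} (f : M ⟶ N) : tensor M T ⟶ tensor N T where
  f :=
    { f := fun n => ModuleCat.ofHom (tensorMapX T f n)
      comm' := by
        intro n n' hn
        have hn : n + 1 = n' := hn
        ext1
        apply tensor_hom_ext
        intro i j h m t
        have e := congr($(f.f.comm i (i + 1)).hom m)
        simp only [ModuleCat.hom_comp, LinearMap.comp_apply] at e
        simp only [ModuleCat.hom_comp, ModuleCat.hom_ofHom, LinearMap.comp_apply]
        rw [tensorMapX_tmul, tensorCx_d_tmul N T n n' hn i (i + 1) j (j + 1) h rfl rfl,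
          tensorCx_d_tmul M T n n' hn i (i + 1) j (j + 1) h rfl rfl, map_add, map_zsmul_unit,
          tensorMapX_tmul, tensorMapX_tmul, e] }
  map_act i j n h x b := by
    suffices (tensorMapX T f n).comp ((tensorAct M T i j n h).flip b) =
        ((tensorAct N T i j n h).flip b).comp (tensorMapX T f i) from congr($this x)
    apply tensor_hom_ext
    intro p q hpq m t
    simp only [LinearMap.comp_apply, LinearMap.flip_apply]
    rw [tensorAct_tmul M T i j n _ p q (q + j) hpq rfl, tensorMapX_tmul, tensorMapX_tmul,
      tensorAct_tmul N T i j n _ p q (q + j) hpq rfl]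

/-- The functor `(-) ⊗_A T` from right DG `A`-modules to right DG `B`-modules. -/
@[simps]
def tensorFunctor : DGModule A ⥤ DGModule B where
  obj M := tensor M T
  map f := tensorMap T f
  map_id M := by
    ext n : 3
    exact tensor_hom_ext fun i j h m t => by simp
  map_comp f g := by
    ext n : 3
    exact tensor_hom_ext fun i j h m t => by simp

end Tensor

end DGModule

/-- The `A`-`B` DG bimodule `T` gives a DG Morita equivalence: the derived tensor product
`(-) ⊗ᴸ_A T : D(A) ⥤ D(B)`, i.e. the total left derived functor of `(-) ⊗_A T`, is an equivalence
of triangulated categories. -/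
def DGBimodule.GivesDGMoritaEquivalence {k : Type u} [CommRing k] {A B : DGAlgebra k}
    (T : DGBimodule A B) : Prop :=
  ∃ (F : DGDerived A ⥤ DGDerived B)
    (α : DGDerived.Q A ⋙ F ⟶ DGModule.tensorFunctor T ⋙ DGDerived.Q B),
    F.IsLeftDerivedFunctor α (DGModule.quasiIso A) ∧ F.IsEquivalence ∧ DGDerived.IsTriangulated F

/-! ### Extension of scalars -/

section BaseChange

variable {k : Type u} [CommRing k] (k' : Type u) [CommRing k'] [Algebra k k']

/-- The bilinear map `(c ⊗ x, c' ⊗ y) ↦ (c c') ⊗ f x y`. -/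
def baseChangeBilin {X Y Z : Type u} [AddCommGroup X] [Module k X] [AddCommGroup Y] [Module k Y]
    [AddCommGroup Z] [Module k Z] (f : X →ₗ[k] Y →ₗ[k] Z) :
    k' ⊗[k] X →ₗ[k'] k' ⊗[k] Y →ₗ[k'] k' ⊗[k] Z :=
  LinearMap.liftBaseChange k' ((LinearMap.baseChangeHom k k' Y Z).comp f)

@[simp]
lemma baseChangeBilin_tmul {X Y Z : Type u} [AddCommGroup X] [Module k X] [AddCommGroup Y]
    [Module k Y] [AddCommGroup Z] [Module k Z] (f : X →ₗ[k] Y →ₗ[k] Z) (c c' : k') (x : X) (y : Y) :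
    baseChangeBilin k' f (c ⊗ₜ x) (c' ⊗ₜ y) = (c * c') ⊗ₜ f x y := by
  simp [baseChangeBilin, TensorProduct.smul_tmul']

/-- The complex `k' ⊗ K` of `k'`-modules. -/
@[simps, reducible]
def baseChangeCx (K : CochainComplex (ModuleCat.{u} k) ℤ) :
    CochainComplex (ModuleCat.{u} k') ℤ where
  X n := ModuleCat.of k' (k' ⊗[k] K.X n)
  d i j := ModuleCat.ofHom ((K.d i j).hom.baseChange k')
  shape i j h := by
    rw [K.shape i j h]
    ext1
    exact LinearMap.baseChange_zero ..
  d_comp_d' i j l _ _ := by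
    ext1
    change ((K.d j l).hom.baseChange k').comp ((K.d i j).hom.baseChange k') = 0
    rw [← LinearMap.baseChange_comp, ← ModuleCat.hom_comp, K.d_comp_d]
    exact LinearMap.baseChange_zero ..

section

variable {K L P : CochainComplex (ModuleCat.{u} k) ℤ}

lemma baseChange_leibniz (i i' j j' n n' : ℤ)
    (f : K.X i →ₗ[k] L.X j →ₗ[k] P.X n) (f₁ : K.X i' →ₗ[k] L.X j →ₗ[k] P.X n')
    (f₂ : K.X i →ₗ[k] L.X j' →ₗ[k] P.X n')
    (H : ∀ x y, (P.d n n').hom (f x y) = f₁ ((K.d i i').hom x) y +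
      i.negOnePow • f₂ x ((L.d j j').hom y))
    (x : k' ⊗[k] K.X i) (y : k' ⊗[k] L.X j) :
    ((P.d n n').hom.baseChange k') (baseChangeBilin k' f x y) =
      baseChangeBilin k' f₁ ((K.d i i').hom.baseChange k' x) y +
        i.negOnePow • baseChangeBilin k' f₂ x ((L.d j j').hom.baseChange k' y) := by
  induction x with
  | zero => simp
  | add x₁ x₂ h₁ h₂ => simp only [map_add, LinearMap.add_apply, h₁, h₂, smul_add]; abel
  | tmul c x =>
    induction y with
    | zero => simp
    | add y₁ y₂ h₁ h₂ => simp only [map_add, h₁, h₂, smul_add]; abel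
    | tmul c' y =>
      simp only [baseChangeBilin_tmul, LinearMap.baseChange_tmul, H, TensorProduct.tmul_add]
      rcases Int.even_or_odd i with hi | hi
      · simp [Int.negOnePow_even i hi]
      · simp [Int.negOnePow_odd i hi, TensorProduct.tmul_neg]

lemma baseChange_assoc {X₁ X₂ X₃ Y Z W : Type u} [AddCommGroup X₁] [Module k X₁]
    [AddCommGroup X₂] [Module k X₂] [AddCommGroup X₃] [Module k X₃] [AddCommGroup Y] [Module k Y]
    [AddCommGroup Z] [Module k Z] [AddCommGroup W] [Module k W]
    (f₁ : X₁ →ₗ[k] X₂ →ₗ[k] Y) (f₂ : Y →ₗ[k] X₃ →ₗ[k] W) (g₁ : X₂ →ₗ[k] X₃ →ₗ[k] Z)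
    (g₂ : X₁ →ₗ[k] Z →ₗ[k] W) (H : ∀ x y z, f₂ (f₁ x y) z = g₂ x (g₁ y z))
    (x : k' ⊗[k] X₁) (y : k' ⊗[k] X₂) (z : k' ⊗[k] X₃) :
    baseChangeBilin k' f₂ (baseChangeBilin k' f₁ x y) z =
      baseChangeBilin k' g₂ x (baseChangeBilin k' g₁ y z) := by
  induction x with
  | zero => simp
  | add x₁ x₂ h₁ h₂ => simp only [map_add, LinearMap.add_apply, h₁, h₂]
  | tmul c x =>
    induction y with
    | zero => simp
    | add y₁ y₂ h₁ h₂ => simp only [map_add, LinearMap.add_apply, h₁, h₂]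
    | tmul c' y =>
      induction z with
      | zero => simp
      | add z₁ z₂ h₁ h₂ => simp only [map_add, h₁, h₂]
      | tmul c'' z => simp only [baseChangeBilin_tmul, H, mul_assoc]

lemma baseChange_unit_right {X Y : Type u} [AddCommGroup X] [Module k X] [AddCommGroup Y]
    [Module k Y] (f : X →ₗ[k] Y →ₗ[k] X) (e : Y) (H : ∀ x, f x e = x) (x : k' ⊗[k] X) :
    baseChangeBilin k' f x (1 ⊗ₜ e) = x := by
  induction x with
  | zero => simp
  | add x₁ x₂ h₁ h₂ => simp only [map_add, LinearMap.add_apply, h₁, h₂]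
  | tmul c x => simp only [baseChangeBilin_tmul, H, mul_one]

lemma baseChange_unit_left {X Y : Type u} [AddCommGroup X] [Module k X] [AddCommGroup Y]
    [Module k Y] (f : Y →ₗ[k] X →ₗ[k] X) (e : Y) (H : ∀ x, f e x = x) (x : k' ⊗[k] X) :
    baseChangeBilin k' f (1 ⊗ₜ e) x = x := by
  induction x with
  | zero => simp
  | add x₁ x₂ h₁ h₂ => simp only [map_add, h₁, h₂]
  | tmul c x => simp only [baseChangeBilin_tmul, H, one_mul]

end

/-- The DG algebra `A_{k'} = k' ⊗ A` over `k'`. -/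
@[reducible]
def DGAlgebra.baseChange (A : DGAlgebra k) : DGAlgebra k' where
  cx := baseChangeCx k' A.cx
  mul i j n h := baseChangeBilin k' (A.mul i j n h)
  one := (1 : k') ⊗ₜ[k] A.one
  one_mul i := baseChange_unit_left k' _ _ (A.one_mul i)
  mul_one i := baseChange_unit_right k' _ _ (A.mul_one i)
  mul_assoc i j l r s n hr hs h₁ h₂ :=
    baseChange_assoc k' _ _ _ _ (A.mul_assoc i j l r s n hr hs h₁ h₂)
  d_mul i i' j j' n n' hi hj hn h :=
    baseChange_leibniz k' i i' j j' n n' _ _ _ (A.d_mul i i' j j' n n' hi hj hn h)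

/-- The right DG `A_{k'}`-module `M_{k'} = k' ⊗ M`. -/
@[reducible]
def DGModule.baseChange {A : DGAlgebra k} (M : DGModule A) : DGModule (A.baseChange k') where
  cx := baseChangeCx k' M.cx
  act i j n h := baseChangeBilin k' (M.act i j n h)
  act_one i := baseChange_unit_right k' _ _ (M.act_one i)
  act_mul i j l r s n hr hs h₁ h₂ :=
    baseChange_assoc k' _ _ _ _ (M.act_mul i j l r s n hr hs h₁ h₂)
  d_act i i' j j' n n' hi hj hn h :=
    baseChange_leibniz k' i i' j j' n n' _ _ _ (M.d_act i i' j j' n n' hi hj hn h)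

/-- The `A_{k'}`-`B_{k'}` DG bimodule `T_{k'} = k' ⊗ T`. -/
@[reducible]
def DGBimodule.baseChange {A B : DGAlgebra k} (T : DGBimodule A B) :
    DGBimodule (A.baseChange k') (B.baseChange k') where
  toDGModule := T.toDGModule.baseChange k'
  lact i j n h := baseChangeBilin k' (T.lact i j n h)
  one_lact i := baseChange_unit_left k' _ _ (T.one_lact i)
  mul_lact i j l r s n hr hs h₁ h₂ :=
    baseChange_assoc k' _ _ _ _ (T.mul_lact i j l r s n hr hs h₁ h₂)
  lact_act i j l r s n hr hs h₁ h₂ :=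
    baseChange_assoc k' _ _ _ _ (T.lact_act i j l r s n hr hs h₁ h₂)
  d_lact i i' j j' n n' hi hj hn h :=
    baseChange_leibniz k' i i' j j' n n' _ _ _ (T.d_lact i i' j j' n n' hi hj hn h)

end BaseChange

end

/-!
# Base change of DG Morita equivalences

Replace the bimodule `T` by its bar resolution `S` as a right `B`-module. The left action of `A`
extends to `S`, which is K-projective over `B`, and `M ⊗ S ⟶ M ⊗ T` is a quasi-isomorphism for
every `M`, since the augmentation of the bar resolution is a homotopy equivalence of complexes of
left `A`-modules (`quasiIso_tensorRight_barBimoduleAug`). For such an `S`, the functors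
`- ⊗ S` and `Hom_B(S, -)` are adjoint, the second preserves quasi-isomorphisms, and the bar
resolution gives enough K-projectives over `A`. Hence (`givesDGMoritaEquivalence_iff`) `T` gives a
Morita equivalence if and only if

* the unit `W ⟶ Hom_B(S, W ⊗ S)` is a quasi-isomorphism for every K-projective `W`, and
* `Hom_B(S, -)` reflects quasi-isomorphisms.

The same criterion applies to `k' ⊗ S ⟶ k' ⊗ T`, although `k' ⊗ S` is not the bar resolution of
`k' ⊗ T` over `k'` by definition: K-projectivity and the property of the augmentation survive the
extension of scalars (`IsKProjective.baseChange`, `quasiIso_tensorRight_baseChange`).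

Both conditions pass from `S` to `k' ⊗ S` along the restriction of scalars `res` from DG modules
over `k' ⊗ A` or `k' ⊗ B` to DG modules over `A` or `B`, which preserves and reflects
quasi-isomorphisms. Graded maps `k' ⊗ S ⟶ N` are
graded maps `S ⟶ res N`, which gives the second condition
(`quasiIso_of_homMap_baseChange`). For the first, `res W ⊗ S` is `res (W ⊗ (k' ⊗ S))`
(`quasiIso_tensorRes`), so that the unit at `W` for `k' ⊗ S` is the unit at `res W` for `S`; and
`res W` is K-projective if `W` is (`IsKProjective.res`), because the right adjoint of `res`, given
by the linear maps out of `k'`, preserves acyclicity over a field. No finiteness of `k'` over `k` is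
needed.
-/

noncomputable section

namespace DGModule

open CochainComplex.HomComplex

section QuasiIso

variable {k : Type u} [CommRing k]

/-- A chain map is a quasi-isomorphism at `n` if and only if it is injective and surjective on
cohomology classes in degree `n`. -/
lemma quasiIsoAt_iff_elements {K L : CochainComplex (ModuleCat.{u} k) ℤ} (f : K ⟶ L)
    (i n j : ℤ) (hi : i + 1 = n) (hj : n + 1 = j) :
    QuasiIsoAt f n ↔
      (∀ x : K.X n, (K.d n j).hom x = 0 → (∃ y : L.X i, (L.d i n).hom y = (f.f n).hom x) →
        ∃ z : K.X i, (K.d i n).hom z = x) ∧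
      (∀ y : L.X n, (L.d n j).hom y = 0 → ∃ x : K.X n, (K.d n j).hom x = 0 ∧
        ∃ z : L.X i, (L.d i n).hom z = y - (f.f n).hom x) := by
  rw [quasiIsoAt_iff' f i n j (by simp; omega) (by simp; omega)]
  let φ := (HomologicalComplex.shortComplexFunctor' (ModuleCat.{u} k) (ComplexShape.up ℤ)
    i n j).map f
  let γ : ShortComplex.LeftHomologyMapData φ (ShortComplex.moduleCatLeftHomologyData _)
    (ShortComplex.moduleCatLeftHomologyData _) := default
  rw [γ.quasiIso_iff, ConcreteCategory.isIso_iff_bijective]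
  have hK (x) : (γ.φK.hom x).1 = (f.f n).hom x.1 := congr(($γ.commi).hom x)
  have hH (x) : γ.φH.hom (Submodule.Quotient.mk x) = Submodule.Quotient.mk (γ.φK.hom x) :=
    congr(($γ.commπ).hom x)
  refine and_congr ⟨fun h x hx hy => ?_, fun h => ?_⟩ ⟨fun h y hy => ?_, fun h => ?_⟩
  · obtain ⟨y, hy⟩ := hy
    have e : γ.φH.hom (Submodule.Quotient.mk ⟨x, hx⟩) = γ.φH.hom 0 := by
      rw [hH, map_zero]
      refine (Submodule.Quotient.mk_eq_zero _).2 ⟨y, Subtype.ext ?_⟩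
      exact hy.trans (hK ⟨x, hx⟩).symm
    obtain ⟨z, hz⟩ := (Submodule.Quotient.mk_eq_zero _).1 (h e)
    exact ⟨z, congr(Subtype.val $hz)⟩
  · refine (injective_iff_map_eq_zero γ.φH.hom).2 fun a ha => ?_
    obtain ⟨⟨x, hx⟩, rfl⟩ := Submodule.Quotient.mk_surjective _ a
    rw [hH] at ha
    obtain ⟨y, hy⟩ := (Submodule.Quotient.mk_eq_zero _).1 ha
    obtain ⟨z, hz⟩ := h x hx ⟨y, congr(Subtype.val $hy).trans (hK ⟨x, hx⟩)⟩
    exact (Submodule.Quotient.mk_eq_zero _).2 ⟨z, Subtype.ext hz⟩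
  · obtain ⟨a, ha⟩ := h (Submodule.Quotient.mk ⟨y, hy⟩)
    obtain ⟨⟨x, hx⟩, rfl⟩ := Submodule.Quotient.mk_surjective _ a
    have ha := (hH ⟨x, hx⟩).symm.trans ha
    obtain ⟨z, hz⟩ := (Submodule.Quotient.eq _).1 ha.symm
    exact ⟨x, hx, z, congr(Subtype.val $hz).trans (congrArg (fun w : L.X n => y - w) (hK ⟨x, hx⟩))⟩
  · intro b
    obtain ⟨⟨y, hy⟩, rfl⟩ := Submodule.Quotient.mk_surjective _ b
    obtain ⟨x, hx, z, hz⟩ := h y hy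
    refine ⟨Submodule.Quotient.mk ⟨x, hx⟩, (hH ⟨x, hx⟩).trans (Eq.symm ?_)⟩
    rw [← hK ⟨x, hx⟩] at hz
    exact (Submodule.Quotient.eq _).2 ⟨z, Subtype.ext hz⟩

end QuasiIso

variable {k : Type u} [CommRing k] {A B C : DGAlgebra k}

lemma quasiIso_iff_elements {M N : DGModule A} (f : M ⟶ N) :
    quasiIso A f ↔ ∀ i n j : ℤ, i + 1 = n → n + 1 = j →
      (∀ x : M.cx.X n, (M.cx.d n j).hom x = 0 →
        (∃ y : N.cx.X i, (N.cx.d i n).hom y = (f.f.f n).hom x) →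
          ∃ z : M.cx.X i, (M.cx.d i n).hom z = x) ∧
      (∀ y : N.cx.X n, (N.cx.d n j).hom y = 0 → ∃ x : M.cx.X n, (M.cx.d n j).hom x = 0 ∧
        ∃ z : N.cx.X i, (N.cx.d i n).hom z = y - (f.f.f n).hom x) := by
  change QuasiIso f.f ↔ _
  rw [_root_.quasiIso_iff]
  constructor
  · intro h i n j hi hj
    exact (quasiIsoAt_iff_elements f.f i n j hi hj).1 (h n)
  · intro h n
    exact (quasiIsoAt_iff_elements f.f (n - 1) n (n + 1) (by omega) rfl).2 (h _ _ _ (by omega) rfl)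

lemma hom_units_smul {V W : ModuleCat.{u} k} (f : V ⟶ W) (e : ℤˣ) (x : V) :
    (e • f).hom x = e • f.hom x := by
  rcases Int.units_eq_one_or e with rfl | rfl <;> simp

section Elements

variable {K L P : CochainComplex (ModuleCat.{u} k) ℤ}

lemma cochain_ext {n : ℤ} {z w : Cochain K L n}
    (H : ∀ (p q : ℤ) (h : p + n = q) (x : K.X p), (z.v p q h).hom x = (w.v p q h).hom x) :
    z = w := by
  ext p q h x
  exact H p q h x

lemma cochain_comp_apply {a b c : ℤ} (z : Cochain K L a) (w : Cochain L P b) (h : a + b = c)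
    (p q r : ℤ) (hpq : p + a = q) (hqr : q + b = r) (x : K.X p) :
    ((z.comp w h).v p r (by omega)).hom x = (w.v q r hqr).hom ((z.v p q hpq).hom x) := by
  rw [Cochain.comp_v _ _ h p q r hpq hqr]
  rfl

lemma cochain_δ_apply {a b : ℤ} (hab : a + 1 = b) (z : Cochain K L a) (p q p' q' : ℤ)
    (h : p + b = q) (hp : p + 1 = p') (hq : q' + 1 = q) (x : K.X p) :
    ((CochainComplex.HomComplex.δ a b z).v p q h).hom x =
      (L.d q' q).hom ((z.v p q' (by omega)).hom x) +
        b.negOnePow • (z.v p' q (by omega)).hom ((K.d p p').hom x) := by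
  rw [δ_v a b hab z p q h q' p' (by omega) hp, ModuleCat.hom_add, LinearMap.add_apply,
    hom_units_smul]
  rfl

end Elements

/-! ### Graded linear maps between DG modules -/

/-- The submodule of `A`-linear cochains of degree `n` from `M` to `N`. As `A` acts on the right,
linearity involves no sign. -/
def linearCochain (M N : DGModule A) (n : ℤ) : Submodule k (Cochain M.cx N.cx n) where
  carrier := {z | ∀ (i j l i' l' : ℤ) (h : i + j = l) (hi : i + n = i') (hl : l + n = l')
    (m : M.cx.X i) (a : A.cx.X j), (z.v l l' hl).hom (M.act i j l h m a) =
      N.act i' j l' (by omega) ((z.v i i' hi).hom m) a}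
  add_mem' := by
    intro z w hz hw i j l i' l' h hi hl m a
    simp [hz i j l i' l' h hi hl m a, hw i j l i' l' h hi hl m a]
  zero_mem' := by
    intro i j l i' l' h hi hl m a
    simp
  smul_mem' := by
    intro c z hz i j l i' l' h hi hl m a
    simp [hz i j l i' l' h hi hl m a]

/-- The `A`-linear graded maps of degree `n` from `M` to `N`, which need not commute with the
differentials: the morphisms of degree `n` of the DG category of DG modules. -/
abbrev GHom (M N : DGModule A) (n : ℤ) : Type u := linearCochain M N n

namespace GHom

variable {M N P Q : DGModule A}

/-- The value of a graded map on an element of degree `p`. -/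
abbrev ap {n : ℤ} (z : GHom M N n) (p q : ℤ) (h : p + n = q) : M.cx.X p →ₗ[k] N.cx.X q :=
  (z.1.v p q h).hom

lemma ext {n : ℤ} {z w : GHom M N n}
    (H : ∀ (p q : ℤ) (h : p + n = q) (x : M.cx.X p), z.ap p q h x = w.ap p q h x) : z = w :=
  Subtype.ext (cochain_ext H)

lemma map_act {n : ℤ} (z : GHom M N n) (i j l i' l' : ℤ) (h : i + j = l) (hi : i + n = i')
    (hl : l + n = l') (m : M.cx.X i) (a : A.cx.X j) :
    z.ap l l' hl (M.act i j l h m a) = N.act i' j l' (by omega) (z.ap i i' hi m) a :=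
  z.2 i j l i' l' h hi hl m a

/-- The closed graded map of degree `0` given by a morphism of DG modules. -/
def ofHom (f : M ⟶ N) : GHom M N 0 :=
  ⟨Cochain.ofHom f.f, by
    intro i j l i' l' h hi hl m a
    obtain rfl : i' = i := by omega
    obtain rfl : l' = l := by omega
    simpa using Hom.map_act f i' j l' h m a⟩

/-- The identity, as a graded map of degree `0`. -/
abbrev id (M : DGModule A) : GHom M M 0 := ofHom (𝟙 M)

/-- The composition of graded maps, in diagrammatic order. -/
def comp {a b c : ℤ} (z : GHom M N a) (w : GHom N P b) (h : a + b = c) : GHom M P c :=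
  ⟨z.1.comp w.1 h, by
    intro i j l i' l' hijl hi hl m x
    rw [cochain_comp_apply _ _ h i (i + a) i' rfl (by omega),
      cochain_comp_apply _ _ h l (l + a) l' rfl (by omega),
      z.map_act i j l (i + a) (l + a) hijl rfl rfl,
      w.map_act (i + a) j (l + a) i' l' (by omega) (by omega) (by omega)]⟩

/-- The differential of the complex of graded maps. -/
def δ (a b : ℤ) : GHom M N a →ₗ[k] GHom M N b :=
  (δ_hom k M.cx N.cx a b).restrict (by
    intro z hz i j l i' l' h hi hl m x
    by_cases hab : a + 1 = b
    · have hz' (i j l i' l' : ℤ) (h : i + j = l) (hi : i + a = i') (hl : l + a = l')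
        (m : M.cx.X i) (x : A.cx.X j) : (z.v l l' hl).hom (M.act i j l h m x) =
        N.act i' j l' (by omega) ((z.v i i' hi).hom m) x := hz i j l i' l' h hi hl m x
      simp only [δ_hom_apply]
      rw [cochain_δ_apply hab z i i' (i + 1) (i + a) hi rfl (by omega),
        cochain_δ_apply hab z l l' (l + 1) (l + a) hl rfl (by omega),
        hz' i j l (i + a) (l + a) h rfl rfl,
        N.d_act (i + a) i' j (j + 1) (l + a) l' (by omega) rfl (by omega),
        M.d_act i (i + 1) j (j + 1) l (l + 1) rfl rfl rfl, map_add, map_zsmul_unit,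
        hz' (i + 1) j (l + 1) i' l' (by omega) (by omega) (by omega),
        hz' i (j + 1) (l + 1) (i + a) l' (by omega) (by omega) (by omega), map_add,
        LinearMap.add_apply, map_zsmul_unit, LinearMap.smul_apply, smul_add, smul_smul]
      have e : b.negOnePow * i.negOnePow = - (i + a).negOnePow := by
        rw [← hab, ← Int.negOnePow_add, ← Int.negOnePow_succ]
        congr 1
        ring
      rw [e, Units.neg_smul]
      abel
    · simp [δ_shape _ _ hab])

@[simp] lemma ofHom_coe (f : M ⟶ N) : (ofHom f).1 = Cochain.ofHom f.f := rfl

@[simp] lemma δ_coe {a b : ℤ} (z : GHom M N a) :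
    (δ a b z).1 = CochainComplex.HomComplex.δ a b z.1 := rfl

lemma ofHom_apply (f : M ⟶ N) (p : ℤ) (x : M.cx.X p) :
    (ofHom f).ap p p (add_zero p) x = (f.f.f p).hom x := by
  simp [ap]

lemma comp_apply {a b c : ℤ} (z : GHom M N a) (w : GHom N P b) (h : a + b = c)
    (p q r : ℤ) (hpq : p + a = q) (hqr : q + b = r) (x : M.cx.X p) :
    (z.comp w h).ap p r (by omega) x = w.ap q r hqr (z.ap p q hpq x) :=
  cochain_comp_apply z.1 w.1 h p q r hpq hqr x

lemma δ_apply {a b : ℤ} (hab : a + 1 = b) (z : GHom M N a) (p q p' q' : ℤ)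
    (h : p + b = q) (hp : p + 1 = p') (hq : q' + 1 = q) (x : M.cx.X p) :
    (δ a b z).ap p q h x = (N.cx.d q' q).hom (z.ap p q' (by omega) x) +
        b.negOnePow • z.ap p' q (by omega) ((M.cx.d p p').hom x) :=
  cochain_δ_apply hab z.1 p q p' q' h hp hq x

@[simp] lemma id_comp {n : ℤ} (z : GHom M N n) : (id M).comp z (zero_add n) = z :=
  Subtype.ext (Cochain.id_comp z.1)

@[simp] lemma comp_id {n : ℤ} (z : GHom M N n) : z.comp (id N) (add_zero n) = z :=
  Subtype.ext (Cochain.comp_id z.1)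

lemma comp_assoc {a b c ab bc abc : ℤ} (z : GHom M N a) (w : GHom N P b) (t : GHom P Q c)
    (h₁ : a + b = ab) (h₂ : b + c = bc) (h : a + b + c = abc) :
    (z.comp w h₁).comp t (by omega) = z.comp (w.comp t h₂) (by omega : a + bc = abc) :=
  Subtype.ext (Cochain.comp_assoc z.1 w.1 t.1 h₁ h₂ h)

lemma ofHom_comp (f : M ⟶ N) (g : N ⟶ P) :
    ofHom (f ≫ g) = (ofHom f).comp (ofHom g) (add_zero 0) :=
  Subtype.ext (Cochain.ofHom_comp f.f g.f)

lemma add_comp {a b c : ℤ} (z z' : GHom M N a) (w : GHom N P b) (h : a + b = c) :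
    (z + z').comp w h = z.comp w h + z'.comp w h :=
  Subtype.ext (Cochain.add_comp z.1 z'.1 w.1 h)

lemma sub_comp {a b c : ℤ} (z z' : GHom M N a) (w : GHom N P b) (h : a + b = c) :
    (z - z').comp w h = z.comp w h - z'.comp w h :=
  Subtype.ext (Cochain.sub_comp z.1 z'.1 w.1 h)

lemma neg_comp {a b c : ℤ} (z : GHom M N a) (w : GHom N P b) (h : a + b = c) :
    (-z).comp w h = -z.comp w h :=
  Subtype.ext (Cochain.neg_comp z.1 w.1 h)

lemma zero_comp {a b c : ℤ} (w : GHom N P b) (h : a + b = c) :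
    (0 : GHom M N a).comp w h = 0 :=
  Subtype.ext (Cochain.zero_comp w.1 h)

lemma smul_comp {a b c : ℤ} (r : k) (z : GHom M N a) (w : GHom N P b) (h : a + b = c) :
    (r • z).comp w h = r • z.comp w h :=
  Subtype.ext (Cochain.smul_comp r z.1 w.1 h)

lemma comp_add {a b c : ℤ} (z : GHom M N a) (w w' : GHom N P b) (h : a + b = c) :
    z.comp (w + w') h = z.comp w h + z.comp w' h :=
  Subtype.ext (Cochain.comp_add z.1 w.1 w'.1 h)

lemma comp_sub {a b c : ℤ} (z : GHom M N a) (w w' : GHom N P b) (h : a + b = c) :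
    z.comp (w - w') h = z.comp w h - z.comp w' h :=
  Subtype.ext (Cochain.comp_sub z.1 w.1 w'.1 h)

lemma comp_neg {a b c : ℤ} (z : GHom M N a) (w : GHom N P b) (h : a + b = c) :
    z.comp (-w) h = -z.comp w h :=
  Subtype.ext (Cochain.comp_neg z.1 w.1 h)

lemma comp_zero {a b c : ℤ} (z : GHom M N a) (h : a + b = c) :
    z.comp (0 : GHom N P b) h = 0 :=
  Subtype.ext (Cochain.comp_zero z.1 h)

lemma comp_smul {a b c : ℤ} (r : k) (z : GHom M N a) (w : GHom N P b) (h : a + b = c) :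
    z.comp (r • w) h = r • z.comp w h :=
  Subtype.ext (Cochain.comp_smul z.1 r w.1 h)

@[simp] lemma δ_δ (a b c : ℤ) (z : GHom M N a) : δ b c (δ a b z) = 0 :=
  Subtype.ext (CochainComplex.HomComplex.δ_δ a b c z.1)

lemma δ_shape {a b : ℤ} (h : ¬ a + 1 = b) (z : GHom M N a) : δ a b z = 0 :=
  Subtype.ext (CochainComplex.HomComplex.δ_shape a b h z.1)

@[simp] lemma δ_ofHom (f : M ⟶ N) (n : ℤ) : δ 0 n (ofHom f) = 0 :=
  Subtype.ext (CochainComplex.HomComplex.δ_ofHom f.f)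

lemma δ_comp {a b c a' b' c' : ℤ} (z : GHom M N a) (w : GHom N P b) (h : a + b = c)
    (h₁ : a + 1 = a') (h₂ : b + 1 = b') (h₃ : c + 1 = c') :
    δ c c' (z.comp w h) = z.comp (δ b b' w) (by omega) +
      b.negOnePow • (δ a a' z).comp w (by omega) :=
  Subtype.ext (CochainComplex.HomComplex.δ_comp z.1 w.1 h a' b' c' h₃ h₁ h₂)

/-- The morphism of DG modules given by a closed graded map of degree `0`. -/
def toHom (z : GHom M N 0) (hz : δ 0 1 z = 0) : M ⟶ N :=
  { f := Cocycle.homOf (Cocycle.mk z.1 1 (zero_add 1) congr(Subtype.val $hz))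
    map_act := fun i j n h m a => z.map_act i j n i n h (add_zero i) (add_zero n) m a }

lemma ofHom_toHom (z : GHom M N 0) (hz : δ 0 1 z = 0) : ofHom (toHom z hz) = z :=
  Subtype.ext (Cocycle.cochain_ofHom_homOf_eq_coe _)

lemma ofHom_injective {f g : M ⟶ N} (h : ofHom f = ofHom g) : f = g := by
  ext n x
  rw [← ofHom_apply, h, ofHom_apply]

end GHom
end DGModule

namespace DGModule

open CochainComplex.HomComplex

variable {k : Type u} [CommRing k] {A B C : DGAlgebra k}

/-- A chain map with an inverse up to homotopy is a quasi-isomorphism; the inverse and the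
homotopies need not be linear over the DG algebra. -/
lemma quasiIso_of_homotopy {M N : DGModule A} (f : M ⟶ N) (g : Cochain N.cx M.cx 0)
    (hg : δ 0 1 g = 0) (h : Cochain M.cx M.cx (-1)) (h' : Cochain N.cx N.cx (-1))
    (hh : δ (-1) 0 h = Cochain.ofHom (𝟙 M.cx) - (Cochain.ofHom f.f).comp g (add_zero 0))
    (hh' : δ (-1) 0 h' = Cochain.ofHom (𝟙 N.cx) - g.comp (Cochain.ofHom f.f) (add_zero 0)) :
    quasiIso A f := by
  let g' : N.cx ⟶ M.cx := Cocycle.homOf (Cocycle.mk g 1 (zero_add 1) hg)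
  have hg' : Cochain.ofHom g' = g := Cocycle.cochain_ofHom_homOf_eq_coe _
  let e : HomotopyEquiv M.cx N.cx :=
    { hom := f.f
      inv := g'
      homotopyHomInvId := (Cochain.equivHomotopy _ _).symm ⟨-h, by
        rw [δ_neg, hh, Cochain.ofHom_comp, hg']; abel⟩
      homotopyInvHomId := (Cochain.equivHomotopy _ _).symm ⟨-h', by
        rw [δ_neg, hh', Cochain.ofHom_comp, hg']; abel⟩ }
  exact e.quasiIso_hom

/-- A morphism of DG modules is a homotopy equivalence. -/
def IsHomotopyEquiv {M N : DGModule A} (f : M ⟶ N) : Prop :=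
  ∃ (g : GHom N M 0) (h : GHom M M (-1)) (h' : GHom N N (-1)), GHom.δ 0 1 g = 0 ∧
    GHom.δ (-1) 0 h = GHom.id M - (GHom.ofHom f).comp g (add_zero 0) ∧
    GHom.δ (-1) 0 h' = GHom.id N - g.comp (GHom.ofHom f) (add_zero 0)

lemma IsHomotopyEquiv.quasiIso {M N : DGModule A} {f : M ⟶ N} (hf : IsHomotopyEquiv f) :
    quasiIso A f := by
  obtain ⟨g, h, h', hg, hh, hh'⟩ := hf
  exact quasiIso_of_homotopy f g.1 congr(Subtype.val $hg) h.1 h'.1 congr(Subtype.val $hh)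
    congr(Subtype.val $hh')

/-! ### The universal graded maps of shifts and cones -/

/-- The identity of `M` as a graded map `M[1] ⟶ M` of degree `1`. -/
def unshift (M : DGModule A) : GHom M.shift M 1 :=
  ⟨Cochain.mk fun p q h => (M.cx.XIsoOfEq h).hom, by
    intro i j l i' l' h hi hl m a
    subst hi hl
    rfl⟩

/-- The identity of `M` as a graded map `M ⟶ M[1]` of degree `-1`. -/
def toShift (M : DGModule A) : GHom M M.shift (-1) :=
  ⟨Cochain.mk fun p q h => (M.cx.XIsoOfEq (by lia : p = q + 1)).hom, by
    intro i j l i' l' h hi hl m a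
    obtain rfl : i = i' + 1 := by lia
    obtain rfl : l = l' + 1 := by lia
    rfl⟩

lemma unshift_apply (M : DGModule A) (p : ℤ) (h : p + 1 = p + 1) (x : M.shift.cx.X p) :
    (unshift M).ap p (p + 1) h x = x := rfl

@[simp] lemma unshift_toShift (M : DGModule A) :
    (unshift M).comp (toShift M) (by lia) = GHom.id M.shift := by
  apply GHom.ext
  intro p q h x
  obtain rfl : p = q := by lia
  rw [GHom.comp_apply _ _ _ p (p + 1) p rfl (by lia), GHom.ofHom_apply]
  rfl

@[simp] lemma toShift_unshift (M : DGModule A) :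
    (toShift M).comp (unshift M) (by lia) = GHom.id M := by
  apply GHom.ext
  intro p q h x
  obtain rfl : p = q := by lia
  obtain ⟨r, rfl⟩ : ∃ r, p = r + 1 := ⟨p - 1, by lia⟩
  rw [GHom.comp_apply _ _ _ (r + 1) r (r + 1) (by lia) (by lia), GHom.ofHom_apply]
  rfl

@[simp] lemma δ_unshift (M : DGModule A) (n : ℤ) : GHom.δ 1 n (unshift M) = 0 := by
  by_cases hn : 1 + 1 = n
  · apply GHom.ext
    intro p q h x
    subst hn
    obtain rfl : q = p + 1 + 1 := by lia
    rw [GHom.δ_apply rfl _ p (p + 1 + 1) (p + 1) (p + 1) _ rfl rfl, unshift_apply, unshift_apply]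
    have : ((M.shift.cx).d p (p + 1)).hom x = -(M.cx.d (p + 1) (p + 1 + 1)).hom x :=
      (hom_units_smul (M.cx.d (p + 1) (p + 1 + 1)) (1 : ℤ).negOnePow x).trans (by simp)
    rw [this, show ((1 : ℤ) + 1).negOnePow = 1 from Int.negOnePow_even 2 (by decide), one_smul]
    exact add_neg_cancel (G := M.cx.X (p + 1 + 1)) _
  · exact GHom.δ_shape hn _

@[simp] lemma δ_toShift (M : DGModule A) (n : ℤ) : GHom.δ (-1) n (toShift M) = 0 := by
  by_cases hn : -1 + 1 = n
  · obtain rfl : n = 0 := by lia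
    have h := GHom.δ_comp (unshift M) (toShift M) (c := 0) (by lia) (by lia : (1 : ℤ) + 1 = 2)
      (by lia : -1 + 1 = 0) (by lia : (0 : ℤ) + 1 = 1)
    rw [unshift_toShift, GHom.δ_ofHom, δ_unshift, GHom.zero_comp, smul_zero, add_zero] at h
    have h' := congrArg (fun z => (toShift M).comp z (by lia : -1 + 1 = 0)) h.symm
    simp only [GHom.comp_zero] at h'
    rwa [← GHom.comp_assoc (toShift M) (unshift M) _ (by lia : -1 + 1 = 0) (by lia) (by lia),
      toShift_unshift, GHom.id_comp] at h'
  · exact GHom.δ_shape hn _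

/-- The functoriality of the shift, with the shifted modules displayed. -/
abbrev shiftMap {M N : DGModule A} (f : M ⟶ N) : M.shift ⟶ N.shift := (shiftFunctor A).map f

lemma unshift_naturality {M N : DGModule A} (f : M ⟶ N) :
    (GHom.ofHom (shiftMap f)).comp (unshift N) (zero_add 1) =
      (unshift M).comp (GHom.ofHom f) (add_zero 1) := by
  apply GHom.ext
  intro p q h x
  subst h
  rw [GHom.comp_apply _ _ _ p p (p + 1) (by lia) rfl,
    GHom.comp_apply _ _ _ p (p + 1) (p + 1) rfl (by lia), GHom.ofHom_apply, GHom.ofHom_apply]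
  rfl

section Cone

variable {M N : DGModule A} (f : M ⟶ N)

/-- The projection from the cone to its first summand, as a graded map. -/
def fstG : GHom (cone f) M 1 :=
  ⟨(CochainComplex.mappingCone.fst f.f).1, by
    intro i j l i' l' h hi hl m a
    exact coneFst_act f i j l i' l' h hi hl m a⟩

/-- The projection from the cone to its second summand, as a graded map. -/
def sndG : GHom (cone f) N 0 :=
  ⟨CochainComplex.mappingCone.snd f.f, by
    intro i j l i' l' h hi hl m a
    obtain rfl : i = i' := by lia
    obtain rfl : l = l' := by lia
    exact coneSnd_act f i j l h m a⟩

/-- The inclusion in the cone of its first summand, as a graded map. -/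
def inlG : GHom M (cone f) (-1) :=
  ⟨CochainComplex.mappingCone.inl f.f, by
    intro i j l i' l' h hi hl m a
    refine cone_ext (f := f) (i := l') (j := l) (by lia) ?_ ?_
    · exact (coneFst_inl f l' l (by lia) _).trans (((coneFst_act f i' j l' i l (by lia) (by lia)
        (by lia) _ a).trans (congrArg (fun x => M.act i j l h x a)
          (coneFst_inl f i' i (by lia) m))).symm)
    · exact (coneSnd_inl f l' l (by lia) _).trans (((coneSnd_act f i' j l' (by lia) _ a).trans
        ((congrArg (fun x => N.act i' j l' (by lia) x a) (coneSnd_inl f i' i (by lia) m)).trans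
          (by simp))).symm)⟩

/-- The inclusion in the cone of its second summand, as a graded map. -/
abbrev inrG : GHom N (cone f) 0 := GHom.ofHom (coneInclusion f)

@[simp] lemma inlG_fstG : (inlG f).comp (fstG f) (by lia) = GHom.id M :=
  Subtype.ext (CochainComplex.mappingCone.inl_fst f.f)

@[simp] lemma inlG_sndG : (inlG f).comp (sndG f) (add_zero (-1)) = 0 :=
  Subtype.ext (CochainComplex.mappingCone.inl_snd f.f)

@[simp] lemma inrG_fstG : (inrG f).comp (fstG f) (zero_add 1) = 0 :=
  Subtype.ext (CochainComplex.mappingCone.inr_fst f.f)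

@[simp] lemma inrG_sndG : (inrG f).comp (sndG f) (zero_add 0) = GHom.id N :=
  Subtype.ext (CochainComplex.mappingCone.inr_snd f.f)

lemma cone_id : (fstG f).comp (inlG f) (by lia) + (sndG f).comp (inrG f) (add_zero 0) =
    GHom.id (cone f) :=
  Subtype.ext (CochainComplex.mappingCone.id f.f)

@[simp] lemma δ_fstG (n : ℤ) : GHom.δ 1 n (fstG f) = 0 :=
  Subtype.ext (Cocycle.δ_eq_zero (CochainComplex.mappingCone.fst f.f) n)

@[simp] lemma δ_inlG :
    GHom.δ (-1) 0 (inlG f) = (GHom.ofHom f).comp (inrG f) (add_zero 0) :=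
  Subtype.ext ((CochainComplex.mappingCone.δ_inl f.f).trans (Cochain.ofHom_comp _ _))

@[simp] lemma δ_sndG :
    GHom.δ 0 1 (sndG f) = -(fstG f).comp (GHom.ofHom f) (add_zero 1) :=
  Subtype.ext (CochainComplex.mappingCone.δ_snd f.f)

lemma coneProjection_unshift :
    (GHom.ofHom (coneProjection f)).comp (unshift M) (zero_add 1) = -fstG f := by
  apply GHom.ext
  intro p q h x
  subst h
  rw [GHom.comp_apply _ _ _ p p (p + 1) (by lia) rfl, unshift_apply, GHom.ofHom_apply]
  exact triangle_mor₃_f f p x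

end Cone

/-! ### DG functors -/

variable (A B) in
/-- A DG functor from DG `A`-modules to DG `B`-modules: it acts on graded maps of all degrees,
compatibly with linear combinations, compositions and differentials. -/
structure DGFun where
  /-- The action on objects. -/
  obj : DGModule A → DGModule B
  /-- The action on graded maps. -/
  map {M N : DGModule A} {n : ℤ} : GHom M N n →ₗ[k] GHom (obj M) (obj N) n
  map_id (M : DGModule A) : map (GHom.id M) = GHom.id (obj M)
  map_comp {M N P : DGModule A} {a b c : ℤ} (z : GHom M N a) (w : GHom N P b) (h : a + b = c) :
    map (z.comp w h) = (map z).comp (map w) h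
  map_δ {M N : DGModule A} {a b : ℤ} (h : a + 1 = b) (z : GHom M N a) :
    map (GHom.δ a b z) = GHom.δ a b (map z)

namespace DGFun

/-- The composition of DG functors. -/
def comp (Φ : DGFun A B) (Ψ : DGFun B C) : DGFun A C where
  obj M := Ψ.obj (Φ.obj M)
  map := Ψ.map.comp Φ.map
  map_id M := by simp [Φ.map_id, Ψ.map_id]
  map_comp z w h := by simp [Φ.map_comp, Ψ.map_comp]
  map_δ h z := by simp [Φ.map_δ h, Ψ.map_δ h]

variable (Φ : DGFun A B)

/-- The functor on the categories of DG modules underlying a DG functor. -/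
@[simps, reducible]
def functor : DGModule A ⥤ DGModule B where
  obj := Φ.obj
  map f := GHom.toHom (Φ.map (GHom.ofHom f)) (by
    rw [← Φ.map_δ (zero_add 1), GHom.δ_ofHom, map_zero])
  map_id M := GHom.ofHom_injective (by rw [GHom.ofHom_toHom, Φ.map_id])
  map_comp f g := GHom.ofHom_injective (by
    rw [GHom.ofHom_toHom, GHom.ofHom_comp, GHom.ofHom_comp, GHom.ofHom_toHom, GHom.ofHom_toHom,
      Φ.map_comp])

lemma ofHom_functor_map {M N : DGModule A} (f : M ⟶ N) :
    GHom.ofHom (Φ.functor.map f) = Φ.map (GHom.ofHom f) := by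
  rw [functor_map, GHom.ofHom_toHom]

lemma isHomotopyEquiv_map {M N : DGModule A} {f : M ⟶ N} (hf : IsHomotopyEquiv f) :
    IsHomotopyEquiv (Φ.functor.map f) := by
  obtain ⟨g, h, h', hg, hh, hh'⟩ := hf
  refine ⟨Φ.map g, Φ.map h, Φ.map h', ?_, ?_, ?_⟩
  · rw [← Φ.map_δ (by lia), hg, map_zero]
  · rw [← Φ.map_δ (by lia), hh, map_sub, Φ.map_id, Φ.map_comp, ofHom_functor_map]
  · rw [← Φ.map_δ (by lia), hh', map_sub, Φ.map_id, Φ.map_comp, ofHom_functor_map]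

/-- A DG functor commutes with the shift. -/
def shiftIsoObj (M : DGModule A) : Φ.obj M.shift ≅ (Φ.obj M).shift where
  hom := GHom.toHom ((Φ.map (unshift M)).comp (toShift (Φ.obj M)) (by lia)) (by
    rw [GHom.δ_comp _ _ (by lia) (by lia : (1 : ℤ) + 1 = 2) (by lia : (-1 : ℤ) + 1 = 0) (by lia),
      ← Φ.map_δ (by lia)]
    simp [GHom.zero_comp, GHom.comp_zero])
  inv := GHom.toHom ((unshift (Φ.obj M)).comp (Φ.map (toShift M)) (by lia)) (by
    rw [GHom.δ_comp _ _ (by lia) (by lia : (1 : ℤ) + 1 = 2) (by lia : (-1 : ℤ) + 1 = 0) (by lia),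
      ← Φ.map_δ (by lia)]
    simp [GHom.zero_comp, GHom.comp_zero])
  hom_inv_id := GHom.ofHom_injective (by
    rw [GHom.ofHom_comp, GHom.ofHom_toHom, GHom.ofHom_toHom,
      GHom.comp_assoc (Φ.map (unshift M)) (toShift (Φ.obj M)) _ (by lia)
        (by lia : (-1 : ℤ) + 0 = -1) (by lia),
      ← GHom.comp_assoc (toShift (Φ.obj M)) (unshift (Φ.obj M)) (Φ.map (toShift M))
        (by lia : (-1 : ℤ) + 1 = 0) (by lia) (by lia), toShift_unshift, GHom.id_comp,
      ← Φ.map_comp, unshift_toShift, Φ.map_id])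
  inv_hom_id := GHom.ofHom_injective (by
    rw [GHom.ofHom_comp, GHom.ofHom_toHom, GHom.ofHom_toHom,
      GHom.comp_assoc (unshift (Φ.obj M)) (Φ.map (toShift M)) _ (by lia)
        (by lia : (-1 : ℤ) + 0 = -1) (by lia),
      ← GHom.comp_assoc (Φ.map (toShift M)) (Φ.map (unshift M)) (toShift (Φ.obj M))
        (by lia : (-1 : ℤ) + 1 = 0) (by lia) (by lia), ← Φ.map_comp, toShift_unshift, Φ.map_id,
      GHom.id_comp, unshift_toShift])

lemma shiftIsoObj_hom_unshift (M : DGModule A) :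
    (GHom.ofHom (Φ.shiftIsoObj M).hom).comp (unshift (Φ.obj M)) (zero_add 1) =
      Φ.map (unshift M) := by
  dsimp only [shiftIsoObj]
  rw [GHom.ofHom_toHom, GHom.comp_assoc (Φ.map (unshift M)) (toShift (Φ.obj M)) _ (by lia)
    (by lia : (-1 : ℤ) + 1 = 0) (by lia), toShift_unshift, GHom.comp_id]

/-- Morphisms to a shift are determined by the corresponding graded maps of degree `1`. -/
lemma hom_ext_unshift {M N : DGModule A} {f g : M ⟶ N.shift}
    (h : (GHom.ofHom f).comp (unshift N) (zero_add 1) =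
      (GHom.ofHom g).comp (unshift N) (zero_add 1)) : f = g := by
  apply GHom.ofHom_injective
  have := congrArg (fun z => GHom.comp z (toShift N) (by lia : (1 : ℤ) + -1 = 0)) h
  rwa [GHom.comp_assoc _ _ _ (zero_add 1) (by lia : (1 : ℤ) + -1 = 0) (by lia),
    GHom.comp_assoc _ _ _ (zero_add 1) (by lia : (1 : ℤ) + -1 = 0) (by lia), unshift_toShift,
    GHom.comp_id, GHom.comp_id] at this

lemma shiftIsoObj_naturality {M N : DGModule A} (f : M ⟶ N) :
    Φ.functor.map (shiftMap f) ≫ (Φ.shiftIsoObj N).hom =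
      (Φ.shiftIsoObj M).hom ≫ shiftMap (Φ.functor.map f) := by
  apply hom_ext_unshift
  rw [GHom.ofHom_comp, GHom.ofHom_comp,
    GHom.comp_assoc _ _ _ (zero_add 0) (zero_add 1) (by lia), shiftIsoObj_hom_unshift,
    GHom.comp_assoc _ _ _ (zero_add 0) (zero_add 1) (by lia), unshift_naturality,
    ← GHom.comp_assoc _ _ _ (zero_add 1) (add_zero 1) (by lia), shiftIsoObj_hom_unshift,
    ofHom_functor_map, ofHom_functor_map, ← Φ.map_comp, ← Φ.map_comp, unshift_naturality]

/-- A DG functor commutes with the shift. -/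
def shiftIso : shiftFunctor A ⋙ Φ.functor ≅ Φ.functor ⋙ shiftFunctor B :=
  NatIso.ofComponents Φ.shiftIsoObj Φ.shiftIsoObj_naturality

section Cone

variable {M N : DGModule A} (f : M ⟶ N)

/-- A DG functor preserves mapping cones. -/
def coneIso : Φ.obj (cone f) ≅ cone (Φ.functor.map f) where
  hom := GHom.toHom ((Φ.map (fstG f)).comp (inlG (Φ.functor.map f)) (by lia) +
      (Φ.map (sndG f)).comp (inrG (Φ.functor.map f)) (add_zero 0)) (by
    rw [map_add,
      GHom.δ_comp _ _ (by lia) (by lia : (1 : ℤ) + 1 = 2) (by lia : (-1 : ℤ) + 1 = 0) (by lia),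
      GHom.δ_comp _ _ (by lia) (by lia : (0 : ℤ) + 1 = 1) (by lia : (0 : ℤ) + 1 = 1) (by lia),
      ← Φ.map_δ (by lia), ← Φ.map_δ (by lia), δ_fstG, δ_inlG, δ_sndG, map_zero, GHom.zero_comp,
      smul_zero, add_zero, GHom.δ_ofHom, GHom.comp_zero, zero_add, Int.negOnePow_zero, one_smul,
      map_neg, GHom.neg_comp, ofHom_functor_map, Φ.map_comp,
      GHom.comp_assoc _ _ _ (add_zero 1) (zero_add 0) (by lia), add_neg_cancel])
  inv := GHom.toHom ((fstG (Φ.functor.map f)).comp (Φ.map (inlG f)) (by lia) +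
      (sndG (Φ.functor.map f)).comp (Φ.map (inrG f)) (add_zero 0)) (by
    rw [map_add,
      GHom.δ_comp _ _ (by lia) (by lia : (1 : ℤ) + 1 = 2) (by lia : (-1 : ℤ) + 1 = 0) (by lia),
      GHom.δ_comp _ _ (by lia) (by lia : (0 : ℤ) + 1 = 1) (by lia : (0 : ℤ) + 1 = 1) (by lia),
      ← Φ.map_δ (by lia), ← Φ.map_δ (by lia), δ_fstG, δ_inlG, δ_sndG, GHom.zero_comp,
      smul_zero, add_zero, GHom.δ_ofHom, map_zero, GHom.comp_zero, zero_add, Int.negOnePow_zero,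
      one_smul, GHom.neg_comp, ofHom_functor_map, Φ.map_comp,
      GHom.comp_assoc _ _ _ (add_zero 1) (zero_add 0) (by lia), add_neg_cancel])
  hom_inv_id := GHom.ofHom_injective (by
    rw [GHom.ofHom_comp, GHom.ofHom_toHom, GHom.ofHom_toHom, GHom.comp_add, GHom.add_comp,
      GHom.add_comp,
      GHom.comp_assoc _ (inlG _) _ (by lia) (by lia : (-1 : ℤ) + 0 = -1) (by lia),
      GHom.comp_assoc _ (inlG _) _ (by lia) (by lia : (-1 : ℤ) + 0 = -1) (by lia),
      GHom.comp_assoc _ (inrG _) _ (by lia) (by lia : (0 : ℤ) + 0 = 0) (by lia),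
      GHom.comp_assoc _ (inrG _) _ (by lia) (by lia : (0 : ℤ) + 0 = 0) (by lia),
      ← GHom.comp_assoc (inlG _) (fstG _) _ (by lia : (-1 : ℤ) + 1 = 0) (by lia) (by lia),
      ← GHom.comp_assoc (inlG _) (sndG _) _ (by lia : (-1 : ℤ) + 0 = -1) (by lia) (by lia),
      ← GHom.comp_assoc (inrG _) (fstG _) _ (by lia : (0 : ℤ) + 1 = 1) (by lia) (by lia),
      ← GHom.comp_assoc (inrG _) (sndG _) _ (by lia : (0 : ℤ) + 0 = 0) (by lia) (by lia),
      inlG_fstG, inlG_sndG, inrG_fstG, inrG_sndG, GHom.zero_comp, GHom.zero_comp, GHom.comp_zero,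
      GHom.comp_zero, GHom.id_comp, GHom.id_comp, add_zero, zero_add, ← Φ.map_comp, ← Φ.map_comp,
      ← map_add, cone_id, Φ.map_id])
  inv_hom_id := GHom.ofHom_injective (by
    rw [GHom.ofHom_comp, GHom.ofHom_toHom, GHom.ofHom_toHom, GHom.comp_add, GHom.add_comp,
      GHom.add_comp,
      GHom.comp_assoc _ (Φ.map (inlG _)) _ (by lia) (by lia : (-1 : ℤ) + 0 = -1) (by lia),
      GHom.comp_assoc _ (Φ.map (inlG _)) _ (by lia) (by lia : (-1 : ℤ) + 0 = -1) (by lia),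
      GHom.comp_assoc _ (Φ.map (inrG _)) _ (by lia) (by lia : (0 : ℤ) + 0 = 0) (by lia),
      GHom.comp_assoc _ (Φ.map (inrG _)) _ (by lia) (by lia : (0 : ℤ) + 0 = 0) (by lia),
      ← GHom.comp_assoc (Φ.map (inlG _)) (Φ.map (fstG _)) _ (by lia : (-1 : ℤ) + 1 = 0) (by lia)
        (by lia),
      ← GHom.comp_assoc (Φ.map (inlG _)) (Φ.map (sndG _)) _ (by lia : (-1 : ℤ) + 0 = -1)
        (by lia) (by lia),
      ← GHom.comp_assoc (Φ.map (inrG _)) (Φ.map (fstG _)) _ (by lia : (0 : ℤ) + 1 = 1) (by lia)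
        (by lia),
      ← GHom.comp_assoc (Φ.map (inrG _)) (Φ.map (sndG _)) _ (by lia : (0 : ℤ) + 0 = 0) (by lia)
        (by lia),
      ← Φ.map_comp, ← Φ.map_comp, ← Φ.map_comp, ← Φ.map_comp,
      inlG_fstG, inlG_sndG, inrG_fstG, inrG_sndG, map_zero, map_zero, Φ.map_id, Φ.map_id,
      GHom.zero_comp, GHom.zero_comp, GHom.comp_zero, GHom.comp_zero, GHom.id_comp, GHom.id_comp,
      add_zero, zero_add, cone_id])

lemma ofHom_coneIso_hom : GHom.ofHom (Φ.coneIso f).hom =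
    (Φ.map (fstG f)).comp (inlG (Φ.functor.map f)) (by lia) +
      (Φ.map (sndG f)).comp (inrG (Φ.functor.map f)) (add_zero 0) := by
  rw [coneIso, GHom.ofHom_toHom]

lemma map_coneInclusion_coneIso :
    Φ.functor.map (coneInclusion f) ≫ (Φ.coneIso f).hom = coneInclusion (Φ.functor.map f) := by
  apply GHom.ofHom_injective
  rw [GHom.ofHom_comp, ofHom_coneIso_hom, GHom.comp_add, ofHom_functor_map,
    ← GHom.comp_assoc _ (Φ.map (fstG _)) _ (by lia : (0 : ℤ) + 1 = 1) (by lia) (by lia),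
    ← GHom.comp_assoc _ (Φ.map (sndG _)) _ (by lia : (0 : ℤ) + 0 = 0) (by lia) (by lia),
    ← Φ.map_comp, ← Φ.map_comp, inrG_fstG, inrG_sndG, map_zero, GHom.zero_comp, zero_add,
    Φ.map_id, GHom.id_comp]

lemma map_coneProjection_shiftIsoObj :
    Φ.functor.map (coneProjection f) ≫ (Φ.shiftIsoObj M).hom =
      (Φ.coneIso f).hom ≫ coneProjection (Φ.functor.map f) := by
  apply hom_ext_unshift
  rw [GHom.ofHom_comp, GHom.ofHom_comp,
    GHom.comp_assoc _ _ _ (zero_add 0) (zero_add 1) (by lia), shiftIsoObj_hom_unshift,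
    GHom.comp_assoc _ _ _ (zero_add 0) (zero_add 1) (by lia), coneProjection_unshift,
    ofHom_functor_map, ← Φ.map_comp, coneProjection_unshift, ofHom_coneIso_hom,
    GHom.add_comp, GHom.comp_neg, GHom.comp_neg,
    GHom.comp_assoc _ (inlG _) _ (by lia) (by lia : (-1 : ℤ) + 1 = 0) (by lia),
    GHom.comp_assoc _ (inrG _) _ (by lia) (by lia : (0 : ℤ) + 1 = 1) (by lia),
    inlG_fstG, inrG_fstG, GHom.comp_zero, neg_zero, add_zero, GHom.comp_id, map_neg]

end Cone

end DGFun
end DGModule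

/-! ### Triangulated functors induced by DG functors -/

section Triangulated

open DGModule DGDerived

variable {k : Type u} [CommRing k] {A B : DGAlgebra k}

/-- A functor between derived categories induced by a DG functor is triangulated. -/
theorem DGDerived.isTriangulated_of_dgFun (Φ : DGFun A B) (F : DGDerived A ⥤ DGDerived B)
    (e : Q A ⋙ F ≅ Φ.functor ⋙ Q B) : IsTriangulated F := by
  let c' : Q A ⋙ (shiftFunctor A ⋙ F) ≅ Q A ⋙ (F ⋙ shiftFunctor B) :=
    (Functor.associator _ _ _).symm ≪≫ Functor.isoWhiskerRight (shiftIso A) F ≪≫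
      Functor.associator _ _ _ ≪≫ Functor.isoWhiskerLeft (DGModule.shiftFunctor A) e ≪≫
      (Functor.associator _ _ _).symm ≪≫ Functor.isoWhiskerRight Φ.shiftIso (Q B) ≪≫
      Functor.associator _ _ _ ≪≫ Functor.isoWhiskerLeft Φ.functor (shiftIso B).symm ≪≫
      (Functor.associator _ _ _).symm ≪≫ Functor.isoWhiskerRight e.symm (shiftFunctor B) ≪≫
      Functor.associator _ _ _
  let c : shiftFunctor A ⋙ F ≅ F ⋙ shiftFunctor B :=
    Localization.liftNatIso (Q A) (quasiIso A) _ _ _ _ c'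
  let sA (M : DGModule A) : (shiftFunctor A).obj ((Q A).obj M) ≅ (Q A).obj M.shift :=
    (shiftIso A).app M
  let sB (M : DGModule B) : (shiftFunctor B).obj ((Q B).obj M) ≅ (Q B).obj M.shift :=
    (shiftIso B).app M
  let e' (M : DGModule A) : F.obj ((Q A).obj M) ≅ (Q B).obj (Φ.obj M) := e.app M
  have he {M N : DGModule A} (f : M ⟶ N) : F.map ((Q A).map f) ≫ (e' N).hom =
      (e' M).hom ≫ (Q B).map (Φ.functor.map f) := e.hom.naturality f
  have hc (M : DGModule A) : c.hom.app ((Q A).obj M) =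
      F.map (sA M).hom ≫ (e' M.shift).hom ≫ (Q B).map (Φ.shiftIsoObj M).hom ≫
        (sB (Φ.obj M)).inv ≫ (shiftFunctor B).map (e' M).inv := by
    refine (Localization.liftNatTrans_app (Q A) (quasiIso A) _ _ _ _ c'.hom M).trans ?_
    simp [c', DGFun.shiftIso, Localization.Lifting.iso]
    rfl
  refine ⟨c, ?_⟩
  rintro t ⟨M, N, φ, eX, eY, eZ, h₁, h₂, h₃⟩
  refine ⟨Φ.obj M, Φ.obj N, Φ.functor.map φ, F.mapIso eX ≪≫ e' M, F.mapIso eY ≪≫ e' N,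
    F.mapIso eZ ≪≫ e' _ ≪≫ (Q B).mapIso (Φ.coneIso φ), ?_, ?_, ?_⟩
  · simp only [Triangle.map, Iso.trans_hom, Functor.mapIso_hom, Category.assoc]
    rw [← F.map_comp_assoc, h₁, F.map_comp_assoc, he]
  · simp only [Triangle.map, Iso.trans_hom, Functor.mapIso_hom, Category.assoc]
    rw [← F.map_comp_assoc, h₂, F.map_comp_assoc, reassoc_of% (he (coneInclusion φ)),
      ← Functor.map_comp, Φ.map_coneInclusion_coneIso]
  · replace h₃ : t.h ≫ (shiftFunctor A).map eX.hom =
      eZ.hom ≫ (Q A).map (coneProjection φ) ≫ (sA M).inv := h₃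
    have nc : F.map ((shiftFunctor A).map eX.hom) ≫ c.hom.app ((Q A).obj M) =
      c.hom.app t.X ≫ (shiftFunctor B).map (F.map eX.hom) := c.hom.naturality eX.hom
    change (F.map t.h ≫ c.hom.app t.X) ≫ (shiftFunctor B).map (F.map eX.hom ≫ (e' M).hom) =
      (F.map eZ.hom ≫ (e' (cone φ)).hom ≫ (Q B).map (Φ.coneIso φ).hom) ≫
        (Q B).map (coneProjection (Φ.functor.map φ)) ≫ (sB (Φ.obj M)).inv
    have q : (shiftFunctor B).map (e' M).inv ≫ (shiftFunctor B).map (e' M).hom = 𝟙 _ := by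
      rw [← (shiftFunctor B).map_comp, Iso.inv_hom_id, CategoryTheory.Functor.map_id]
    rw [(shiftFunctor B).map_comp, Category.assoc, ← reassoc_of% nc, ← F.map_comp_assoc, h₃, hc]
    simp only [F.map_comp, Category.assoc]
    rw [← F.map_comp_assoc (sA M).inv, Iso.inv_hom_id, CategoryTheory.Functor.map_id,
      Category.id_comp, q, Category.comp_id, reassoc_of% (he (coneProjection φ)),
      ← (Q B).map_comp_assoc, ← (Q B).map_comp_assoc, Φ.map_coneProjection_shiftIsoObj]

end Triangulated

namespace DGModule

variable {k : Type u} [CommRing k] {A B : DGAlgebra k}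

/-! ### K-projective DG modules -/

/-- A DG module is acyclic if all its cocycles are coboundaries. -/
def IsAcyclic (M : DGModule A) : Prop :=
  ∀ (i n j : ℤ), i + 1 = n → n + 1 = j → ∀ x : M.cx.X n, (M.cx.d n j).hom x = 0 →
    ∃ y : M.cx.X i, (M.cx.d i n).hom y = x

/-- The cone of a quasi-isomorphism is acyclic. -/
lemma isAcyclic_cone {M N : DGModule A} (f : M ⟶ N) (hf : quasiIso A f) : IsAcyclic (cone f) := by
  rw [quasiIso_iff_elements] at hf
  intro i n j hi hj x hx
  have h₁ := coneFst_d f n j (j + 1) hj rfl x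
  have h₂ := coneSnd_d f n j hj x
  have hx' : ((CochainComplex.mappingCone f.f).d n j).hom x = 0 := hx
  rw [hx', map_zero] at h₁ h₂
  have h₁ := neg_eq_zero.1 h₁.symm
  have comm (p q : ℤ) (m : M.cx.X p) :
      (f.f.f q).hom ((M.cx.d p q).hom m) = (N.cx.d p q).hom ((f.f.f p).hom m) :=
    (congr(($(f.f.comm p q)).hom m)).symm
  obtain ⟨z, hz⟩ := (hf n j (j + 1) hj rfl).1 _ h₁
    ⟨-coneSnd f n x, by rw [map_neg]; exact (eq_neg_of_add_eq_zero_left h₂.symm).symm⟩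
  obtain ⟨w, hw, v, hv⟩ := (hf i n j hi hj).2 (coneSnd f n x + (f.f.f n).hom z) (by
    rw [map_add, ← comm, hz, h₂, add_comm])
  refine ⟨coneInl f i n hi (w - z) + coneInr f i v, cone_ext (f := f) hj ?_ ?_⟩
  · refine (coneFst_d f i n j hi hj _).trans ?_
    rw [map_add, coneFst_inl, coneFst_inr, add_zero, map_sub, hw, zero_sub, neg_neg, hz]
  · refine (coneSnd_d f i n hi _).trans ?_
    rw [map_add, coneFst_inl, coneFst_inr, add_zero, map_add, coneSnd_inl, coneSnd_inr, zero_add,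
      hv, map_sub]
    abel

/-- A DG module is K-projective if every closed graded map from it to an acyclic DG module is a
coboundary. -/
def IsKProjective (M : DGModule A) : Prop :=
  ∀ N : DGModule A, IsAcyclic N → ∀ (i n j : ℤ), i + 1 = n → n + 1 = j → ∀ z : GHom M N n,
    GHom.δ n j z = 0 → ∃ w : GHom M N i, GHom.δ i n w = z

namespace IsKProjective

variable {M N P : DGModule A}

/-- Closed graded maps from a K-projective DG module lift through quasi-isomorphisms, up to
coboundaries. -/
lemma exists_lift (hM : IsKProjective M) (f : N ⟶ P) (hf : quasiIso A f) (i n j : ℤ)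
    (hi : i + 1 = n) (hj : n + 1 = j) (z : GHom M P n) (hz : GHom.δ n j z = 0) :
    ∃ w : GHom M N n, GHom.δ n j w = 0 ∧
      ∃ v : GHom M P i, GHom.δ i n v = z - w.comp (GHom.ofHom f) (add_zero n) := by
  obtain ⟨u, hu⟩ := hM (cone f) (isAcyclic_cone f hf) i n j hi hj
    (z.comp (inrG f) (add_zero n)) (by
      rw [GHom.δ_comp _ _ _ hj (zero_add 1) hj, hz, GHom.zero_comp, GHom.δ_ofHom, GHom.comp_zero,
        smul_zero, add_zero])
  refine ⟨u.comp (fstG f) hi, ?_, u.comp (sndG f) (add_zero i), ?_⟩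
  · rw [GHom.δ_comp _ _ _ hi (by omega : (1 : ℤ) + 1 = 2) hj, hu, δ_fstG, GHom.comp_zero, zero_add,
      GHom.comp_assoc _ _ _ (add_zero n) (zero_add 1) (by omega), inrG_fstG, GHom.comp_zero,
      smul_zero]
  · rw [GHom.δ_comp _ _ _ hi (zero_add 1) hi, hu, δ_sndG,
      GHom.comp_assoc _ _ _ (add_zero n) (zero_add 0) (by omega), inrG_sndG, GHom.comp_id,
      GHom.comp_neg, ← GHom.comp_assoc _ _ _ hi (add_zero 1) (by omega), Int.negOnePow_zero,
      one_smul, neg_add_eq_sub]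

/-- A closed graded map from a K-projective DG module is a coboundary if its composition with a
quasi-isomorphism is one. -/
lemma exists_δ_eq (hM : IsKProjective M) (f : N ⟶ P) (hf : quasiIso A f) (i n j : ℤ)
    (hi : i + 1 = n) (hj : n + 1 = j) (w : GHom M N n) (hw : GHom.δ n j w = 0) (v : GHom M P i)
    (hv : GHom.δ i n v = w.comp (GHom.ofHom f) (add_zero n)) : ∃ u, GHom.δ i n u = w := by
  obtain ⟨u, hu⟩ := hM (cone f) (isAcyclic_cone f hf) (i - 1) i n (by omega) hi
    (w.comp (inlG f) (by omega) - v.comp (inrG f) (add_zero i)) (by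
      rw [map_sub, GHom.δ_comp _ _ _ hj (by omega : (-1 : ℤ) + 1 = 0) hi, hw, GHom.zero_comp,
        GHom.δ_comp _ _ _ hi (zero_add 1) hi, GHom.δ_ofHom, GHom.comp_zero, hv, smul_zero,
        add_zero, δ_inlG, GHom.comp_assoc _ _ _ (add_zero n) (zero_add 0) (by omega), zero_add,
        Int.negOnePow_zero, one_smul, sub_self])
  refine ⟨-u.comp (fstG f) (by omega), ?_⟩
  rw [map_neg, GHom.δ_comp _ _ _ (by omega : i - 1 + 1 = i) (by omega : (1 : ℤ) + 1 = 2) hi, hu,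
    δ_fstG, GHom.comp_zero, zero_add, GHom.sub_comp,
    GHom.comp_assoc _ _ _ (by omega) (by omega : (-1 : ℤ) + 1 = 0) (by omega),
    GHom.comp_assoc _ _ _ (add_zero i) (zero_add 1) (by omega), inlG_fstG, inrG_fstG,
    GHom.comp_zero, GHom.comp_id, sub_zero, Int.negOnePow_one, Units.neg_smul, one_smul, neg_neg]

/-- A quasi-isomorphism between K-projective DG modules is a homotopy equivalence. -/
lemma isHomotopyEquiv (hM : IsKProjective M) (hN : IsKProjective N) (f : M ⟶ N)
    (hf : quasiIso A f) : IsHomotopyEquiv f := by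
  obtain ⟨g, hg, v, hv⟩ := hN.exists_lift f hf (-1) 0 1 (by omega) (by omega) (GHom.id N) (by simp)
  obtain ⟨u, hu⟩ := hM.exists_δ_eq f hf (-1) 0 1 (by omega) (by omega)
    (GHom.id M - (GHom.ofHom f).comp g (add_zero 0)) (by
      rw [map_sub, GHom.δ_ofHom, GHom.δ_comp _ _ _ (zero_add 1) (zero_add 1) (zero_add 1), hg,
        GHom.δ_ofHom, GHom.zero_comp, GHom.comp_zero, smul_zero, add_zero, sub_zero])
    ((GHom.ofHom f).comp v (zero_add (-1))) (by
      rw [GHom.δ_comp _ _ _ (zero_add 1) (by omega : (-1 : ℤ) + 1 = 0) (by omega), hv, GHom.δ_ofHom,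
        GHom.zero_comp, smul_zero, add_zero, GHom.comp_sub, GHom.sub_comp, GHom.comp_id,
        GHom.id_comp, GHom.comp_assoc _ _ _ (zero_add 0) (zero_add 0) (by omega)])
  exact ⟨g, u, v, hg, hu, hv⟩

/-- DG functors preserve the quasi-isomorphisms between K-projective DG modules. -/
lemma quasiIso_map (hM : IsKProjective M) (hN : IsKProjective N) (Φ : DGFun A B) (f : M ⟶ N)
    (hf : quasiIso A f) : quasiIso B (Φ.functor.map f) :=
  (Φ.isHomotopyEquiv_map (hM.isHomotopyEquiv hN f hf)).quasiIso

end IsKProjective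

end DGModule

namespace DGModule

open CochainComplex.HomComplex

/-! ### Free DG modules on complexes -/

section Free

variable {k : Type u} [CommRing k] (B : DGAlgebra k)

section

variable (K : CochainComplex (ModuleCat.{u} k) ℤ)

/-- Degree `n` of the free DG `B`-module `K ⊗ B`: the direct sum of `Kⁱ ⊗ Bʲ` over `i + j = n`. -/
abbrev FreeX (n : ℤ) : Type u :=
  DirectSum {p : ℤ × ℤ // p.1 + p.2 = n} fun p => K.X p.1.1 ⊗[k] B.cx.X p.1.2

/-- The bilinear map `Kⁱ × Bʲ → (K ⊗ B)ⁿ`, `(x, b) ↦ x ⊗ b`. -/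
def freeMk (i j n : ℤ) (h : i + j = n) : K.X i →ₗ[k] B.cx.X j →ₗ[k] FreeX B K n :=
  (TensorProduct.mk k (K.X i) (B.cx.X j)).compr₂
    (DirectSum.lof k {p : ℤ × ℤ // p.1 + p.2 = n}
      (fun p => K.X p.1.1 ⊗[k] B.cx.X p.1.2) ⟨(i, j), h⟩)

variable {B K}

/-- Linear maps out of `(K ⊗ B)ⁿ` are determined by their values on the elements `x ⊗ b`. -/
lemma free_hom_ext {n : ℤ} {V : Type*} [AddCommGroup V] [Module k V]
    {φ ψ : FreeX B K n →ₗ[k] V}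
    (H : ∀ (i j : ℤ) (h : i + j = n) (x : K.X i) (b : B.cx.X j),
      φ (freeMk B K i j n h x b) = ψ (freeMk B K i j n h x b)) : φ = ψ := by
  apply DirectSum.linearMap_ext
  rintro ⟨⟨i, j⟩, h⟩
  exact TensorProduct.ext' fun x b => H i j h x b

/-- The linear map out of `(K ⊗ B)ⁿ` given by a family of bilinear maps. -/
def freeDesc {n : ℤ} {V : Type*} [AddCommGroup V] [Module k V]
    (φ : ∀ i j : ℤ, i + j = n → K.X i →ₗ[k] B.cx.X j →ₗ[k] V) : FreeX B K n →ₗ[k] V :=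
  DirectSum.toModule k _ _ fun p => TensorProduct.lift (φ p.1.1 p.1.2 p.2)

@[simp]
lemma freeDesc_freeMk {n : ℤ} {V : Type*} [AddCommGroup V] [Module k V]
    (φ : ∀ i j : ℤ, i + j = n → K.X i →ₗ[k] B.cx.X j →ₗ[k] V)
    (i j : ℤ) (h : i + j = n) (x : K.X i) (b : B.cx.X j) :
    freeDesc φ (freeMk B K i j n h x b) = φ i j h x b := by
  simp [freeDesc, freeMk]

variable (B K)

/-- The differential of `K ⊗ B`: `d (x ⊗ b) = d x ⊗ b + (-1) ^ |x| • x ⊗ d b`. -/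
def freeD (n n' : ℤ) (hn : n + 1 = n') : FreeX B K n →ₗ[k] FreeX B K n' :=
  freeDesc fun i j h => (freeMk B K (i + 1) j n' (by omega)).comp (K.d i (i + 1)).hom +
    i.negOnePow • (freeMk B K i (j + 1) n' (by omega)).compl₂ (B.cx.d j (j + 1)).hom

lemma freeD_freeMk (n n' : ℤ) (hn : n + 1 = n') (i i' j j' : ℤ) (h : i + j = n) (hi : i + 1 = i')
    (hj : j + 1 = j') (x : K.X i) (b : B.cx.X j) :
    freeD B K n n' hn (freeMk B K i j n h x b) =
      freeMk B K i' j n' (by omega) ((K.d i i').hom x) b +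
        i.negOnePow • freeMk B K i j' n' (by omega) x ((B.cx.d j j').hom b) := by
  subst hi hj
  exact freeDesc_freeMk _ _ _ _ _ _

/-- The complex `K ⊗ B`. -/
@[simps, reducible]
def freeCx : CochainComplex (ModuleCat.{u} k) ℤ where
  X n := ModuleCat.of k (FreeX B K n)
  d n n' := if hn : n + 1 = n' then ModuleCat.ofHom (freeD B K n n' hn) else 0
  shape n n' h := dif_neg h
  d_comp_d' n n' n'' h h' := by
    have h : n + 1 = n' := h
    have h' : n' + 1 = n'' := h'
    rw [dif_pos h, dif_pos h']
    ext1
    apply free_hom_ext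
    intro i j hij x b
    have e₁ := congr($(K.d_comp_d i (i + 1) (i + 1 + 1)).hom x)
    have e₂ := congr($(B.cx.d_comp_d j (j + 1) (j + 1 + 1)).hom b)
    simp only [ModuleCat.hom_comp, LinearMap.comp_apply, ModuleCat.hom_zero,
      LinearMap.zero_apply] at e₁ e₂
    simp only [ModuleCat.hom_comp, ModuleCat.hom_ofHom, LinearMap.comp_apply, ModuleCat.hom_zero,
      LinearMap.zero_apply]
    rw [freeD_freeMk B K n n' h i (i + 1) j (j + 1) hij rfl rfl, map_add, map_zsmul_unit,
      freeD_freeMk B K n' n'' h' (i + 1) (i + 1 + 1) j (j + 1) (by omega) rfl rfl,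
      freeD_freeMk B K n' n'' h' i (i + 1) (j + 1) (j + 1 + 1) (by omega) rfl rfl, e₁, e₂,
      Int.negOnePow_succ]
    simp

lemma freeCx_d_freeMk (n n' : ℤ) (hn : n + 1 = n') (i i' j j' : ℤ) (h : i + j = n)
    (hi : i + 1 = i') (hj : j + 1 = j') (x : K.X i) (b : B.cx.X j) :
    ((freeCx B K).d n n').hom (freeMk B K i j n h x b) =
      freeMk B K i' j n' (by omega) ((K.d i i').hom x) b +
        i.negOnePow • freeMk B K i j' n' (by omega) x ((B.cx.d j j').hom b) := by
  rw [← freeD_freeMk B K n n' hn i i' j j' h hi hj, freeCx_d, dif_pos hn]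
  rfl

/-- The right action of `B` on `K ⊗ B`: `(x ⊗ b) b' = x ⊗ b b'`. -/
def freeAct (n l n' : ℤ) (hn : n + l = n') :
    FreeX B K n →ₗ[k] B.cx.X l →ₗ[k] FreeX B K n' :=
  freeDesc fun i j h => LinearMap.mk₂ k
    (fun x b => (freeMk B K i (j + l) n' (by omega) x).comp (B.mul j l (j + l) rfl b))
    (by intros; ext; simp) (by intros; ext; simp) (by intros; ext; simp) (by intros; ext; simp)

lemma freeAct_freeMk (n l n' : ℤ) (hn : n + l = n') (i j s : ℤ) (h : i + j = n) (hs : j + l = s)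
    (x : K.X i) (b : B.cx.X j) (b' : B.cx.X l) :
    freeAct B K n l n' hn (freeMk B K i j n h x b) b' =
      freeMk B K i s n' (by omega) x (B.mul j l s hs b b') := by
  subst hs
  simp [freeAct]

/-- The free right DG `B`-module `K ⊗ B` on a complex `K`. -/
@[reducible]
def free : DGModule B where
  cx := freeCx B K
  act := freeAct B K
  act_one n x := by
    suffices (freeAct B K n 0 n (add_zero n)).flip B.one = LinearMap.id from congr($this x)
    apply free_hom_ext
    intro i j h m t
    rw [LinearMap.flip_apply, freeAct_freeMk B K n 0 n _ i j j h (add_zero j), B.mul_one,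
      LinearMap.id_apply]
  act_mul n j l r s n' hr hs h₁ h₂ x a b := by
    suffices ((freeAct B K r l n' h₁).flip b).comp ((freeAct B K n j r hr).flip a) =
        (freeAct B K n s n' h₂).flip (B.mul j l s hs a b) from congr($this x)
    apply free_hom_ext
    intro p q h m t
    simp only [LinearMap.comp_apply, LinearMap.flip_apply]
    rw [freeAct_freeMk B K n j r _ p q (q + j) h rfl,
      freeAct_freeMk B K r l n' _ p (q + j) (q + j + l) (by omega) rfl,
      freeAct_freeMk B K n s n' _ p q (q + j + l) h (by omega),
      B.mul_assoc q j l (q + j) s (q + j + l) rfl hs rfl]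
  d_act i i' j j' n n' hi hj hn h x b := by
    suffices ((freeCx B K).d n n').hom.comp ((freeAct B K i j n h).flip b) =
        ((freeAct B K i' j n' (by omega)).flip b).comp ((freeCx B K).d i i').hom +
          i.negOnePow • (freeAct B K i j' n' (by omega)).flip ((B.cx.d j j').hom b) from
      congr($this x)
    apply free_hom_ext
    intro p q hpq m t
    simp only [LinearMap.comp_apply, LinearMap.flip_apply, LinearMap.add_apply,
      LinearMap.smul_apply]
    rw [freeAct_freeMk B K i j n _ p q (q + j) hpq rfl,
      freeCx_d_freeMk B K n n' hn p (p + 1) (q + j) (q + j + 1) (by omega) rfl rfl,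
      freeCx_d_freeMk B K i i' hi p (p + 1) q (q + 1) hpq rfl rfl, map_add, map_zsmul_unit,
      LinearMap.add_apply, LinearMap.smul_apply,
      freeAct_freeMk B K i' j n' _ (p + 1) q (q + j) (by omega) rfl,
      freeAct_freeMk B K i' j n' _ p (q + 1) (q + j + 1) (by omega) (by omega),
      freeAct_freeMk B K i j' n' _ p q (q + j + 1) (by omega) (by omega),
      B.d_mul q (q + 1) j j' (q + j) (q + j + 1) rfl hj rfl, map_add, map_zsmul_unit, smul_add,
      smul_smul, ← Int.negOnePow_add, hpq]
    exact (add_assoc _ _ _).symm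

end

variable {K L P : CochainComplex (ModuleCat.{u} k) ℤ}

/-- Graded maps out of a free DG module are determined by their values on the `x ⊗ b`. -/
lemma free_ghom_ext {M : DGModule B} {n : ℤ} {z w : GHom (free B K) M n}
    (H : ∀ (p q : ℤ) (h : p + n = q) (i j : ℤ) (hij : i + j = p) (x : K.X i) (b : B.cx.X j),
      z.ap p q h (freeMk B K i j p hij x b) = w.ap p q h (freeMk B K i j p hij x b)) : z = w := by
  apply GHom.ext
  intro p q h x
  have : z.ap p q h = w.ap p q h := free_hom_ext fun i j hij x b => H p q h i j hij x b
  rw [this]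

/-- The map `x ⊗ b ↦ z x ⊗ b` in degree `p`. -/
def freeMapX {n : ℤ} (z : Cochain K L n) (p q : ℤ) (h : p + n = q) :
    FreeX B K p →ₗ[k] FreeX B L q :=
  freeDesc fun i j hij => (freeMk B L (i + n) j q (by omega)).comp (z.v i (i + n) rfl).hom

lemma freeMapX_freeMk {n : ℤ} (z : Cochain K L n) (p q : ℤ) (h : p + n = q) (i i' j : ℤ)
    (hij : i + j = p) (hi : i + n = i') (x : K.X i) (b : B.cx.X j) :
    freeMapX B z p q h (freeMk B K i j p hij x b) =
      freeMk B L i' j q (by omega) ((z.v i i' hi).hom x) b := by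
  subst hi
  exact freeDesc_freeMk _ _ _ _ _ _

lemma freeMapX_act {n : ℤ} (z : Cochain K L n) (i j l i' l' : ℤ) (h : i + j = l)
    (hi : i + n = i') (hl : l + n = l') (x : FreeX B K i) (b : B.cx.X j) :
    freeMapX B z l l' hl (freeAct B K i j l h x b) =
      freeAct B L i' j l' (by omega) (freeMapX B z i i' hi x) b := by
  suffices (freeMapX B z l l' hl).comp ((freeAct B K i j l h).flip b) =
    ((freeAct B L i' j l' (by omega)).flip b).comp (freeMapX B z i i' hi) from congr($this x)
  apply free_hom_ext
  intro p q hpq x c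
  simp only [LinearMap.comp_apply, LinearMap.flip_apply]
  rw [freeAct_freeMk B K i j l h p q (q + j) hpq rfl,
    freeMapX_freeMk B z l l' hl p (p + n) (q + j) _ rfl,
    freeMapX_freeMk B z i i' hi p (p + n) q _ rfl,
    freeAct_freeMk B L i' j l' _ (p + n) q (q + j) (by omega) rfl]

/-- The graded map `z ⊗ 1 : K ⊗ B ⟶ L ⊗ B` induced by a cochain `z`. -/
def freeMapG {n : ℤ} (z : Cochain K L n) : GHom (free B K) (free B L) n :=
  ⟨Cochain.mk fun p q h => ModuleCat.ofHom (freeMapX B z p q h), freeMapX_act B z⟩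

lemma freeMapG_apply {n : ℤ} (z : Cochain K L n) (p q : ℤ) (h : p + n = q) (i i' j : ℤ)
    (hij : i + j = p) (hi : i + n = i') (x : K.X i) (b : B.cx.X j) :
    (freeMapG B z).ap p q h (freeMk B K i j p hij x b) =
      freeMk B L i' j q (by omega) ((z.v i i' hi).hom x) b :=
  freeMapX_freeMk B z p q h i i' j hij hi x b

/-- The map `z ↦ z ⊗ 1` is linear. -/
def freeMap {n : ℤ} : Cochain K L n →ₗ[k] GHom (free B K) (free B L) n where
  toFun := freeMapG B
  map_add' z w := by
    apply free_ghom_ext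
    intro p q h i j hij x b
    refine (freeMapG_apply B (z + w) p q h i _ j hij rfl x b).trans ?_
    refine Eq.trans ?_ (congrArg₂ (· + ·) (freeMapG_apply B z p q h i _ j hij rfl x b)
      (freeMapG_apply B w p q h i _ j hij rfl x b)).symm
    simp
  map_smul' c z := by
    apply free_ghom_ext
    intro p q h i j hij x b
    refine (freeMapG_apply B (c • z) p q h i _ j hij rfl x b).trans ?_
    refine Eq.trans ?_ (congrArg (c • ·) (freeMapG_apply B z p q h i _ j hij rfl x b)).symm
    simp

lemma freeMap_apply {n : ℤ} (z : Cochain K L n) (p q : ℤ) (h : p + n = q) (i i' j : ℤ)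
    (hij : i + j = p) (hi : i + n = i') (x : K.X i) (b : B.cx.X j) :
    (freeMap B z).ap p q h (freeMk B K i j p hij x b) =
      freeMk B L i' j q (by omega) ((z.v i i' hi).hom x) b :=
  freeMapX_freeMk B z p q h i i' j hij hi x b

lemma freeMap_id (K : CochainComplex (ModuleCat.{u} k) ℤ) :
    freeMap B (Cochain.ofHom (𝟙 K)) = GHom.id (free B K) := by
  apply free_ghom_ext
  intro p q h i j hij x b
  obtain rfl : p = q := by omega
  rw [freeMap_apply B _ p p h i i j hij (add_zero i), GHom.ofHom_apply, Cochain.ofHom_v]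
  rfl

lemma freeMap_comp {a b c : ℤ} (z : Cochain K L a) (w : Cochain L P b) (h : a + b = c) :
    freeMap B (z.comp w h) = (freeMap B z).comp (freeMap B w) h := by
  apply free_ghom_ext
  intro p q hpq i j hij x y
  rw [freeMap_apply B _ p q hpq i (i + a + b) j hij (by omega),
    GHom.comp_apply _ _ _ p (p + a) q rfl (by omega),
    freeMap_apply B _ p (p + a) rfl i (i + a) j hij rfl,
    freeMap_apply B _ (p + a) q _ (i + a) (i + a + b) j (by omega) rfl,
    cochain_comp_apply z w h i (i + a) (i + a + b) rfl rfl]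

lemma freeMap_δ {a b : ℤ} (h : a + 1 = b) (z : Cochain K L a) :
    freeMap B (δ a b z) = GHom.δ a b (freeMap B z) := by
  apply free_ghom_ext
  intro p q hpq i j hij x y
  have e : b.negOnePow * i.negOnePow = - (i + a).negOnePow := by
    rw [← h, ← Int.negOnePow_add, ← Int.negOnePow_succ]
    congr 1
    ring
  rw [freeMap_apply B _ p q hpq i (i + b) j hij rfl,
    GHom.δ_apply h _ p q (p + 1) (p + a) hpq rfl (by omega),
    freeMap_apply B _ p (p + a) rfl i (i + a) j hij rfl,
    freeCx_d_freeMk B L (p + a) q (by omega) (i + a) (i + b) j (j + 1) (by omega) (by omega) rfl,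
    freeCx_d_freeMk B K p (p + 1) rfl i (i + 1) j (j + 1) (by omega) rfl rfl, map_add,
    map_zsmul_unit, freeMap_apply B _ (p + 1) q _ (i + 1) (i + b) j _ (by omega),
    freeMap_apply B _ (p + 1) q _ i (i + a) (j + 1) _ rfl,
    cochain_δ_apply h z i (i + b) (i + 1) (i + a) rfl rfl (by omega), map_add, LinearMap.add_apply,
    map_zsmul_unit, LinearMap.smul_apply, smul_add, smul_smul, e, Units.neg_smul]
  abel

/-- The inclusion of generators `K ⟶ K ⊗ B`, `x ↦ x ⊗ 1`. -/
def freeUnit (K : CochainComplex (ModuleCat.{u} k) ℤ) : Cochain K (free B K).cx 0 :=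
  Cochain.mk fun p q h => ModuleCat.ofHom ((freeMk B K p 0 q h).flip B.one)

lemma freeUnit_apply (p q : ℤ) (h : p + 0 = q) (x : K.X p) :
    ((freeUnit B K).v p q h).hom x = freeMk B K p 0 q h x B.one := rfl

variable {B} in
lemma DGAlgebra.d_one (n : ℤ) : (B.cx.d 0 n).hom B.one = 0 := by
  by_cases hn : 0 + 1 = n
  · have h := B.d_mul 0 1 0 1 0 1 rfl rfl rfl rfl B.one B.one
    obtain rfl : n = 1 := by omega
    rw [B.one_mul, B.mul_one] at h
    simpa [B.one_mul] using h
  · rw [B.cx.shape _ _ (by simpa using hn)]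
    rfl

@[simp]
lemma δ_freeUnit (K : CochainComplex (ModuleCat.{u} k) ℤ) (n : ℤ) : δ 0 n (freeUnit B K) = 0 := by
  by_cases hn : 0 + 1 = n
  · apply cochain_ext
    intro p q h x
    rw [cochain_δ_apply hn _ p q (p + 1) p h rfl (by omega), freeUnit_apply, freeUnit_apply,
      freeCx_d_freeMk B K p q (by omega) p (p + 1) 0 1 _ rfl rfl, DGAlgebra.d_one, map_zero,
      smul_zero, add_zero, show n.negOnePow = -1 by rw [← hn]; rfl, Units.neg_smul, one_smul]
    exact add_neg_cancel _
  · exact δ_shape _ _ hn _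

lemma freeUnit_naturality {n : ℤ} (z : Cochain K L n) :
    (freeUnit B K).comp (freeMap B z).1 (zero_add n) = z.comp (freeUnit B L) (add_zero n) := by
  apply cochain_ext
  intro p q h x
  rw [cochain_comp_apply _ _ _ p p q (add_zero p) h, cochain_comp_apply _ _ _ p q q h (add_zero q),
    freeUnit_apply, freeUnit_apply]
  exact freeMap_apply B z p q h p q 0 _ h x B.one

variable {B}

/-- The action map `m ⊗ b ↦ m b` in degree `n`. -/
def freeCounitX (M : DGModule B) (n : ℤ) : FreeX B M.cx n →ₗ[k] M.cx.X n :=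
  freeDesc fun i j h => M.act i j n h

@[simp]
lemma freeCounitX_freeMk (M : DGModule B) (n i j : ℤ) (h : i + j = n) (x : M.cx.X i)
    (b : B.cx.X j) : freeCounitX M n (freeMk B M.cx i j n h x b) = M.act i j n h x b :=
  freeDesc_freeMk _ _ _ _ _ _

/-- The action map `M ⊗ B ⟶ M`, `m ⊗ b ↦ m b`. -/
def freeCounit (M : DGModule B) : free B M.cx ⟶ M where
  f :=
    { f := fun n => ModuleCat.ofHom (freeCounitX M n)
      comm' := by
        intro n n' hn
        have hn : n + 1 = n' := hn
        ext1
        apply free_hom_ext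
        intro i j h m b
        simp only [ModuleCat.hom_comp, ModuleCat.hom_ofHom, LinearMap.comp_apply]
        rw [freeCx_d_freeMk B M.cx n n' hn i (i + 1) j (j + 1) h rfl rfl, map_add, map_zsmul_unit,
          freeCounitX_freeMk, freeCounitX_freeMk, freeCounitX_freeMk,
          M.d_act i (i + 1) j (j + 1) n n' rfl rfl hn] }
  map_act i j n h x b := by
    suffices (freeCounitX M n).comp ((freeAct B M.cx i j n h).flip b) =
        ((M.act i j n h).flip b).comp (freeCounitX M i) from congr($this x)
    apply free_hom_ext
    intro p q hpq x c
    simp only [LinearMap.comp_apply, LinearMap.flip_apply]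
    rw [freeAct_freeMk B M.cx i j n h p q (q + j) hpq rfl, freeCounitX_freeMk, freeCounitX_freeMk,
      M.act_mul p q j i (q + j) n hpq rfl]

lemma freeCounit_apply (M : DGModule B) (n i j : ℤ) (h : i + j = n) (x : M.cx.X i)
    (b : B.cx.X j) : ((freeCounit M).f.f n).hom (freeMk B M.cx i j n h x b) = M.act i j n h x b :=
  freeCounitX_freeMk M n i j h x b

lemma freeCounit_naturality {M N : DGModule B} {n : ℤ} (z : GHom M N n) :
    (freeMap B z.1).comp (GHom.ofHom (freeCounit N)) (add_zero n) =
      (GHom.ofHom (freeCounit M)).comp z (zero_add n) := by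
  apply free_ghom_ext
  intro p q hpq i j hij x y
  rw [GHom.comp_apply _ _ _ p q q hpq (add_zero q), GHom.comp_apply _ _ _ p p q (add_zero p) hpq,
    freeMap_apply B _ p q hpq i (i + n) j hij rfl, GHom.ofHom_apply, GHom.ofHom_apply,
    freeCounit_apply, freeCounit_apply, z.map_act i j p (i + n) q hij rfl hpq]

lemma freeUnit_freeCounit (M : DGModule B) :
    (freeUnit B M.cx).comp (Cochain.ofHom (freeCounit M).f) (add_zero 0) =
      Cochain.ofHom (𝟙 M.cx) := by
  apply cochain_ext
  intro p q h x
  obtain rfl : p = q := by omega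
  rw [cochain_comp_apply _ _ _ p p p h h, freeUnit_apply, Cochain.ofHom_v, Cochain.ofHom_v,
    freeCounit_apply, M.act_one]
  rfl

variable (B) in
/-- The DG functor `M ↦ M ⊗ B`. -/
@[simps]
def freeFun : DGFun B B where
  obj M := free B M.cx
  map := (freeMap B).comp (Submodule.subtype _)
  map_id M := freeMap_id B M.cx
  map_comp z w h := freeMap_comp B z.1 w.1 h
  map_δ h z := freeMap_δ B h z.1

end Free

/-! ### Free DG modules over a field are K-projective -/

section Field

variable {k : Type u} [Field k] {B : DGAlgebra k}

/-- Over a field, an acyclic complex is contractible. -/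
lemma IsAcyclic.exists_contraction {N : DGModule B} (hN : IsAcyclic N) :
    ∃ s : Cochain N.cx N.cx (-1), δ (-1) 0 s = Cochain.ofHom (𝟙 N.cx) := by
  have h (i n j : ℤ) : ∃ t : N.cx.X n →ₗ[k] N.cx.X i, i + 1 = n → n + 1 = j →
      ∀ x, (N.cx.d n j).hom x = 0 → (N.cx.d i n).hom (t x) = x := by
    by_cases hij : i + 1 = n ∧ n + 1 = j
    · let D : N.cx.X i →ₗ[k] LinearMap.ker (N.cx.d n j).hom :=
        (N.cx.d i n).hom.codRestrict _ fun x => congr($(N.cx.d_comp_d i n j).hom x)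
      obtain ⟨τ, hτ⟩ := D.exists_rightInverse_of_surjective (by
        rw [LinearMap.range_eq_top]
        rintro ⟨x, hx⟩
        obtain ⟨y, hy⟩ := hN i n j hij.1 hij.2 x hx
        exact ⟨y, Subtype.ext hy⟩)
      obtain ⟨t, ht⟩ := LinearMap.exists_extend τ
      refine ⟨t, fun _ _ x hx => ?_⟩
      have e₁ : t x = τ ⟨x, hx⟩ := congr($ht ⟨x, hx⟩)
      rw [e₁]
      exact congr(Subtype.val ($hτ ⟨x, hx⟩))
    · exact ⟨0, fun hi hj => absurd ⟨hi, hj⟩ hij⟩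
  choose t ht using h
  have hdd (a b c : ℤ) (x : N.cx.X a) : (N.cx.d b c).hom ((N.cx.d a b).hom x) = 0 :=
    congr($(N.cx.d_comp_d a b c).hom x)
  -- `s x = t (x - t (d x))`, where `t` is a section of `d` on cocycles
  refine ⟨Cochain.mk fun p q _ => ModuleCat.ofHom ((t q p (p + 1)).comp
    (LinearMap.id - (t p (p + 1) (p + 2)).comp (N.cx.d p (p + 1)).hom)), cochain_ext ?_⟩
  intro p q h x
  obtain rfl : p = q := by omega
  rw [cochain_δ_apply (by omega) _ p p (p + 1) (p - 1) h rfl (by omega), Cochain.ofHom_v]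
  simp only [Cochain.mk_v, ModuleCat.hom_ofHom, LinearMap.comp_apply, LinearMap.sub_apply,
    LinearMap.id_apply, hdd, map_zero, sub_zero, Int.negOnePow_zero, one_smul]
  rw [ht (p - 1) p (p + 1) (by omega) rfl, sub_eq_add_neg]
  · obtain h2 : p + 2 = p + 1 + 1 := by omega
    simp [h2]
  · rw [map_sub, ht p (p + 1) (p + 2) rfl (by omega) _ (hdd _ _ _ _), sub_self]

/-- The factorization of a graded map out of a free DG module through its values on generators. -/
lemma freeMap_freeUnit_comp {K : CochainComplex (ModuleCat.{u} k) ℤ} {N : DGModule B} {n : ℤ}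
    (z : GHom (free B K) N n) :
    (freeMap B ((freeUnit B K).comp z.1 (zero_add n))).comp (GHom.ofHom (freeCounit N))
      (add_zero n) = z := by
  apply free_ghom_ext
  intro p q hpq i j hij x b
  rw [GHom.comp_apply _ _ _ p q q hpq (add_zero q),
    freeMap_apply B _ p q hpq i (i + n) j hij rfl, GHom.ofHom_apply, freeCounit_apply,
    cochain_comp_apply _ _ _ i i (i + n) (add_zero i) rfl, freeUnit_apply]
  refine (z.map_act i j p (i + n) q hij rfl hpq _ b).symm.trans (congrArg (z.ap p q hpq) ?_)
  refine (freeAct_freeMk B K i j p hij i 0 j (add_zero i) (zero_add j) x B.one b).trans ?_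
  rw [B.one_mul]

/-- Over a field, free DG modules are K-projective. -/
lemma isKProjective_free (K : CochainComplex (ModuleCat.{u} k) ℤ) :
    IsKProjective (free B K) := by
  intro N hN i n j hi hj z hz
  obtain ⟨s, hs⟩ := hN.exists_contraction
  obtain ⟨c, hc⟩ : ∃ c, c = (freeUnit B K).comp z.1 (zero_add n) := ⟨_, rfl⟩
  have hcδ : δ n j c = 0 := by
    rw [hc, δ_comp _ _ (zero_add n) 1 j j hj (zero_add 1) hj, δ_freeUnit, Cochain.zero_comp,
      smul_zero, add_zero, ← GHom.δ_coe, hz]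
    exact Cochain.comp_zero _ _
  refine ⟨(freeMap B (c.comp s (by omega : n + -1 = i))).comp (GHom.ofHom (freeCounit N))
    (add_zero i), ?_⟩
  rw [GHom.δ_comp _ _ _ hi (zero_add 1) hi, GHom.δ_ofHom, GHom.comp_zero, zero_add,
    Int.negOnePow_zero, one_smul, ← freeMap_δ B hi,
    δ_comp c s _ j 0 n hi hj (by omega), hs, hcδ, Cochain.zero_comp, smul_zero, add_zero,
    Cochain.comp_id, hc]
  exact freeMap_freeUnit_comp z

end Field

end DGModule

namespace DGModule

open CochainComplex.HomComplex

/-! ### The total DG module of a sequence of DG modules -/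

section Tot

variable {k : Type u} [CommRing k] {B : DGAlgebra k} (Z : ℕ → DGModule B)

/-- Degree `m` of the total module: the direct sum of the `(Z n)ᵖ` over `p - n = m`. -/
abbrev TotX (m : ℤ) : Type u :=
  DirectSum {q : ℕ × ℤ // q.2 + -(q.1 : ℤ) = m} fun q => (Z q.1.1).cx.X q.1.2

/-- The inclusion of a summand in the total module. -/
def totMk (n : ℕ) (p m : ℤ) (h : p + -(n : ℤ) = m) : (Z n).cx.X p →ₗ[k] TotX Z m :=
  DirectSum.lof k {q : ℕ × ℤ // q.2 + -(q.1 : ℤ) = m} (fun q => (Z q.1.1).cx.X q.1.2) ⟨(n, p), h⟩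

variable {Z}

lemma tot_hom_ext {m : ℤ} {V : Type*} [AddCommGroup V] [Module k V] {φ ψ : TotX Z m →ₗ[k] V}
    (H : ∀ (n : ℕ) (p : ℤ) (h : p + -(n : ℤ) = m) (x : (Z n).cx.X p),
      φ (totMk Z n p m h x) = ψ (totMk Z n p m h x)) : φ = ψ := by
  apply DirectSum.linearMap_ext
  rintro ⟨⟨n, p⟩, h⟩
  exact LinearMap.ext fun x => H n p h x

/-- The linear map out of a degree of the total module given by its restrictions to the summands. -/
def totDescX {m : ℤ} {V : Type*} [AddCommGroup V] [Module k V]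
    (φ : ∀ (n : ℕ) (p : ℤ), p + -(n : ℤ) = m → (Z n).cx.X p →ₗ[k] V) : TotX Z m →ₗ[k] V :=
  DirectSum.toModule k _ _ fun q => φ q.1.1 q.1.2 q.2

@[simp]
lemma totDescX_totMk {m : ℤ} {V : Type*} [AddCommGroup V] [Module k V]
    (φ : ∀ (n : ℕ) (p : ℤ), p + -(n : ℤ) = m → (Z n).cx.X p →ₗ[k] V) (n : ℕ) (p : ℤ)
    (h : p + -(n : ℤ) = m) (x : (Z n).cx.X p) :
    totDescX φ (totMk Z n p m h x) = φ n p h x := by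
  simp [totDescX, totMk]

variable (bd : ∀ n, Z (n + 1) ⟶ Z n)

/-- The horizontal part of the differential of the total module, on a summand. -/
def totBd : ∀ (n : ℕ) (p m : ℤ), p + -(n : ℤ) + 1 = m → ((Z n).cx.X p →ₗ[k] TotX Z m)
  | 0, _, _, _ => 0
  | n + 1, p, m, h => (totMk Z n p m (by push_cast at h; omega)).comp ((bd n).f.f p).hom

lemma totBd_succ (n : ℕ) (p m : ℤ) (h : p + -((n + 1 : ℕ) : ℤ) + 1 = m)
    (x : (Z (n + 1)).cx.X p) :
    totBd bd (n + 1) p m h x = totMk Z n p m (by push_cast at h; omega) (((bd n).f.f p).hom x) :=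
  rfl

/-- The differential of the total module, on the `n`-th summand: `(-1)ⁿ d` plus the horizontal
part. -/
def totD (m m' : ℤ) (hm : m + 1 = m') : TotX Z m →ₗ[k] TotX Z m' :=
  totDescX fun n p h => (n : ℤ).negOnePow •
    (totMk Z n (p + 1) m' (by omega)).comp ((Z n).cx.d p (p + 1)).hom + totBd bd n p m' (by omega)

lemma totD_totMk (m m' : ℤ) (hm : m + 1 = m') (n : ℕ) (p p' : ℤ) (h : p + -(n : ℤ) = m)
    (hp : p + 1 = p') (x : (Z n).cx.X p) :
    totD bd m m' hm (totMk Z n p m h x) =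
      (n : ℤ).negOnePow • totMk Z n p' m' (by omega) (((Z n).cx.d p p').hom x) +
        totBd bd n p m' (by omega) x := by
  subst hp
  exact totDescX_totMk _ _ _ _ _

variable (hbd : ∀ (n : ℕ) (p : ℤ) (x : (Z (n + 2)).cx.X p),
  ((bd n).f.f p).hom (((bd (n + 1)).f.f p).hom x) = 0)

include hbd in
lemma totD_totBd (m m' : ℤ) (hm : m + 1 = m') (n : ℕ) (p p' : ℤ) (h : p + -(n : ℤ) + 1 = m)
    (hp : p + 1 = p') (x : (Z n).cx.X p) :
    totD bd m m' hm (totBd bd n p m h x) =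
      -((n : ℤ).negOnePow • totBd bd n p' m' (by omega) (((Z n).cx.d p p').hom x)) := by
  cases n with
  | zero => simp [totBd]
  | succ n =>
    have e := congr($((bd n).f.comm p p').hom x)
    simp only [ModuleCat.hom_comp, LinearMap.comp_apply] at e
    have e' : totBd bd n p m' (by push_cast at h; omega) (((bd n).f.f p).hom x) = 0 := by
      cases n with
      | zero => rfl
      | succ n => rw [totBd_succ, hbd, map_zero]
    have e₂ : ((n + 1 : ℕ) : ℤ).negOnePow = -(n : ℤ).negOnePow := by
      rw [Nat.cast_succ, Int.negOnePow_succ]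
    rw [totBd_succ, totBd_succ, totD_totMk bd m m' hm n p p' _ hp, e, e', add_zero, e₂,
      Units.neg_smul, neg_neg]

/-- The total complex of a sequence `⋯ ⟶ Z 2 ⟶ Z 1 ⟶ Z 0` of DG modules. -/
@[simps, reducible]
def totCx : CochainComplex (ModuleCat.{u} k) ℤ where
  X m := ModuleCat.of k (TotX Z m)
  d m m' := if hm : m + 1 = m' then ModuleCat.ofHom (totD bd m m' hm) else 0
  shape m m' h := dif_neg h
  d_comp_d' m m' m'' h h' := by
    have h : m + 1 = m' := h
    have h' : m' + 1 = m'' := h'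
    rw [dif_pos h, dif_pos h']
    ext1
    apply tot_hom_ext
    intro n p hp x
    have e := congr($((Z n).cx.d_comp_d p (p + 1) (p + 1 + 1)).hom x)
    simp only [ModuleCat.hom_comp, LinearMap.comp_apply, ModuleCat.hom_zero,
      LinearMap.zero_apply] at e
    simp only [ModuleCat.hom_comp, ModuleCat.hom_ofHom, LinearMap.comp_apply, ModuleCat.hom_zero,
      LinearMap.zero_apply]
    rw [totD_totMk bd m m' h n p (p + 1) hp rfl, map_add, map_zsmul_unit,
      totD_totMk bd m' m'' h' n (p + 1) (p + 1 + 1) _ rfl, e, map_zero, smul_zero, zero_add,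
      totD_totBd bd hbd m' m'' h' n p (p + 1) _ rfl, add_neg_cancel]

lemma totCx_d_totMk (m m' : ℤ) (hm : m + 1 = m') (n : ℕ) (p p' : ℤ) (h : p + -(n : ℤ) = m)
    (hp : p + 1 = p') (x : (Z n).cx.X p) :
    ((totCx bd hbd).d m m').hom (totMk Z n p m h x) =
      (n : ℤ).negOnePow • totMk Z n p' m' (by omega) (((Z n).cx.d p p').hom x) +
        totBd bd n p m' (by omega) x := by
  rw [← totD_totMk bd m m' hm n p p' h hp, totCx_d, dif_pos hm]
  rfl

variable (Z) in
/-- The action on the total module, componentwise and without signs. -/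
def totAct (m l m' : ℤ) (hm : m + l = m') : TotX Z m →ₗ[k] B.cx.X l →ₗ[k] TotX Z m' :=
  totDescX fun n p h => ((Z n).act p l (p + l) rfl).compr₂ (totMk Z n (p + l) m' (by omega))

lemma totAct_totMk (m l m' : ℤ) (hm : m + l = m') (n : ℕ) (p p' : ℤ) (h : p + -(n : ℤ) = m)
    (hp : p + l = p') (x : (Z n).cx.X p) (b : B.cx.X l) :
    totAct Z m l m' hm (totMk Z n p m h x) b =
      totMk Z n p' m' (by omega) ((Z n).act p l p' hp x b) := by
  subst hp
  simp [totAct]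

lemma totBd_act (m l m' : ℤ) (hm : m + l = m') (n : ℕ) (p p' : ℤ) (h : p + -(n : ℤ) + 1 = m)
    (hp : p + l = p') (x : (Z n).cx.X p) (b : B.cx.X l) :
    totAct Z m l m' hm (totBd bd n p m h x) b =
      totBd bd n p' m' (by omega) ((Z n).act p l p' hp x b) := by
  cases n with
  | zero => simp [totBd]
  | succ n => rw [totBd_succ, totBd_succ, totAct_totMk m l m' hm n p p' _ hp, (bd n).map_act]

/-- The total DG module of a sequence `⋯ ⟶ Z 2 ⟶ Z 1 ⟶ Z 0` of DG modules: in degree `m` it is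
the direct sum of the `(Z n)ᵐ⁺ⁿ`, with differential `(-1)ⁿ d` plus the maps of the sequence, and
action componentwise. -/
@[reducible]
def tot : DGModule B where
  cx := totCx bd hbd
  act := totAct Z
  act_one m x := by
    suffices (totAct Z m 0 m (add_zero m)).flip B.one = LinearMap.id from congr($this x)
    apply tot_hom_ext
    intro n p h x
    rw [LinearMap.flip_apply, totAct_totMk m 0 m _ n p p h (add_zero p), (Z n).act_one,
      LinearMap.id_apply]
  act_mul m j l r s m' hr hs h₁ h₂ x a b := by
    suffices ((totAct Z r l m' h₁).flip b).comp ((totAct Z m j r hr).flip a) =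
        (totAct Z m s m' h₂).flip (B.mul j l s hs a b) from congr($this x)
    apply tot_hom_ext
    intro n p h x
    simp only [LinearMap.comp_apply, LinearMap.flip_apply]
    rw [totAct_totMk m j r _ n p (p + j) h rfl,
      totAct_totMk r l m' _ n (p + j) (p + j + l) (by omega) rfl,
      totAct_totMk m s m' _ n p (p + j + l) h (by omega),
      (Z n).act_mul p j l (p + j) s (p + j + l) rfl hs rfl]
  d_act i i' j j' m m' hi hj hm h x b := by
    suffices ((totCx bd hbd).d m m').hom.comp ((totAct Z i j m h).flip b) =
        ((totAct Z i' j m' (by omega)).flip b).comp ((totCx bd hbd).d i i').hom +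
          i.negOnePow • (totAct Z i j' m' (by omega)).flip ((B.cx.d j j').hom b) from
      congr($this x)
    apply tot_hom_ext
    intro n p hp x
    simp only [LinearMap.comp_apply, LinearMap.flip_apply, LinearMap.add_apply,
      LinearMap.smul_apply]
    have e : (n : ℤ).negOnePow * p.negOnePow = i.negOnePow := by
      rw [← hp, Int.negOnePow_add, Int.negOnePow_neg, mul_comm]
    rw [totAct_totMk i j m h n p (p + j) hp rfl,
      totCx_d_totMk bd hbd m m' hm n (p + j) (p + j + 1) (by omega) rfl,
      totCx_d_totMk bd hbd i i' hi n p (p + 1) hp rfl, map_add, map_zsmul_unit,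
      LinearMap.add_apply, LinearMap.smul_apply,
      totAct_totMk i' j m' _ n (p + 1) (p + j + 1) (by omega) (by omega),
      totBd_act bd i' j m' _ n p (p + j) _ rfl,
      totAct_totMk i j' m' _ n p (p + j + 1) hp (by omega),
      (Z n).d_act p (p + 1) j j' (p + j) (p + j + 1) rfl hj rfl, map_add, map_zsmul_unit, smul_add,
      smul_smul, e]
    abel

/-- The inclusion of `Z n` in the total module, of degree `-n`. -/
def totIncl (n : ℕ) : GHom (Z n) (tot bd hbd) (-(n : ℤ)) :=
  ⟨Cochain.mk fun p m h => ModuleCat.ofHom (totMk Z n p m h),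
    fun i j l i' l' h hi hl x b => (totAct_totMk i' j l' (by omega) n i l hi h x b).symm⟩

lemma totIncl_apply (n : ℕ) (p m : ℤ) (h : p + -(n : ℤ) = m) (x : (Z n).cx.X p) :
    (totIncl bd hbd n).ap p m h x = totMk Z n p m h x := rfl

@[simp]
lemma δ_totIncl_zero (j : ℤ) : GHom.δ (-((0 : ℕ) : ℤ)) j (totIncl bd hbd 0) = 0 := by
  by_cases hj : -((0 : ℕ) : ℤ) + 1 = j
  · apply GHom.ext
    intro p q h x
    rw [GHom.δ_apply hj _ p q (p + 1) p h rfl (by omega), totIncl_apply, totIncl_apply,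
      totCx_d_totMk bd hbd p q (by omega) 0 p (p + 1) _ rfl,
      show j.negOnePow = -1 by rw [← hj]; rfl]
    simp only [totBd, Units.neg_smul, one_smul, LinearMap.zero_apply, add_zero]
    simp
    rfl
  · exact GHom.δ_shape hj _

lemma δ_totIncl_succ (n : ℕ) (j : ℤ) (hj : -((n + 1 : ℕ) : ℤ) + 1 = j) :
    GHom.δ (-((n + 1 : ℕ) : ℤ)) j (totIncl bd hbd (n + 1)) =
      (GHom.ofHom (bd n)).comp (totIncl bd hbd n) (by push_cast at hj; omega) := by
  apply GHom.ext
  intro p q h x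
  have hs : j.negOnePow = -((n + 1 : ℕ) : ℤ).negOnePow := by
    rw [← hj, Int.negOnePow_succ, Int.negOnePow_neg]
  rw [GHom.δ_apply hj _ p q (p + 1) (q - 1) h rfl (by omega), totIncl_apply, totIncl_apply,
    totCx_d_totMk bd hbd (q - 1) q (by omega) (n + 1) p (p + 1) _ rfl,
    GHom.comp_apply _ _ _ p p q (add_zero p) (by push_cast at hj; omega), totIncl_apply, hs,
    GHom.ofHom_apply, totBd_succ, Units.neg_smul]
  abel

variable {bd hbd}

/-- Cochains out of the total complex are determined by their restrictions to the summands. -/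
lemma tot_cochain_ext {K : CochainComplex (ModuleCat.{u} k) ℤ} {e : ℤ}
    {z w : Cochain (tot bd hbd).cx K e}
    (H : ∀ n, (totIncl bd hbd n).1.comp z rfl = (totIncl bd hbd n).1.comp w rfl) : z = w := by
  apply cochain_ext
  intro m q h x
  suffices (z.v m q h).hom = (w.v m q h).hom from congr($this x)
  apply tot_hom_ext
  intro n p hp x
  have := congr((($(H n)).v p q (by omega)).hom x)
  rwa [cochain_comp_apply _ _ _ p m q hp h, cochain_comp_apply _ _ _ p m q hp h] at this

lemma tot_ext {M : DGModule B} {e : ℤ} {z w : GHom (tot bd hbd) M e}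
    (H : ∀ n, (totIncl bd hbd n).comp z rfl = (totIncl bd hbd n).comp w rfl) : z = w :=
  Subtype.ext (tot_cochain_ext fun n => congrArg Subtype.val (H n))

variable (bd hbd)

/-- The cochain out of the total complex with given restrictions to the summands. -/
def totDescC {K : CochainComplex (ModuleCat.{u} k) ℤ} {e : ℤ}
    (w : ∀ n : ℕ, Cochain (Z n).cx K (-(n : ℤ) + e)) : Cochain (tot bd hbd).cx K e :=
  Cochain.mk fun _ q _ => ModuleCat.ofHom (totDescX fun n p _ => ((w n).v p q (by omega)).hom)

lemma totDescC_totMk {K : CochainComplex (ModuleCat.{u} k) ℤ} {e : ℤ}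
    (w : ∀ n : ℕ, Cochain (Z n).cx K (-(n : ℤ) + e)) (m q : ℤ) (h : m + e = q) (n : ℕ) (p : ℤ)
    (hp : p + -(n : ℤ) = m) (x : (Z n).cx.X p) :
    ((totDescC bd hbd w).v m q h).hom (totMk Z n p m hp x) =
      ((w n).v p q (by omega)).hom x :=
  totDescX_totMk _ _ _ _ _

@[simp]
lemma totIncl_totDescC {K : CochainComplex (ModuleCat.{u} k) ℤ} {e : ℤ}
    (w : ∀ n : ℕ, Cochain (Z n).cx K (-(n : ℤ) + e)) (n : ℕ) :
    (totIncl bd hbd n).1.comp (totDescC bd hbd w) rfl = w n := by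
  apply cochain_ext
  intro p q h x
  rw [cochain_comp_apply _ _ _ p (p + -(n : ℤ)) q rfl (by omega)]
  exact totDescC_totMk bd hbd w _ _ _ n p rfl x

/-- The graded map out of the total module with given restrictions to the summands. -/
def totDesc {M : DGModule B} {e : ℤ} (w : ∀ n : ℕ, GHom (Z n) M (-(n : ℤ) + e)) :
    GHom (tot bd hbd) M e :=
  ⟨totDescC bd hbd fun n => (w n).1, by
    intro i j l i' l' h hi hl x b
    suffices ((totDescC bd hbd fun n => (w n).1).v l l' hl).hom.comp
        ((totAct Z i j l h).flip b) = ((M.act i' j l' (by omega)).flip b).comp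
        ((totDescC bd hbd fun n => (w n).1).v i i' hi).hom from congr($this x)
    apply tot_hom_ext
    intro n p hp x
    simp only [LinearMap.comp_apply, LinearMap.flip_apply]
    rw [totAct_totMk i j l h n p (p + j) hp rfl, totDescC_totMk, totDescC_totMk]
    exact (w n).map_act p j (p + j) i' l' rfl (by omega) (by omega) x b⟩

@[simp]
lemma totIncl_totDesc {M : DGModule B} {e : ℤ} (w : ∀ n : ℕ, GHom (Z n) M (-(n : ℤ) + e))
    (n : ℕ) : (totIncl bd hbd n).comp (totDesc bd hbd w) rfl = w n :=
  Subtype.ext (totIncl_totDescC bd hbd (fun n => (w n).1) n)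

end Tot
end DGModule

namespace DGModule

open CochainComplex.HomComplex

namespace GHom

variable {k : Type u} [CommRing k] {A : DGAlgebra k} {M N P : DGModule A}

lemma units_smul_comp {a b c : ℤ} (e : ℤˣ) (z : GHom M N a) (w : GHom N P b) (h : a + b = c) :
    (e • z).comp w h = e • z.comp w h := by
  rcases Int.units_eq_one_or e with rfl | rfl
  · rw [one_smul, one_smul]
  · rw [Units.neg_smul, Units.neg_smul, one_smul, one_smul, neg_comp]

lemma comp_units_smul {a b c : ℤ} (e : ℤˣ) (z : GHom M N a) (w : GHom N P b) (h : a + b = c) :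
    z.comp (e • w) h = e • z.comp w h := by
  rcases Int.units_eq_one_or e with rfl | rfl
  · rw [one_smul, one_smul]
  · rw [Units.neg_smul, Units.neg_smul, one_smul, one_smul, comp_neg]

lemma δ_units_smul {a : ℤ} (b : ℤ) (e : ℤˣ) (z : GHom M N a) : δ a b (e • z) = e • δ a b z := by
  rcases Int.units_eq_one_or e with rfl | rfl
  · rw [one_smul, one_smul]
  · rw [Units.neg_smul, Units.neg_smul, one_smul, one_smul, map_neg]

lemma comp_comp_eq_zero {Q : DGModule A} {a b c ab bc abc : ℤ} {z : GHom M N a} {w : GHom N P b}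
    {h₁ : a + b = ab} (hzw : z.comp w h₁ = 0) (t : GHom P Q c) (h₂ : b + c = bc)
    (h : a + bc = abc) : z.comp (w.comp t h₂) h = 0 := by
  rw [← GHom.comp_assoc z w t h₁ h₂ (by omega), hzw, zero_comp]

end GHom

/-! ### Total DG modules of K-projective DG modules -/

section

variable {k : Type u} [CommRing k] {B : DGAlgebra k}

/-- The recursion step in the proof that total modules of K-projective modules are K-projective. -/
lemma IsKProjective.exists_extension {M M₀ N : DGModule B} (hM : IsKProjective M) (hN : IsAcyclic N)
    (f : M ⟶ M₀) {a b b' c : ℤ} (hc : c + 1 = b) (hb : b + 1 = a) (hb' : 0 + b' = b) (e : ℤˣ)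
    (y : GHom M N b) (y₀ : GHom M₀ N a) (w : GHom M₀ N b')
    (hy : GHom.δ b a y = -(e • (GHom.ofHom f).comp y₀ (zero_add a)))
    (hw : (GHom.ofHom f).comp (GHom.δ b' a w) (zero_add a) =
      (GHom.ofHom f).comp y₀ (zero_add a)) :
    ∃ w' : GHom M N c, GHom.δ c b w' = y + e • (GHom.ofHom f).comp w hb' := by
  refine hM N hN c b a hc hb _ ?_
  rw [map_add, hy, GHom.δ_units_smul, GHom.δ_comp _ _ hb' (zero_add 1) (by omega : b' + 1 = a) hb,
    GHom.δ_ofHom, GHom.zero_comp, smul_zero, add_zero, hw, neg_add_cancel]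

lemma isKProjective_tot {Z : ℕ → DGModule B}
    (bd : ∀ n, Z (n + 1) ⟶ Z n) (hbd : ∀ (n : ℕ) (p : ℤ) (x : (Z (n + 2)).cx.X p),
      ((bd n).f.f p).hom (((bd (n + 1)).f.f p).hom x) = 0)
    (hZ : ∀ n, IsKProjective (Z n)) : IsKProjective (tot bd hbd) := by
  intro N hN i n j hi hj z hz
  have h₁ (m : ℕ) : -(m : ℤ) + i + 1 = -(m : ℤ) + n := by omega
  have h₂ (m : ℕ) : -((m + 1 : ℕ) : ℤ) + n + 1 = -(m : ℤ) + n := by push_cast; omega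
  have h₃ (m : ℕ) : 0 + -(m : ℤ) + i = -((m + 1 : ℕ) : ℤ) + n := by push_cast; omega
  have hdeg (m : ℕ) : 0 + (-(m : ℤ) + i) = -((m + 1 : ℕ) : ℤ) + n := by push_cast; omega
  have hbd' (m : ℕ) : (GHom.ofHom (bd (m + 1))).comp (GHom.ofHom (bd m)) (add_zero 0) = 0 := by
    apply GHom.ext
    intro p q h x
    obtain rfl : p = q := by omega
    rw [GHom.comp_apply _ _ _ p p p h h, GHom.ofHom_apply, GHom.ofHom_apply, hbd]
    rfl
  -- `y m` is the restriction of `z` to `Z m`; the required graded map is built by recursion on `m`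
  obtain ⟨y, hy⟩ : ∃ y : ∀ m : ℕ, GHom (Z m) N (-(m : ℤ) + n),
    ∀ m, y m = (totIncl bd hbd m).comp z rfl := ⟨_, fun _ => rfl⟩
  have hy₀ : GHom.δ (-((0 : ℕ) : ℤ) + n) (-((0 : ℕ) : ℤ) + n + 1) (y 0) = 0 := by
    rw [hy, GHom.δ_comp _ _ _ rfl hj rfl, hz, δ_totIncl_zero, GHom.zero_comp, GHom.comp_zero,
      smul_zero, add_zero]
  have hy₁ (m : ℕ) : GHom.δ (-((m + 1 : ℕ) : ℤ) + n) (-(m : ℤ) + n) (y (m + 1)) =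
        -(i.negOnePow • (GHom.ofHom (bd m)).comp (y m) (zero_add _)) := by
    have hs : n.negOnePow = -i.negOnePow := by rw [← hi, Int.negOnePow_succ]
    rw [hy, hy, GHom.δ_comp _ _ _ rfl hj (h₂ m), hz, δ_totIncl_succ bd hbd m _ rfl,
      GHom.comp_zero, zero_add, hs, Units.neg_smul,
      GHom.comp_assoc (GHom.ofHom (bd m)) (totIncl bd hbd m) z _ rfl (by omega)]
  -- the invariant of the recursion
  let Good (m : ℕ) (w : GHom (Z m) N (-(m : ℤ) + i)) : Prop :=
    (GHom.ofHom (bd m)).comp (GHom.δ (-(m : ℤ) + i) (-(m : ℤ) + n) w) (zero_add _) =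
      (GHom.ofHom (bd m)).comp (y m) (zero_add _)
  obtain ⟨w₀, hw₀⟩ := hZ 0 N hN (-((0 : ℕ) : ℤ) + i) (-((0 : ℕ) : ℤ) + n) (-((0 : ℕ) : ℤ) + n + 1)
    (h₁ 0) rfl (y 0) hy₀
  have step (m : ℕ) (w : {w // Good m w}) : ∃ w' : {w' // Good (m + 1) w'},
      GHom.δ _ (-((m + 1 : ℕ) : ℤ) + n) w'.1 = y (m + 1) + i.negOnePow •
        (GHom.ofHom (bd m)).comp w.1 (hdeg m) := by
    obtain ⟨w', hw'⟩ := (hZ (m + 1)).exists_extension hN (bd m)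
      (h₁ (m + 1)) (h₂ m) (hdeg m) i.negOnePow (y (m + 1)) (y m) w.1 (hy₁ m) w.2
    refine ⟨⟨w', ?_⟩, hw'⟩
    dsimp only [Good]
    rw [hw', GHom.comp_add, GHom.comp_units_smul, GHom.comp_comp_eq_zero (hbd' m), smul_zero,
      add_zero]
  choose next hnext using step
  obtain ⟨w, hw₁, hw₂⟩ : ∃ w : ∀ m : ℕ, {w // Good m w},
      (w 0).1 = w₀ ∧ ∀ m, w (m + 1) = next m (w m) :=
    ⟨fun m => Nat.rec ⟨w₀, by dsimp only [Good]; rw [hw₀]⟩ next m, rfl, fun _ => rfl⟩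
  refine ⟨totDesc bd hbd fun m => (w m).1, tot_ext fun m => ?_⟩
  cases m with
  | zero =>
    have e := GHom.δ_comp (totIncl bd hbd 0) (totDesc bd hbd fun m => (w m).1) rfl rfl hi
      (h₁ _)
    rw [totIncl_totDesc, δ_totIncl_zero, GHom.zero_comp, smul_zero, add_zero] at e
    rw [hw₁] at e
    exact (e.symm.trans hw₀).trans (hy 0)
  | succ m =>
    have e := GHom.δ_comp (totIncl bd hbd (m + 1)) (totDesc bd hbd fun m => (w m).1) rfl rfl hi
      (h₁ _)
    have e' : GHom.δ _ (-((m + 1 : ℕ) : ℤ) + n) (w (m + 1)).1 = y (m + 1) + i.negOnePow •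
        (GHom.ofHom (bd m)).comp (w m).1 (hdeg m) := by rw [hw₂]; exact hnext m (w m)
    rw [totIncl_totDesc, e', δ_totIncl_succ bd hbd m _ rfl,
      GHom.comp_assoc (GHom.ofHom (bd m)) _ _ _ rfl (h₃ m), totIncl_totDesc] at e
    exact (add_right_cancel e).symm.trans (hy (m + 1))

end

/-! ### The bar resolution -/

section Bar

variable {k : Type u} [CommRing k] {B : DGAlgebra k}

/-- The terms of the augmented bar resolution of `X`: the iterated free modules
`X, X ⊗ B, X ⊗ B ⊗ B, …`. -/
@[reducible]
def barObj (X : DGModule B) : ℕ → DGModule B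
  | 0 => X
  | n + 1 => free B (barObj X n).cx

/-- The graded map `z ⊗ 1 : M ⊗ B ⟶ N ⊗ B` induced by a graded map `z`. -/
abbrev freeG {M N : DGModule B} {n : ℤ} :
    GHom M N n →ₗ[k] GHom (free B M.cx) (free B N.cx) n := (freeFun B).map

/-- The maps of the augmented bar resolution. The first one is the action map, and the others are
defined recursively by `∂ = ε - ∂ ⊗ 1`, where `ε` is the action map. -/
def barBd (X : DGModule B) : ∀ n, barObj X (n + 1) ⟶ barObj X n
  | 0 => freeCounit X
  | n + 1 => GHom.toHom (GHom.ofHom (freeCounit (barObj X (n + 1))) -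
      freeG (GHom.ofHom (barBd X n)))
      (by
        have e : GHom.δ 0 1 (freeG (GHom.ofHom (barBd X n))) = 0 :=
          ((freeFun B).map_δ (zero_add 1) _).symm.trans (by rw [GHom.δ_ofHom, map_zero]; rfl)
        rw [map_sub, GHom.δ_ofHom]
        exact (congrArg (0 - ·) e).trans (sub_zero _))

lemma ofHom_barBd_succ (X : DGModule B) (n : ℕ) : GHom.ofHom (barBd X (n + 1)) =
    GHom.ofHom (freeCounit (barObj X (n + 1))) - freeG (GHom.ofHom (barBd X n)) :=
  GHom.ofHom_toHom _ _

lemma freeG_comp_freeCounit {M N : DGModule B} {n : ℤ} (z : GHom M N n) :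
    (freeG z).comp (GHom.ofHom (freeCounit N)) (add_zero n) =
      (GHom.ofHom (freeCounit M)).comp z (zero_add n) :=
  freeCounit_naturality z

lemma freeG_comp {M N P : DGModule B} {a b c : ℤ} (z : GHom M N a) (w : GHom N P b)
    (h : a + b = c) : freeG (z.comp w h) = (freeG z).comp (freeG w) h :=
  (freeFun B).map_comp z w h

lemma barBd_barBd (X : DGModule B) (n : ℕ) :
    (GHom.ofHom (barBd X (n + 1))).comp (GHom.ofHom (barBd X n)) (add_zero 0) = 0 := by
  induction n with
  | zero =>
    rw [ofHom_barBd_succ, GHom.sub_comp, sub_eq_zero]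
    exact (freeG_comp_freeCounit (GHom.ofHom (freeCounit X))).symm
  | succ n ih =>
    rw [ofHom_barBd_succ X (n + 1), GHom.sub_comp, ← freeG_comp_freeCounit, ← GHom.comp_sub]
    have e : GHom.ofHom (freeCounit (barObj X (n + 1))) - GHom.ofHom (barBd X (n + 1)) =
      freeG (GHom.ofHom (barBd X n)) := by rw [ofHom_barBd_succ, sub_sub_cancel]
    refine (congrArg (fun t => (freeG (GHom.ofHom (barBd X (n + 1)))).comp t (add_zero 0))
      e).trans ?_
    rw [← freeG_comp, ih, map_zero]

/-- The action of graded maps on the terms of the augmented bar resolution. -/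
def barMap {X Y : DGModule B} {e : ℤ} : ∀ n, GHom X Y e →ₗ[k] GHom (barObj X n) (barObj Y n) e
  | 0 => LinearMap.id
  | n + 1 => freeG.comp (barMap n)

lemma barMap_succ {X Y : DGModule B} {e : ℤ} (n : ℕ) (φ : GHom X Y e) :
    barMap (n + 1) φ = freeG (barMap n φ) := rfl

lemma barMap_id (X : DGModule B) (n : ℕ) : barMap n (GHom.id X) = GHom.id (barObj X n) := by
  induction n with
  | zero => rfl
  | succ n ih => rw [barMap_succ, ih]; exact (freeFun B).map_id _

lemma barMap_comp {X Y W : DGModule B} {a b c : ℤ} (n : ℕ) (z : GHom X Y a) (w : GHom Y W b)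
    (h : a + b = c) : barMap n (z.comp w h) = (barMap n z).comp (barMap n w) h := by
  induction n with
  | zero => rfl
  | succ n ih => rw [barMap_succ, ih, freeG_comp, barMap_succ, barMap_succ]

lemma barMap_δ {X Y : DGModule B} {a b : ℤ} (n : ℕ) (h : a + 1 = b) (z : GHom X Y a) :
    barMap n (GHom.δ a b z) = GHom.δ a b (barMap n z) := by
  induction n with
  | zero => rfl
  | succ n ih => rw [barMap_succ, ih, barMap_succ]; exact (freeFun B).map_δ h _

lemma barMap_barBd {X Y : DGModule B} {e : ℤ} (n : ℕ) (φ : GHom X Y e) :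
    (barMap (n + 1) φ).comp (GHom.ofHom (barBd Y n)) (add_zero e) =
      (GHom.ofHom (barBd X n)).comp (barMap n φ) (zero_add e) := by
  induction n with
  | zero => exact freeG_comp_freeCounit φ
  | succ n ih =>
    rw [ofHom_barBd_succ, ofHom_barBd_succ, GHom.comp_sub, GHom.sub_comp, barMap_succ (n + 1),
      freeG_comp_freeCounit]
    congr 1
    rw [← freeG_comp, ih, freeG_comp]
    rfl

/-- The contraction of the augmented bar resolution, `x ↦ x ⊗ 1`. It is not linear over `B`. -/
abbrev barSec (X : DGModule B) (n : ℕ) : Cochain (barObj X n).cx (barObj X (n + 1)).cx 0 :=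
  freeUnit B (barObj X n).cx

lemma barSec_barBd_zero (X : DGModule B) :
    (barSec X 0).comp (GHom.ofHom (barBd X 0)).1 (add_zero 0) = Cochain.ofHom (𝟙 X.cx) :=
  freeUnit_freeCounit X

lemma barSec_naturality {X Y : DGModule B} {e : ℤ} (n : ℕ) (φ : GHom X Y e) :
    (barSec X n).comp (barMap (n + 1) φ).1 (zero_add e) =
      (barMap n φ).1.comp (barSec Y n) (add_zero e) :=
  freeUnit_naturality B (barMap n φ).1

lemma barSec_barBd_succ (X : DGModule B) (n : ℕ) :
    (barSec X (n + 1)).comp (GHom.ofHom (barBd X (n + 1))).1 (add_zero 0) =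
      Cochain.ofHom (𝟙 (barObj X (n + 1)).cx) -
        (GHom.ofHom (barBd X n)).1.comp (barSec X n) (add_zero 0) := by
  rw [ofHom_barBd_succ, Submodule.coe_sub, Cochain.comp_sub]
  congr 1
  · exact freeUnit_freeCounit (barObj X (n + 1))
  · exact freeUnit_naturality B (GHom.ofHom (barBd X n)).1

end Bar
end DGModule

namespace DGModule

open CochainComplex.HomComplex

section BarResolution

variable {k : Type u} [CommRing k] {B : DGAlgebra k}

lemma barBd_barBd_apply (X : DGModule B) (n : ℕ) (p : ℤ) (x : (barObj X (n + 2)).cx.X p) :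
    ((barBd X n).f.f p).hom (((barBd X (n + 1)).f.f p).hom x) = 0 := by
  have e := congr($(barBd_barBd X n).ap p p (add_zero p) x)
  rw [GHom.comp_apply _ _ _ p p p (add_zero p) (add_zero p), GHom.ofHom_apply,
    GHom.ofHom_apply] at e
  exact e

/-- The bar resolution of `X`, with terms `X ⊗ B, X ⊗ B ⊗ B, …`. -/
@[reducible]
def bar (X : DGModule B) : DGModule B :=
  tot (Z := fun n => barObj X (n + 1)) (fun n => barBd X (n + 1))
    fun n => barBd_barBd_apply X (n + 1)

/-- The inclusion of the `n`-th term in the bar resolution. -/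
abbrev barIncl (X : DGModule B) (n : ℕ) : GHom (barObj X (n + 1)) (bar X) (-(n : ℤ)) :=
  totIncl (Z := fun n => barObj X (n + 1)) _ _ n

lemma bar_ext {X M : DGModule B} {e : ℤ} {z w : GHom (bar X) M e}
    (H : ∀ n, (barIncl X n).comp z rfl = (barIncl X n).comp w rfl) : z = w :=
  tot_ext H

lemma δ_barIncl_zero (X : DGModule B) (j : ℤ) :
    GHom.δ (-((0 : ℕ) : ℤ)) j (barIncl X 0) = 0 :=
  δ_totIncl_zero _ _ j

lemma δ_barIncl_succ (X : DGModule B) (n : ℕ) (j : ℤ) (hj : -((n + 1 : ℕ) : ℤ) + 1 = j) :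
    GHom.δ (-((n + 1 : ℕ) : ℤ)) j (barIncl X (n + 1)) =
      (GHom.ofHom (barBd X (n + 1))).comp (barIncl X n) (by push_cast at hj; omega) :=
  δ_totIncl_succ _ _ n j hj

/-- The sign by which a graded map of degree `e` acts on the `n`-th term of the bar resolution. -/
abbrev barSign (n : ℕ) (e : ℤ) : ℤˣ := ((n : ℤ) * e).negOnePow

lemma barSign_add (n : ℕ) (a b : ℤ) : barSign n (a + b) = barSign n a * barSign n b := by
  rw [barSign, mul_add, Int.negOnePow_add]

lemma barSign_succ (n : ℕ) (e : ℤ) : barSign (n + 1) e = e.negOnePow * barSign n e := by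
  rw [barSign, Nat.cast_succ, add_mul, one_mul, Int.negOnePow_add, mul_comm]

/-- The graded map between bar resolutions induced by a graded map of degree `e`: it acts on the
`n`-th terms with the sign `(-1)ⁿᵉ`. -/
def barG {X Y : DGModule B} {e : ℤ} : GHom X Y e →ₗ[k] GHom (bar X) (bar Y) e where
  toFun φ := totDesc _ _ fun n =>
    barSign n e • (barMap (n + 1) φ).comp (barIncl Y n) (add_comm _ _)
  map_add' φ ψ := by
    refine bar_ext fun n => ?_
    rw [GHom.comp_add, totIncl_totDesc, totIncl_totDesc, totIncl_totDesc, map_add, GHom.add_comp,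
      smul_add]
  map_smul' c φ := by
    refine bar_ext fun n => ?_
    rw [GHom.comp_smul, totIncl_totDesc, totIncl_totDesc, map_smul, GHom.smul_comp, smul_comm]
    rfl

@[simp]
lemma barIncl_barG {X Y : DGModule B} {e : ℤ} (φ : GHom X Y e) (n : ℕ) :
    (barIncl X n).comp (barG φ) rfl =
      barSign n e • (barMap (n + 1) φ).comp (barIncl Y n) (add_comm _ _) :=
  totIncl_totDesc _ _ _ n

lemma barG_δ {X Y : DGModule B} {a b : ℤ} (h : a + 1 = b) (z : GHom X Y a) :
    barG (GHom.δ a b z) = GHom.δ a b (barG z) := by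
  have hd (n : ℕ) : -(n : ℤ) + a + 1 = -(n : ℤ) + b := by omega
  have hd' (n : ℕ) : -((n + 1 : ℕ) : ℤ) + 1 + a = -((n + 1 : ℕ) : ℤ) + b := by omega
  have hd₁ (n : ℕ) : 0 + -(n : ℤ) = -((n + 1 : ℕ) : ℤ) + 1 := by push_cast; omega
  have hd₂ (n : ℕ) : a + (-((n + 1 : ℕ) : ℤ) + 1) = -((n + 1 : ℕ) : ℤ) + b := by omega
  have hd₃ (n : ℕ) : a + -(n : ℤ) = -(n : ℤ) + a := by omega
  have hd₄ (n : ℕ) : 0 + (-(n : ℤ) + a) = -((n + 1 : ℕ) : ℤ) + b := by omega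
  have hd₅ (n : ℕ) : a + 0 + -(n : ℤ) = -((n + 1 : ℕ) : ℤ) + b := by omega
  have hd₆ (n : ℕ) : 0 + a + -(n : ℤ) = -((n + 1 : ℕ) : ℤ) + b := by omega
  have hd₇ (n : ℕ) : 0 + -(n : ℤ) + a = -((n + 1 : ℕ) : ℤ) + b := by omega
  refine bar_ext fun n => ?_
  have e₁ := GHom.δ_comp (barIncl X n) (barG z) rfl rfl h (hd n)
  have e₂ := GHom.δ_comp (barMap (n + 1) z) (barIncl Y n) (add_comm _ _) h rfl (hd n)
  have e₃ : barSign n a * (-(n : ℤ)).negOnePow = barSign n b := by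
    rw [← h, barSign_add, Int.negOnePow_neg, barSign, barSign, mul_one]
  rw [barIncl_barG, GHom.δ_units_smul, e₂, smul_add, smul_smul, e₃] at e₁
  rw [barIncl_barG, barMap_δ _ h]
  cases n with
  | zero =>
    rw [δ_barIncl_zero, δ_barIncl_zero, GHom.zero_comp, GHom.comp_zero, smul_zero,
      smul_zero] at e₁
    exact (zero_add _).symm.trans (e₁.trans (add_zero _))
  | succ n =>
    have e₄ : (barMap (n + 1 + 1) z).comp ((GHom.ofHom (barBd Y (n + 1))).comp (barIncl Y n)
        (hd₁ n)) (hd₂ n) = (GHom.ofHom (barBd X (n + 1))).comp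
        ((barMap (n + 1) z).comp (barIncl Y n) (hd₃ n)) (hd₄ n) := by
      rw [← GHom.comp_assoc _ _ _ (add_zero a) (hd₁ n) (hd₅ n), barMap_barBd,
        GHom.comp_assoc _ _ _ (zero_add a) (hd₃ n) (hd₆ n)]
    have e₅ : a.negOnePow • ((GHom.ofHom (barBd X (n + 1))).comp (barIncl X n) (hd₁ n)).comp
        (barG z) (hd' n) = barSign (n + 1) a • (GHom.ofHom (barBd X (n + 1))).comp
        ((barMap (n + 1) z).comp (barIncl Y n) (hd₃ n)) (hd₄ n) := by
      rw [GHom.comp_assoc _ _ _ (hd₁ n) rfl (hd₇ n), barIncl_barG, GHom.comp_units_smul, smul_smul,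
        ← barSign_succ]
    rw [δ_barIncl_succ X n _ rfl, δ_barIncl_succ Y n _ rfl, e₄, e₅] at e₁
    exact add_right_cancel ((add_comm _ _).trans e₁)

/-- The bar resolution as a DG functor. -/
@[reducible]
def barFun (B : DGAlgebra k) : DGFun B B where
  obj := bar
  map := barG
  map_id X := by
    refine bar_ext fun n => ?_
    rw [barIncl_barG, barMap_id, barSign, mul_zero, Int.negOnePow_zero, one_smul]
    apply GHom.ext
    intro p q h x
    rw [GHom.comp_apply _ _ _ p p q (add_zero p) (by omega),
      GHom.comp_apply _ _ _ p q q (by omega) (add_zero q)]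
    rfl
  map_comp {X Y W a b c} z w h := by
    have hd (n : ℕ) : -(n : ℤ) + a + b = -(n : ℤ) + c := by omega
    have hd' (n : ℕ) : a + -(n : ℤ) + b = -(n : ℤ) + c := by omega
    have hd'' (n : ℕ) : a + b + -(n : ℤ) = -(n : ℤ) + c := by omega
    refine bar_ext fun n => ?_
    rw [← GHom.comp_assoc _ _ _ rfl h (hd n), barIncl_barG, barIncl_barG, GHom.units_smul_comp,
      GHom.comp_assoc _ _ _ (add_comm _ _) rfl (hd' n), barIncl_barG, GHom.comp_units_smul,
      smul_smul, ← barSign_add, h, barMap_comp _ z w h,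
      GHom.comp_assoc _ _ _ h (add_comm _ _) (hd'' n)]
  map_δ h z := barG_δ h z

/-- The augmentation of the bar resolution, as a graded map. -/
def barAugG (X : DGModule B) : GHom (bar X) X 0 :=
  totDesc _ _ fun n => match n with
    | 0 => (GHom.ofHom (freeCounit X)).comp (GHom.id X) rfl
    | _ + 1 => 0

lemma barIncl_barAugG_zero (X : DGModule B) (h : -((0 : ℕ) : ℤ) + 0 = 0) :
    (barIncl X 0).comp (barAugG X) h = GHom.ofHom (barBd X 0) :=
  (totIncl_totDesc _ _ _ 0).trans (GHom.comp_id _)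

lemma barIncl_barAugG_succ (X : DGModule B) (n : ℕ) (a : ℤ) (h : -((n + 1 : ℕ) : ℤ) + 0 = a) :
    (barIncl X (n + 1)).comp (barAugG X) h = 0 := by
  subst h
  exact totIncl_totDesc _ _ _ (n + 1)

lemma δ_barAugG (X : DGModule B) : GHom.δ 0 1 (barAugG X) = 0 := by
  have hd (n : ℕ) : -(n : ℤ) + 0 + 1 = -(n : ℤ) + 1 := by omega
  have hd₁ (n : ℕ) : 0 + -(n : ℤ) = -((n + 1 : ℕ) : ℤ) + 1 := by push_cast; omega
  have hd₂ (n : ℕ) : -(n : ℤ) + 0 = -((n + 1 : ℕ) : ℤ) + 1 := by push_cast; omega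
  have hd₃ (n : ℕ) : 0 + (-((n + 1 : ℕ) : ℤ) + 1) = -((n + 1 : ℕ) : ℤ) + 1 := by omega
  have hd₄ (n : ℕ) : 0 + -(n : ℤ) + 0 = -((n + 1 : ℕ) : ℤ) + 1 := by push_cast; omega
  refine bar_ext fun n => ?_
  have e := GHom.δ_comp (barIncl X n) (barAugG X) rfl rfl (zero_add 1) (hd n)
  rw [GHom.comp_zero]
  cases n with
  | zero =>
    have e' : GHom.δ (-((0 : ℕ) : ℤ) + 0) (-((0 : ℕ) : ℤ) + 1)
        ((barIncl X 0).comp (barAugG X) rfl) = 0 := by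
      rw [barIncl_barAugG_zero X rfl]
      exact GHom.δ_ofHom _ _
    rw [e', δ_barIncl_zero, GHom.zero_comp, smul_zero] at e
    exact (e.trans (add_zero _)).symm
  | succ n =>
    rw [barIncl_barAugG_succ, map_zero, δ_barIncl_succ X n _ rfl,
      GHom.comp_assoc _ _ _ (hd₁ n) (hd₂ n) (hd₄ n)] at e
    have e' : (GHom.ofHom (barBd X (n + 1))).comp ((barIncl X n).comp (barAugG X) (hd₂ n))
        (hd₃ n) = 0 := by
      cases n with
      | zero =>
        rw [barIncl_barAugG_zero X]
        exact barBd_barBd X 0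
      | succ n => rw [barIncl_barAugG_succ, GHom.comp_zero]
    rw [e', smul_zero] at e
    exact (e.trans (add_zero _)).symm

/-- The augmentation of the bar resolution. -/
def barAug (X : DGModule B) : bar X ⟶ X := GHom.toHom (barAugG X) (δ_barAugG X)

lemma ofHom_barAug (X : DGModule B) : GHom.ofHom (barAug X) = barAugG X := GHom.ofHom_toHom _ _

/-- The augmentation is natural with respect to graded maps of all degrees. -/
lemma barG_barAug {X Y : DGModule B} {e : ℤ} (φ : GHom X Y e) :
    (barG φ).comp (GHom.ofHom (barAug Y)) (add_zero e) =
      (GHom.ofHom (barAug X)).comp φ (zero_add e) := by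
  have hd (n : ℕ) : -(n : ℤ) + e + 0 = -(n : ℤ) + e := by omega
  have hd₁ (n : ℕ) : -(n : ℤ) + 0 + e = -(n : ℤ) + e := by omega
  have hd₂ (n : ℕ) : e + -(n : ℤ) + 0 = -(n : ℤ) + e := by omega
  have hd₃ (n : ℕ) : e + -(n : ℤ) = -(n : ℤ) + e := by omega
  have hd₄ (n : ℕ) : e + (-(n : ℤ) + 0) = -(n : ℤ) + e := by omega
  have h₀ : -((0 : ℕ) : ℤ) + 0 = 0 := rfl
  rw [ofHom_barAug, ofHom_barAug]
  refine bar_ext fun n => ?_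
  rw [← GHom.comp_assoc _ _ _ rfl (add_zero e) (hd n), barIncl_barG, GHom.units_smul_comp]
  cases n with
  | zero =>
    have hs : barSign 0 e = 1 := by rw [barSign, Nat.cast_zero, zero_mul, Int.negOnePow_zero]
    rw [GHom.comp_assoc _ _ _ (hd₃ 0) h₀ (hd₂ 0), ← GHom.comp_assoc _ _ _ h₀ (zero_add e) (hd₁ 0),
      barIncl_barAugG_zero X h₀, barIncl_barAugG_zero Y h₀, hs, one_smul]
    apply GHom.ext
    intro p q h x
    have hq : p + e = q := by rw [← h, Nat.cast_zero, neg_zero, zero_add]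
    have e₁ := congr($(barMap_barBd 0 φ).ap p q hq x)
    rw [GHom.comp_apply _ _ _ p q q hq (add_zero q),
      GHom.comp_apply _ _ _ p p q (add_zero p) hq] at e₁ ⊢
    exact e₁
  | succ n =>
    rw [GHom.comp_assoc _ _ _ (hd₃ (n + 1)) rfl (hd₂ (n + 1)),
      ← GHom.comp_assoc _ _ _ rfl (zero_add e) (hd₁ (n + 1)), barIncl_barAugG_succ,
      barIncl_barAugG_succ, GHom.comp_zero, GHom.zero_comp, smul_zero]

lemma barFun_map_barAug {X Y : DGModule B} (f : X ⟶ Y) :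
    (barFun B).functor.map f ≫ barAug Y = barAug X ≫ f := by
  apply GHom.ofHom_injective
  rw [GHom.ofHom_comp, GHom.ofHom_comp, DGFun.ofHom_functor_map]
  exact barG_barAug (GHom.ofHom f)

lemma barAug_apply_zero (X : DGModule B) (p : ℤ) (h : p + -((0 : ℕ) : ℤ) = p)
    (x : (barObj X 1).cx.X p) :
    ((barAug X).f.f p).hom (totMk (fun n => barObj X (n + 1)) 0 p p h x) =
      ((barBd X 0).f.f p).hom x := by
  have e := congr($(barIncl_barAugG_zero X rfl).ap p p (add_zero p) x)
  rw [GHom.comp_apply _ _ _ p p p h (add_zero p)] at e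
  exact e

lemma barAug_apply_succ (X : DGModule B) (n : ℕ) (p m : ℤ) (h : p + -((n + 1 : ℕ) : ℤ) = m)
    (x : (barObj X (n + 2)).cx.X p) :
    ((barAug X).f.f m).hom (totMk (fun n => barObj X (n + 1)) (n + 1) p m h x) = 0 := by
  have e := congr($(barIncl_barAugG_succ X n _ rfl).ap p m (by omega) x)
  rw [GHom.comp_apply _ _ _ p m m h (add_zero m)] at e
  exact e

lemma bar_d_totMk (X : DGModule B) (m m' : ℤ) (hm : m + 1 = m') (n : ℕ) (p p' : ℤ)
    (h : p + -(n : ℤ) = m) (hp : p + 1 = p') (h₁ : p' + -(n : ℤ) = m')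
    (h₂ : p + -(n : ℤ) + 1 = m') (x : (barObj X (n + 1)).cx.X p) :
    ((bar X).cx.d m m').hom (totMk (fun n => barObj X (n + 1)) n p m h x) =
      (n : ℤ).negOnePow • totMk (fun n => barObj X (n + 1)) n p' m' h₁
        (((barObj X (n + 1)).cx.d p p').hom x) +
        totBd (Z := fun n => barObj X (n + 1)) (fun n => barBd X (n + 1)) n p m' h₂ x := by
  exact totCx_d_totMk (Z := fun n => barObj X (n + 1)) (fun n => barBd X (n + 1))
    (fun n => barBd_barBd_apply X (n + 1)) m m' hm n p p' h hp x

/-- The section `x ↦ x ⊗ 1` of the augmentation of the bar resolution. -/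
def barUnit (X : DGModule B) : Cochain X.cx (bar X).cx 0 :=
  Cochain.mk fun p q h => (barSec X 0).v p p (add_zero p) ≫
    (barIncl X 0).1.v p q (by simpa using h)

lemma barUnit_apply (X : DGModule B) (p q : ℤ) (h : p + 0 = q) (x : X.cx.X p) :
    ((barUnit X).v p q h).hom x =
      totMk (fun n => barObj X (n + 1)) 0 p q (by simpa using h)
        (((barSec X 0).v p p (add_zero p)).hom x) := rfl

/-- The contracting homotopy of the augmented bar resolution. -/
def barHomotopy (X : DGModule B) : Cochain (bar X).cx (bar X).cx (-1) :=
  totDescC _ _ fun n => (barSec X (n + 1)).comp (barIncl X (n + 1)).1 (by push_cast; omega)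

lemma barHomotopy_apply (X : DGModule B) (n : ℕ) (p m q : ℤ) (h : m + -1 = q)
    (hp : p + -(n : ℤ) = m) (hq : p + -((n + 1 : ℕ) : ℤ) = q) (x : (barObj X (n + 1)).cx.X p) :
    ((barHomotopy X).v m q h).hom (totMk (fun n => barObj X (n + 1)) n p m hp x) =
      totMk (fun n => barObj X (n + 1)) (n + 1) p q hq
        (((barSec X (n + 1)).v p p (add_zero p)).hom x) := by
  refine Eq.trans (totDescC_totMk (Z := fun n => barObj X (n + 1)) _ _ _ m q h n p hp x) ?_
  exact cochain_comp_apply (barSec X (n + 1)) (barIncl X (n + 1)).1 _ p p q (add_zero p) hq x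

lemma barSec_d (X : DGModule B) (n : ℕ) (p p' : ℤ) (hp : p + 1 = p') (x : (barObj X n).cx.X p) :
    ((barObj X (n + 1)).cx.d p p').hom (((barSec X n).v p p (add_zero p)).hom x) =
      ((barSec X n).v p' p' (add_zero p')).hom (((barObj X n).cx.d p p').hom x) := by
  have e := congr(($(δ_freeUnit B (barObj X n).cx 1).v p p' hp).hom x)
  rw [cochain_δ_apply (zero_add 1) _ p p' p' p hp hp hp,
    show (1 : ℤ).negOnePow = -1 from rfl, Units.neg_smul, one_smul, ← sub_eq_add_neg] at e
  exact sub_eq_zero.1 e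

lemma barBd_barSec_zero (X : DGModule B) (p : ℤ) (x : X.cx.X p) :
    ((barBd X 0).f.f p).hom (((barSec X 0).v p p (add_zero p)).hom x) = x := by
  have e := congr(($(barSec_barBd_zero X).v p p (add_zero p)).hom x)
  rw [cochain_comp_apply _ _ _ p p p (add_zero p) (add_zero p), Cochain.ofHom_v] at e
  exact e

lemma barBd_barSec_succ (X : DGModule B) (n : ℕ) (p : ℤ) (x : (barObj X (n + 1)).cx.X p) :
    ((barBd X (n + 1)).f.f p).hom (((barSec X (n + 1)).v p p (add_zero p)).hom x) =
      x - ((barSec X n).v p p (add_zero p)).hom (((barBd X n).f.f p).hom x) := by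
  have e := congr(($(barSec_barBd_succ X n).v p p (add_zero p)).hom x)
  rw [cochain_comp_apply _ _ _ p p p (add_zero p) (add_zero p), GHom.ofHom_coe, GHom.ofHom_coe,
    Cochain.sub_v, Cochain.ofHom_v, Cochain.ofHom_v, ModuleCat.hom_sub, LinearMap.sub_apply,
    cochain_comp_apply _ _ _ p p p (add_zero p) (add_zero p), Cochain.ofHom_v] at e
  exact e

lemma δ_barUnit (X : DGModule B) : δ 0 1 (barUnit X) = 0 := by
  apply cochain_ext
  intro p q h x
  rw [cochain_δ_apply (zero_add 1) _ p q q p h h h, barUnit_apply, barUnit_apply]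
  rw [bar_d_totMk X p q h 0 p q _ h (by simp) (by simpa using h), barSec_d X 0 p q h,
      show (1 : ℤ).negOnePow = -1 from rfl,
    show (((0 : ℕ) : ℤ)).negOnePow = 1 from rfl, one_smul, Units.neg_smul, one_smul]
  simp [totBd]

lemma barUnit_barAug (X : DGModule B) :
    (barUnit X).comp (Cochain.ofHom (barAug X).f) (add_zero 0) = Cochain.ofHom (𝟙 X.cx) := by
  apply cochain_ext
  intro p q h x
  obtain rfl : p = q := by omega
  rw [cochain_comp_apply _ _ _ p p p h h, barUnit_apply, Cochain.ofHom_v, Cochain.ofHom_v,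
    barAug_apply_zero]
  exact barBd_barSec_zero X p x

lemma δ_barHomotopy (X : DGModule B) : δ (-1) 0 (barHomotopy X) =
    Cochain.ofHom (𝟙 (bar X).cx) -
      (Cochain.ofHom (barAug X).f).comp (barUnit X) (add_zero 0) := by
  apply cochain_ext
  intro m q h x
  obtain rfl : m = q := by omega
  rw [cochain_δ_apply (by omega) _ m m (m + 1) (m - 1) h rfl (by omega), Int.negOnePow_zero,
    one_smul,
    Cochain.sub_v, ModuleCat.hom_sub, LinearMap.sub_apply,
    cochain_comp_apply _ _ _ m m m h h, Cochain.ofHom_v, Cochain.ofHom_v]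
  suffices (((bar X).cx.d (m - 1) m).hom.comp ((barHomotopy X).v m (m - 1) (by omega)).hom +
      ((barHomotopy X).v (m + 1) m (by omega)).hom.comp ((bar X).cx.d m (m + 1)).hom) =
      LinearMap.id - ((barUnit X).v m m h).hom.comp ((barAug X).f.f m).hom from congr($this x)
  refine tot_hom_ext (Z := fun n => barObj X (n + 1)) fun n p hp x => ?_
  have hm : m - 1 + 1 = m := by omega
  have hq : p + -((n + 1 : ℕ) : ℤ) = m - 1 := by push_cast; omega
  have hq' : p + 1 + -((n + 1 : ℕ) : ℤ) = m := by push_cast; omega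
  have hp' : p + 1 + -(n : ℤ) = m + 1 := by omega
  change ((bar X).cx.d (m - 1) m).hom (((barHomotopy X).v m (m - 1) _).hom _) +
    ((barHomotopy X).v (m + 1) m (by omega)).hom (((bar X).cx.d m (m + 1)).hom _) =
    _ - ((barUnit X).v m m h).hom (((barAug X).f.f m).hom _)
  rw [barHomotopy_apply X n p m (m - 1) _ hp hq]
  rw [bar_d_totMk X (m - 1) m hm (n + 1) p (p + 1) _ rfl hq' (by rw [hq, hm]),
    bar_d_totMk X m (m + 1) rfl n p (p + 1) hp rfl hp' (by rw [hp])]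
  have e₂ : ((n + 1 : ℕ) : ℤ).negOnePow = -(n : ℤ).negOnePow := by
    rw [Nat.cast_succ, Int.negOnePow_succ]
  rw [totBd_succ, barBd_barSec_succ, barSec_d X (n + 1) p (p + 1) rfl, map_add, map_zsmul_unit,
    barHomotopy_apply X n (p + 1) (m + 1) m _ hp' hq', e₂, Units.neg_smul]
  cases n with
  | zero =>
    obtain rfl : p = m := by simpa using hp
    rw [barAug_apply_zero, barUnit_apply]
    simp [totBd]
  | succ n =>
    rw [barAug_apply_succ, totBd_succ, barHomotopy_apply X n p (m + 1) m _ _ hp,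
      map_zero, sub_zero, LinearMap.id_apply, map_sub]
    abel

lemma quasiIso_barAug (X : DGModule B) : quasiIso B (barAug X) :=
  quasiIso_of_homotopy (barAug X) (barUnit X) (δ_barUnit X) (barHomotopy X) 0 (δ_barHomotopy X)
    (by rw [barUnit_barAug, sub_self, δ_zero])

end BarResolution

/-- Over a field, the bar resolution is K-projective. -/
lemma isKProjective_bar {k : Type u} [Field k] {B : DGAlgebra k} (X : DGModule B) :
    IsKProjective (bar X) :=
  isKProjective_tot _ _ fun n => isKProjective_free (barObj X n).cx

end DGModule

/-! ### Derived functors from functorial resolutions -/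

section Resolution

open Functor

variable {C D H : Type*} [Category* C] [Category* D] [Category* H] (L : C ⥤ D)
  (W : MorphismProperty C) [L.IsLocalization W] {F : D ⥤ H} {G : C ⥤ H} (α : L ⋙ F ⟶ G)
  {P : C ⥤ C} (p : P ⟶ 𝟭 C)

/-- The comparison transformation in the proof that a functor with `α` invertible on resolutions is
a left derived functor: on `L X` it is the transport along `p : P X ⟶ X` of `β ≫ α⁻¹`. -/
def resolutionLift (hp : ∀ X, IsIso (L.map (p.app X))) (hα : ∀ X, IsIso (α.app (P.obj X)))
    (G' : D ⥤ H) (β : L ⋙ G' ⟶ G) : L ⋙ G' ⟶ L ⋙ F where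
  app X := inv (G'.map (L.map (p.app X))) ≫ β.app (P.obj X) ≫ inv (α.app (P.obj X)) ≫
    F.map (L.map (p.app X))
  naturality X Y f := by
    have h₁ : L.map (P.map f) ≫ L.map (p.app Y) = L.map (p.app X) ≫ L.map f := by
      rw [← L.map_comp, p.naturality, L.map_comp, Functor.id_map]
    have h₂ := β.naturality (P.map f)
    have h₃ := α.naturality (P.map f)
    dsimp at h₂ h₃ ⊢
    have h₄ : F.map (L.map (P.map f)) ≫ F.map (L.map (p.app Y)) =
        F.map (L.map (p.app X)) ≫ F.map (L.map f) := by rw [← F.map_comp, h₁, F.map_comp]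
    have h₅ : G'.map (L.map (P.map f)) ≫ G'.map (L.map (p.app Y)) =
        G'.map (L.map (p.app X)) ≫ G'.map (L.map f) := by rw [← G'.map_comp, h₁, G'.map_comp]
    rw [← cancel_epi (G'.map (L.map (p.app X))), ← reassoc_of% h₅, IsIso.hom_inv_id_assoc]
    simp only [Category.assoc, IsIso.hom_inv_id_assoc]
    rw [← h₄, reassoc_of% h₂]
    congr 1
    rw [← cancel_epi (α.app (P.obj X)), ← reassoc_of% h₃]
    simp

/-- A functor out of a localization is a left derived functor of `G` as soon as the comparison
transformation to `G` is invertible on the objects `P X` of a functorial resolution. -/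
lemma isLeftDerivedFunctor_of_resolution (hp : ∀ X, W (p.app X))
    (hα : ∀ X, IsIso (α.app (P.obj X))) : F.IsLeftDerivedFunctor α W := by
  have hp' (X : C) : IsIso (L.map (p.app X)) := Localization.inverts L W _ (hp X)
  have exist (G' : D ⥤ H) (β : L ⋙ G' ⟶ G) : ∃ γ : G' ⟶ F, whiskerLeft L γ ≫ α = β := by
    refine ⟨Localization.liftNatTrans L W (L ⋙ G') (L ⋙ F) G' F
      (resolutionLift L α p hp' hα G' β), ?_⟩
    ext X
    have h₁ := β.naturality (p.app X)
    have h₂ := α.naturality (p.app X)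
    dsimp at h₁ h₂ ⊢
    rw [Localization.liftNatTrans_app]
    simp [resolutionLift, h₂, ← h₁]
  have uniq (G' : D ⥤ H) (γ γ' : G' ⟶ F) (h : whiskerLeft L γ ≫ α = whiskerLeft L γ' ≫ α) :
      γ = γ' := by
    refine Localization.natTrans_ext L W fun X => ?_
    have h₁ := congr_app h (P.obj X)
    have h₂ := γ.naturality (L.map (p.app X))
    have h₃ := γ'.naturality (L.map (p.app X))
    dsimp at h₁ h₂ h₃
    rw [cancel_mono] at h₁
    rw [← cancel_epi (G'.map (L.map (p.app X))), h₂, h₃, h₁]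
  rw [isLeftDerivedFunctor_iff_isRightKanExtension]
  refine ⟨⟨Limits.IsTerminal.ofUniqueHom
    (fun E => CostructuredArrow.homMk (exist E.left E.hom).choose
      (exist E.left E.hom).choose_spec) fun E m => ?_⟩⟩
  refine CostructuredArrow.hom_ext _ _ (uniq _ _ _ ?_)
  exact (CostructuredArrow.w m).trans (exist E.left E.hom).choose_spec.symm

/-- The left derived functor obtained from a functorial resolution is absolute: composing it with
any functor gives a left derived functor. -/
lemma isLeftDerivedFunctor_comp_of_resolution {H' : Type*} [Category* H'] (K : H ⥤ H')
    (hp : ∀ X, W (p.app X)) (hα : ∀ X, IsIso (α.app (P.obj X))) :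
    (F ⋙ K).IsLeftDerivedFunctor ((Functor.associator _ _ _).inv ≫ whiskerRight α K) W :=
  isLeftDerivedFunctor_of_resolution L W _ p hp fun X => by
    have := hα X
    dsimp
    rw [Category.id_comp]
    infer_instance

end Resolution

/-! ### Equivalences between derived functors of adjoint functors -/

section DerivedAdjunction

open Functor

variable {C₁ C₂ D₁ D₂ : Type*} [Category* C₁] [Category* C₂] [Category* D₁] [Category* D₂]
  {G : C₁ ⥤ C₂} {R : C₂ ⥤ C₁} (adj : G ⊣ R)
  (L₁ : C₁ ⥤ D₁) (L₂ : C₂ ⥤ D₂) (W₁ : MorphismProperty C₁) (W₂ : MorphismProperty C₂)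
  [L₁.IsLocalization W₁] [L₂.IsLocalization W₂]
  {G' : D₁ ⥤ D₂} {R' : D₂ ⥤ D₁}
  (α : L₁ ⋙ G' ⟶ G ⋙ L₂) (β : R ⋙ L₁ ≅ L₂ ⋙ R') {P : C₁ ⥤ C₁} (p : P ⟶ 𝟭 C₁)

include adj p β W₂ in
/-- Let `G ⊣ R` be adjoint functors such that `R` inverts quasi-isomorphisms and the left derived
functor of `G` is computed by the resolutions `P`. The left derived functor is an equivalence if and
only if the unit of the adjunction is invertible, in the localization, at the resolutions,
and `R` reflects quasi-isomorphisms. -/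
lemma isEquivalence_leftDerived_iff (hp : ∀ X, W₁ (p.app X))
    (hα : ∀ X, IsIso (α.app (P.obj X))) (S : C₁ → Prop) (hS : ∀ X, S (P.obj X))
    (hSα : ∀ X, S X → IsIso (α.app X)) [L₁.EssSurj] [L₂.EssSurj] :
    G'.IsEquivalence ↔ (∀ X, S X → IsIso (L₁.map (adj.unit.app X))) ∧
      ∀ ⦃Y Y' : C₂⦄ (g : Y ⟶ Y'), IsIso (L₁.map (R.map g)) → IsIso (L₂.map g) := by
  have hp' (X : C₁) : IsIso (L₁.map (p.app X)) := Localization.inverts L₁ W₁ _ (hp X)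
  have := isLeftDerivedFunctor_of_resolution L₁ W₁ α p hp hα
  have := isLeftDerivedFunctor_comp_of_resolution L₁ W₁ α p R' hp hα
  have : R'.IsRightDerivedFunctor β.hom W₂ :=
    isRightDerivedFunctor_of_inverts W₂ R' β.symm
  have : (R' ⋙ G').IsRightDerivedFunctor
      (whiskerRight β.hom G' ≫ (Functor.associator _ _ _).hom) W₂ :=
    isRightDerivedFunctor_of_inverts W₂ (R' ⋙ G')
      (asIso (whiskerRight β.hom G' ≫ (Functor.associator _ _ _).hom)).symm
  let adj' := adj.derived W₁ W₂ α β.hom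
  have unit_fac (X : C₁) : adj'.unit.app (L₁.obj X) ≫ R'.map (α.app X) =
      L₁.map (adj.unit.app X) ≫ β.hom.app (G.obj X) :=
    adj.derivedη_fac_app W₁ α β.hom X
  have counit_fac (Y : C₂) : G'.map (β.hom.app Y) ≫ adj'.counit.app (L₂.obj Y) =
      α.app (R.obj Y) ≫ L₂.map (adj.counit.app Y) :=
    adj.derivedε_fac_app W₂ α β.hom Y
  have iso_unit (X : C₁) (hX : S X) : IsIso (adj'.unit.app (L₁.obj X)) ↔
      IsIso (L₁.map (adj.unit.app X)) := by
    have := hSα X hX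
    rw [← isIso_comp_right_iff _ (R'.map (α.app X)), unit_fac, isIso_comp_right_iff]
  constructor
  · intro h
    have : R'.IsEquivalence := adj'.isEquivalence_right_of_isEquivalence_left
    refine ⟨fun X hX => (iso_unit X hX).1 inferInstance, fun Y Y' g hg => ?_⟩
    have e := β.hom.naturality g
    dsimp at e
    have : IsIso (R'.map (L₂.map g)) := by
      rw [← isIso_comp_left_iff (β.hom.app Y), ← e]
      infer_instance
    exact isIso_of_reflects_iso _ R'
  · rintro ⟨h₁, h₂⟩
    have hunit (X : D₁) : IsIso (adj'.unit.app X) := by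
      rw [NatTrans.isIso_app_iff_of_iso adj'.unit (L₁.objObjPreimageIso X).symm]
      generalize L₁.objPreimage X = X
      let e : L₁.obj (P.obj X) ≅ L₁.obj X := asIso (L₁.map (p.app X))
      rw [NatTrans.isIso_app_iff_of_iso adj'.unit e.symm]
      exact (iso_unit _ (hS _)).2 (h₁ _ (hS _))
    have hcounit (Y : D₂) : IsIso (adj'.counit.app Y) := by
      rw [NatTrans.isIso_app_iff_of_iso adj'.counit (L₂.objObjPreimageIso Y).symm]
      generalize L₂.objPreimage Y = Y
      -- the counit at `L₂ Y` is represented by the composition `G P R Y ⟶ G R Y ⟶ Y`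
      let g : G.obj (P.obj (R.obj Y)) ⟶ Y := G.map (p.app (R.obj Y)) ≫ adj.counit.app Y
      have := hα (R.obj Y)
      have e : G'.map (L₁.map (p.app (R.obj Y))) ≫ G'.map (β.hom.app Y) ≫
          adj'.counit.app (L₂.obj Y) = α.app (P.obj (R.obj Y)) ≫ L₂.map g := by
        have e₁ := α.naturality (p.app (R.obj Y))
        dsimp at e₁
        rw [counit_fac, reassoc_of% e₁, ← L₂.map_comp]
      have hR : IsIso (R'.map (adj'.counit.app (L₂.obj Y))) := by
        have := adj'.right_triangle_components (L₂.obj Y)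
        exact IsIso.of_isIso_fac_left this
      have hg : IsIso (R'.map (L₂.map g)) := by
        rw [← isIso_comp_left_iff (R'.map (α.app (P.obj (R.obj Y)))), ← R'.map_comp, ← e,
          R'.map_comp, R'.map_comp]
        infer_instance
      have := h₂ g (by
        have e' := β.hom.naturality g
        dsimp at e'
        rw [← isIso_comp_right_iff _ (β.hom.app Y), e']
        infer_instance)
      rw [← isIso_comp_left_iff (G'.map (β.hom.app Y)),
        ← isIso_comp_left_iff (G'.map (L₁.map (p.app (R.obj Y)))), e]
      infer_instance
    have := NatIso.isIso_of_isIso_app adj'.unit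
    have := NatIso.isIso_of_isIso_app adj'.counit
    exact adj'.toEquivalence.isEquivalence_functor

end DerivedAdjunction

namespace DGModule

open CochainComplex.HomComplex

variable {k : Type u} [CommRing k] {A B C : DGAlgebra k}

/-! ### The tensor product as a DG functor -/

section TensorDG

variable {M N P : DGModule A} (T : DGBimodule A B)

/-- Graded maps out of a tensor product are determined by their values on the `m ⊗ t`. -/
lemma tensor_ghom_ext {T : DGBimodule A B} {Y : DGModule B} {n : ℤ} {z w : GHom (tensor M T) Y n}
    (H : ∀ (p q : ℤ) (h : p + n = q) (i j : ℤ) (hij : i + j = p) (x : M.cx.X i) (t : T.cx.X j),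
      z.ap p q h (tmul M T i j p hij x t) = w.ap p q h (tmul M T i j p hij x t)) : z = w := by
  apply GHom.ext
  intro p q h x
  have : z.ap p q h = w.ap p q h := tensor_hom_ext fun i j hij x b => H p q h i j hij x b
  rw [this]

/-- The map `m ⊗ t ↦ z m ⊗ t` in degree `p`. -/
def tensorGX {n : ℤ} (z : GHom M N n) (p q : ℤ) (h : p + n = q) :
    TensorX M T p →ₗ[k] TensorX N T q :=
  tensorDesc (fun i j hij => (tmul N T (i + n) j q (by omega)).comp (z.ap i (i + n) rfl)) (by
    intro i j l r s hr hs h₁ h₂ m a t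
    simp only [LinearMap.comp_apply]
    rw [z.map_act i j r (i + n) (r + n) hr rfl rfl,
      tmul_act N T (i + n) j l (r + n) s q (by omega) hs (by omega) (by omega)])

lemma tensorGX_tmul {n : ℤ} (z : GHom M N n) (p q : ℤ) (h : p + n = q) (i i' j : ℤ)
    (hij : i + j = p) (hi : i + n = i') (x : M.cx.X i) (t : T.cx.X j) :
    tensorGX T z p q h (tmul M T i j p hij x t) =
      tmul N T i' j q (by omega) (z.ap i i' hi x) t := by
  subst hi
  exact tensorDesc_tmul _ _ _ _ _ _ _

lemma tensorGX_act {n : ℤ} (z : GHom M N n) (i j l i' l' : ℤ) (h : i + j = l)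
    (hi : i + n = i') (hl : l + n = l') (x : TensorX M T i) (b : B.cx.X j) :
    tensorGX T z l l' hl (tensorAct M T i j l h x b) =
      tensorAct N T i' j l' (by omega) (tensorGX T z i i' hi x) b := by
  suffices (tensorGX T z l l' hl).comp ((tensorAct M T i j l h).flip b) =
    ((tensorAct N T i' j l' (by omega)).flip b).comp (tensorGX T z i i' hi) from congr($this x)
  apply tensor_hom_ext
  intro p q hpq x c
  simp only [LinearMap.comp_apply, LinearMap.flip_apply]
  rw [tensorAct_tmul M T i j l h p q (q + j) hpq rfl,
    tensorGX_tmul T z l l' hl p (p + n) (q + j) _ rfl,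
    tensorGX_tmul T z i i' hi p (p + n) q _ rfl,
    tensorAct_tmul N T i' j l' _ (p + n) q (q + j) (by omega) rfl]

/-- The graded map `z ⊗ 1 : M ⊗ T ⟶ N ⊗ T` induced by a graded map `z`. -/
def tensorGAux {n : ℤ} (z : GHom M N n) : GHom (tensor M T) (tensor N T) n :=
  ⟨Cochain.mk fun p q h => ModuleCat.ofHom (tensorGX T z p q h), tensorGX_act T z⟩

lemma tensorGAux_apply {n : ℤ} (z : GHom M N n) (p q : ℤ) (h : p + n = q) (i i' j : ℤ)
    (hij : i + j = p) (hi : i + n = i') (x : M.cx.X i) (t : T.cx.X j) :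
    (tensorGAux T z).ap p q h (tmul M T i j p hij x t) =
      tmul N T i' j q (by omega) (z.ap i i' hi x) t :=
  tensorGX_tmul T z p q h i i' j hij hi x t

/-- The map `z ↦ z ⊗ 1` is linear. -/
def tensorG {n : ℤ} : GHom M N n →ₗ[k] GHom (tensor M T) (tensor N T) n where
  toFun := tensorGAux T
  map_add' z w := by
    apply tensor_ghom_ext
    intro p q h i j hij x b
    refine (tensorGAux_apply T (z + w) p q h i _ j hij rfl x b).trans ?_
    refine Eq.trans ?_ (congrArg₂ (· + ·) (tensorGAux_apply T z p q h i _ j hij rfl x b)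
      (tensorGAux_apply T w p q h i _ j hij rfl x b)).symm
    exact congr($(map_add (tmul N T (i + n) j q (by omega)) (z.ap i (i + n) rfl x)
      (w.ap i (i + n) rfl x)) b)
  map_smul' c z := by
    apply tensor_ghom_ext
    intro p q h i j hij x b
    refine (tensorGAux_apply T (c • z) p q h i _ j hij rfl x b).trans ?_
    refine Eq.trans ?_ (congrArg (c • ·) (tensorGAux_apply T z p q h i _ j hij rfl x b)).symm
    exact congr($(map_smul (tmul N T (i + n) j q (by omega)) c (z.ap i (i + n) rfl x)) b)

lemma tensorG_apply {n : ℤ} (z : GHom M N n) (p q : ℤ) (h : p + n = q) (i i' j : ℤ)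
    (hij : i + j = p) (hi : i + n = i') (x : M.cx.X i) (t : T.cx.X j) :
    (tensorG T z).ap p q h (tmul M T i j p hij x t) =
      tmul N T i' j q (by omega) (z.ap i i' hi x) t :=
  tensorGX_tmul T z p q h i i' j hij hi x t

lemma tensorG_id (M : DGModule A) : tensorG T (GHom.id M) = GHom.id (tensor M T) := by
  apply tensor_ghom_ext
  intro p q h i j hij x b
  obtain rfl : p = q := by omega
  rw [tensorG_apply T _ p p h i i j hij (add_zero i), GHom.ofHom_apply, GHom.ofHom_apply]
  rfl

lemma tensorG_comp {a b c : ℤ} (z : GHom M N a) (w : GHom N P b) (h : a + b = c) :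
    tensorG T (z.comp w h) = (tensorG T z).comp (tensorG T w) h := by
  apply tensor_ghom_ext
  intro p q hpq i j hij x y
  rw [tensorG_apply T _ p q hpq i (i + a + b) j hij (by omega),
    GHom.comp_apply _ _ _ p (p + a) q rfl (by omega),
    tensorG_apply T _ p (p + a) rfl i (i + a) j hij rfl,
    tensorG_apply T _ (p + a) q _ (i + a) (i + a + b) j (by omega) rfl,
    GHom.comp_apply z w h i (i + a) (i + a + b) rfl rfl]

lemma tensorG_δ {a b : ℤ} (h : a + 1 = b) (z : GHom M N a) :
    tensorG T (GHom.δ a b z) = GHom.δ a b (tensorG T z) := by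
  apply tensor_ghom_ext
  intro p q hpq i j hij x y
  have e : b.negOnePow * i.negOnePow = - (i + a).negOnePow := by
    rw [← h, ← Int.negOnePow_add, ← Int.negOnePow_succ]
    congr 1
    ring
  rw [tensorG_apply T _ p q hpq i (i + b) j hij rfl,
    GHom.δ_apply h _ p q (p + 1) (p + a) hpq rfl (by omega),
    tensorG_apply T _ p (p + a) rfl i (i + a) j hij rfl,
    tensorCx_d_tmul N T (p + a) q (by omega) (i + a) (i + b) j (j + 1) (by omega) (by omega) rfl,
    tensorCx_d_tmul M T p (p + 1) rfl i (i + 1) j (j + 1) (by omega) rfl rfl, map_add,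
    map_zsmul_unit, tensorG_apply T _ (p + 1) q _ (i + 1) (i + b) j _ (by omega),
    tensorG_apply T _ (p + 1) q _ i (i + a) (j + 1) _ rfl,
    GHom.δ_apply h z i (i + b) (i + 1) (i + a) rfl rfl (by omega), map_add, LinearMap.add_apply,
    map_zsmul_unit, LinearMap.smul_apply, smul_add, smul_smul, e, Units.neg_smul]
  abel

/-- The DG functor `(-) ⊗_A T`. -/
@[reducible]
def tensorFun : DGFun A B where
  obj M := tensor M T
  map := tensorG T
  map_id M := tensorG_id T M
  map_comp z w h := tensorG_comp T z w h
  map_δ h z := tensorG_δ T h z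

lemma tensorFun_functor_map (f : M ⟶ N) : (tensorFun T).functor.map f = tensorMap T f := by
  apply GHom.ofHom_injective
  rw [DGFun.ofHom_functor_map]
  apply tensor_ghom_ext
  intro p q h i j hij x t
  obtain rfl : p = q := by omega
  refine (tensorG_apply T _ p p h i i j hij (add_zero i) x t).trans ?_
  rw [GHom.ofHom_apply, GHom.ofHom_apply]
  exact (tensorMapX_tmul T f p i j hij x t).symm

end TensorDG

/-! ### Left multiplications -/

section LeftMul

variable (T : DGBimodule A B)

/-- Left multiplication by `a` on a DG bimodule, as a graded map of right DG modules. -/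
def lmul (i : ℤ) : A.cx.X i →ₗ[k] GHom T.toDGModule T.toDGModule i where
  toFun a := ⟨Cochain.mk fun p q h => ModuleCat.ofHom (T.lact i p q (by omega) a),
    fun p j q p' q' h hp hq t b => (T.lact_act i p j p' q q' (by omega) h (by omega) (by omega)
      a t b).symm⟩
  map_add' a b := by
    apply GHom.ext
    intro p q h x
    exact congr($(map_add (T.lact i p q (by omega)) a b) x)
  map_smul' c a := by
    apply GHom.ext
    intro p q h x
    exact congr($(map_smul (T.lact i p q (by omega)) c a) x)

lemma lmul_apply (i : ℤ) (a : A.cx.X i) (p q : ℤ) (h : p + i = q) (t : T.cx.X p) :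
    (lmul T i a).ap p q h t = T.lact i p q (by omega) a t := rfl

lemma lmul_one : lmul T 0 A.one = GHom.id T.toDGModule := by
  apply GHom.ext
  intro p q h x
  obtain rfl : p = q := by omega
  rw [lmul_apply, T.one_lact]
  rfl

lemma lmul_mul (i j n : ℤ) (h : i + j = n) (a : A.cx.X i) (b : A.cx.X j) :
    lmul T n (A.mul i j n h a b) = (lmul T j b).comp (lmul T i a) (by omega) := by
  apply GHom.ext
  intro p q hpq x
  rw [lmul_apply, GHom.comp_apply _ _ _ p (p + j) q rfl (by omega), lmul_apply, lmul_apply,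
    T.mul_lact i j p n (p + j) q h (by omega) (by omega) (by omega)]

lemma δ_lmul (i j : ℤ) (h : i + 1 = j) (a : A.cx.X i) :
    GHom.δ i j (lmul T i a) = lmul T j ((A.cx.d i j).hom a) := by
  apply GHom.ext
  intro p q hpq x
  have hs : j.negOnePow = -i.negOnePow := by rw [← h, Int.negOnePow_succ]
  rw [GHom.δ_apply h _ p q (p + 1) (p + i) hpq rfl (by omega), lmul_apply, lmul_apply, lmul_apply,
    T.d_lact i j p (p + 1) (p + i) q h rfl (by omega), hs, Units.neg_smul]
  abel

end LeftMul

/-- The image of a DG bimodule under a DG functor: the left multiplications act by functoriality. -/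
@[reducible]
def DGFun.mapBimodule (Φ : DGFun B C) (T : DGBimodule A B) : DGBimodule A C where
  toDGModule := Φ.obj T.toDGModule
  lact i j n h := LinearMap.mk₂ k (fun a t => (Φ.map (lmul T i a)).ap j n (by omega) t)
    (by intro a b t; rw [map_add, map_add]; rfl) (by intro c a t; rw [map_smul, map_smul]; rfl)
    (by intros; simp) (by intros; simp)
  one_lact i t := by
    rw [LinearMap.mk₂_apply, lmul_one, Φ.map_id]
    rfl
  mul_lact i j l r s n hr hs h₁ h₂ a b t := by
    rw [LinearMap.mk₂_apply, LinearMap.mk₂_apply, LinearMap.mk₂_apply, lmul_mul, Φ.map_comp,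
      GHom.comp_apply _ _ _ l s n (by omega) (by omega)]
  lact_act i j l r s n hr hs h₁ h₂ a t b := by
    rw [LinearMap.mk₂_apply, LinearMap.mk₂_apply]
    exact ((Φ.map (lmul T i a)).map_act j l s r n hs (by omega) (by omega) t b).symm
  d_lact i i' j j' n n' hi hj hn h a t := by
    have e := GHom.δ_apply hi (Φ.map (lmul T i a)) j n' j' n (by omega) hj hn t
    have hs : i'.negOnePow = -i.negOnePow := by rw [← hi, Int.negOnePow_succ]
    rw [← Φ.map_δ hi, δ_lmul T i i' hi, hs, Units.neg_smul] at e
    simp only [LinearMap.mk₂_apply]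
    rw [e]
    abel

end DGModule

namespace DGModule

open CochainComplex.HomComplex

variable {k : Type u} [CommRing k] {A B : DGAlgebra k} (T : DGBimodule A B)

/-! ### The DG modules of graded maps, and the adjunction with the tensor product -/

section HomModule

/-- The complex of graded maps of right DG modules. -/
@[reducible]
def homCx (M Y : DGModule B) : CochainComplex (ModuleCat.{u} k) ℤ where
  X n := ModuleCat.of k (GHom M Y n)
  d i j := ModuleCat.ofHom (GHom.δ i j)
  shape _ _ h := ModuleCat.hom_ext (LinearMap.ext fun z => GHom.δ_shape h z)
  d_comp_d' i j l _ _ := ModuleCat.hom_ext (LinearMap.ext fun z => GHom.δ_δ i j l z)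

/-- The right action of `A` on the graded maps `T ⟶ Y`: `(f a) t = f (a t)`. -/
def homAct (Y : DGModule B) (i j n : ℤ) (h : i + j = n) :
    GHom T.toDGModule Y i →ₗ[k] A.cx.X j →ₗ[k] GHom T.toDGModule Y n :=
  LinearMap.mk₂ k (fun f a => (lmul T j a).comp f (by omega))
    (by intros; exact GHom.comp_add _ _ _ _) (by intros; exact GHom.comp_smul _ _ _ _)
    (by intro f a b; rw [map_add]; exact GHom.add_comp _ _ _ _)
    (by intro c f a; rw [map_smul]; exact GHom.smul_comp _ _ _ _)

lemma homAct_apply (Y : DGModule B) (i j n : ℤ) (h : i + j = n) (f : GHom T.toDGModule Y i)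
    (a : A.cx.X j) : homAct T Y i j n h f a = (lmul T j a).comp f (by omega) := rfl

/-- The right DG `A`-module of graded maps `T ⟶ Y`. -/
@[reducible]
def homModule (Y : DGModule B) : DGModule A where
  cx := homCx T.toDGModule Y
  act := homAct T Y
  act_one i f := by
    rw [homAct_apply, lmul_one]
    exact GHom.id_comp f
  act_mul i j l r s n hr hs h₁ h₂ f a b := by
    rw [homAct_apply, homAct_apply, homAct_apply, lmul_mul,
      GHom.comp_assoc _ _ _ _ _ (by omega)]
  d_act i i' j j' n n' hi hj hn h f a := by
    rw [homAct_apply, homAct_apply, homAct_apply, ← δ_lmul T j j' hj]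
    exact GHom.δ_comp _ _ _ hj hi hn

/-- The map `f ↦ g ∘ f` on graded maps out of `T`. -/
def homMap {Y Y' : DGModule B} (g : Y ⟶ Y') : homModule T Y ⟶ homModule T Y' where
  f :=
    { f := fun n => ModuleCat.ofHom
        { toFun := fun f => GHom.comp (M := T.toDGModule) (a := n) f (GHom.ofHom g) (add_zero n)
          map_add' := fun f f' => GHom.add_comp _ _ _ _
          map_smul' := fun c f => GHom.smul_comp _ _ _ _ }
      comm' := by
        intro n n' hn
        have hn : n + 1 = n' := hn
        refine ModuleCat.hom_ext (LinearMap.ext fun f => ?_)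
        refine (GHom.δ_comp (M := T.toDGModule) _ _ (add_zero n) hn (zero_add 1) hn).trans ?_
        rw [GHom.δ_ofHom, GHom.comp_zero, zero_add, Int.negOnePow_zero, one_smul]
        rfl }
  map_act i j n h f a := GHom.comp_assoc _ _ _ _ (add_zero i) (by omega)

/-- The functor `Y ↦ Hom_B(T, Y)` from right DG `B`-modules to right DG `A`-modules. -/
@[simps]
def homFunctor : DGModule B ⥤ DGModule A where
  obj Y := homModule T Y
  map g := homMap T g
  map_id Y := by
    ext n : 3
    exact LinearMap.ext fun f => GHom.comp_id (M := T.toDGModule) (N := Y) f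
  map_comp g g' := by
    ext n : 3
    refine LinearMap.ext fun f => ?_
    have e : (n + 0 + 0 : ℤ) = n := by omega
    exact (congrArg (fun z => GHom.comp (M := T.toDGModule) (a := n) f z (add_zero n))
      (GHom.ofHom_comp g g')).trans
      (GHom.comp_assoc (M := T.toDGModule) f (GHom.ofHom g) (GHom.ofHom g') (add_zero n)
        (add_zero 0) e).symm

/-- If `T` is K-projective as a right DG module, then `Hom_B(T, -)` preserves
quasi-isomorphisms. -/
lemma quasiIso_homMap (hT : IsKProjective T.toDGModule) {Y Y' : DGModule B} (g : Y ⟶ Y')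
    (hg : quasiIso B g) : quasiIso A (homMap T g) := by
  rw [quasiIso_iff_elements]
  intro i n j hi hj
  refine ⟨fun w hw ⟨v, hv⟩ => hT.exists_δ_eq g hg i n j hi hj w hw v hv, fun z hz => ?_⟩
  obtain ⟨w, hw, v, hv⟩ := hT.exists_lift g hg i n j hi hj z hz
  exact ⟨w, hw, v, hv⟩

/-- The graded map `t ↦ m ⊗ t`. -/
def tensorUnitG (M : DGModule A) (i : ℤ) :
    M.cx.X i →ₗ[k] GHom T.toDGModule (tensor M T) i where
  toFun m := ⟨Cochain.mk fun p q h => ModuleCat.ofHom (tmul M T i p q (by omega) m),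
    fun p j q p' q' h hp hq t b => (tensorAct_tmul M T p' j q' (by omega) i p q (by omega) h
      m t b).symm⟩
  map_add' a b := by
    apply GHom.ext
    intro p q h x
    exact congr($(map_add (tmul M T i p q (by omega)) a b) x)
  map_smul' c a := by
    apply GHom.ext
    intro p q h x
    exact congr($(map_smul (tmul M T i p q (by omega)) c a) x)

lemma tensorUnitG_apply (M : DGModule A) (i : ℤ) (m : M.cx.X i) (p q : ℤ) (h : p + i = q)
    (t : T.cx.X p) : (tensorUnitG T M i m).ap p q h t = tmul M T i p q (by omega) m t := rfl

/-- The unit `M ⟶ Hom_B(T, M ⊗ T)` of the adjunction, `m ↦ (t ↦ m ⊗ t)`. -/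
def tensorUnit (M : DGModule A) : M ⟶ homModule T (tensor M T) where
  f :=
    { f := fun n => ModuleCat.ofHom (tensorUnitG T M n)
      comm' := by
        intro n n' hn
        have hn : n + 1 = n' := hn
        have hs : n'.negOnePow = -n.negOnePow := by rw [← hn, Int.negOnePow_succ]
        refine ModuleCat.hom_ext (LinearMap.ext fun m => ?_)
        apply GHom.ext
        intro p q h t
        refine (GHom.δ_apply hn (tensorUnitG T M n m) p q (p + 1) (p + n) h rfl (by omega) t).trans
          ?_
        rw [tensorUnitG_apply, tensorUnitG_apply, tensorCx_d_tmul M T (p + n) q (by omega) n n' p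
          (p + 1) (by omega) hn rfl, hs, Units.neg_smul, add_assoc, add_neg_cancel, add_zero]
        rfl }
  map_act i j n h m a := by
    apply GHom.ext
    intro p q hpq t
    refine Eq.trans (tmul_act M T i j p n (j + p) q h rfl (by omega) (by omega) m a t) ?_
    refine ((GHom.comp_apply (lmul T j a) (tensorUnitG T M i m) _ p (j + p) q (by omega) (by omega)
      t).trans ?_).symm
    rfl

/-- The evaluation map `f ⊗ t ↦ f t` in degree `n`. -/
def tensorCounitX (Y : DGModule B) (n : ℤ) :
    TensorX (homModule T Y) T n →ₗ[k] Y.cx.X n :=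
  tensorDesc (fun i j h => LinearMap.mk₂ k
      (fun (f : GHom T.toDGModule Y i) t => f.ap j n (by omega) t)
      (by intros; rfl) (by intros; rfl) (by intros; simp) (by intros; simp)) (by
    intro i j l r s hr hs h₁ h₂ f a t
    have h : j + i = r := by omega
    have e : l + j = s := by omega
    have e' : s + i = n := by omega
    exact GHom.comp_apply (M := T.toDGModule) (lmul T j a) f h l s n e e' t)

lemma tensorCounitX_tmul (Y : DGModule B) (n i j : ℤ) (h : i + j = n)
    (f : GHom T.toDGModule Y i) (t : T.cx.X j) :
    tensorCounitX T Y n (tmul (homModule T Y) T i j n h f t) = f.ap j n (by omega) t :=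
  tensorDesc_tmul _ _ _ _ _ _ _

/-- The counit `Hom_B(T, Y) ⊗ T ⟶ Y` of the adjunction, `f ⊗ t ↦ f t`. -/
def tensorCounit (Y : DGModule B) : tensor (homModule T Y) T ⟶ Y where
  f :=
    { f := fun n => ModuleCat.ofHom (tensorCounitX T Y n)
      comm' := by
        intro n n' hn
        have hn : n + 1 = n' := hn
        ext1
        apply tensor_hom_ext
        intro i j h f t
        simp only [ModuleCat.hom_comp, ModuleCat.hom_ofHom, LinearMap.comp_apply]
        have hs : (i + 1).negOnePow = -i.negOnePow := Int.negOnePow_succ i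
        have e := GHom.δ_apply rfl f j n' (j + 1) n (by omega) rfl hn t
        rw [tensorCx_d_tmul (homModule T Y) T n n' hn i (i + 1) j (j + 1) h rfl rfl, map_add,
          map_zsmul_unit, tensorCounitX_tmul, tensorCounitX_tmul]
        have e₂ := tensorCounitX_tmul T Y n' i (j + 1) (by omega) f ((T.cx.d j (j + 1)).hom t)
        refine Eq.trans ?_ (congrArg₂ (· + ·) e (congrArg (i.negOnePow • ·) e₂)).symm
        rw [hs, Units.neg_smul]
        exact (neg_add_cancel_right _ _).symm }
  map_act i j n h x b := by
    suffices (tensorCounitX T Y n).comp ((tensorAct (homModule T Y) T i j n h).flip b) =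
        ((Y.act i j n h).flip b).comp (tensorCounitX T Y i) from congr($this x)
    apply tensor_hom_ext
    intro p q hpq f t
    simp only [LinearMap.comp_apply, LinearMap.flip_apply]
    rw [tensorAct_tmul (homModule T Y) T i j n h p q (q + j) hpq rfl, tensorCounitX_tmul,
      tensorCounitX_tmul]
    exact GHom.map_act f q j (q + j) i n rfl (by omega) (by omega) t b

/-- The adjunction between the tensor product with `T` and the graded maps out of `T`. -/
@[reducible]
def tensorAdjunction : tensorFunctor T ⊣ homFunctor T where
  unit :=
    { app := fun M => tensorUnit T M
      naturality := by
        intro M N f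
        ext n : 3
        refine LinearMap.ext fun m => ?_
        apply GHom.ext
        intro p q h t
        refine Eq.symm (Eq.trans (GHom.comp_apply (tensorUnitG T M n m)
          (GHom.ofHom (tensorMap T f)) (add_zero n) p q q h (add_zero q) t) ?_)
        rw [GHom.ofHom_apply]
        exact tensorMapX_tmul T f q n p (by omega) m t }
  counit :=
    { app := fun Y => tensorCounit T Y
      naturality := by
        intro Y Y' g
        ext n : 3
        apply tensor_hom_ext
        intro i j h f t
        have e₁ := tensorMapX_tmul T (homMap T g) n i j h f t
        have e₂ := tensorCounitX_tmul T Y n i j h f t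
        have e₃ := tensorCounitX_tmul T Y' n i j h (((homMap T g).f.f i).hom f) t
        refine (congrArg (tensorCounitX T Y' n) e₁).trans (e₃.trans ?_)
        refine Eq.trans ?_ (congrArg (g.f.f n).hom e₂).symm
        have h' : j + i = n := by omega
        refine (GHom.comp_apply (M := T.toDGModule) f (GHom.ofHom g) (add_zero i) j n n h'
          (add_zero n) t).trans ?_
        rw [GHom.ofHom_apply] }
  left_triangle_components M := by
    ext n : 3
    apply tensor_hom_ext
    intro i j h m t
    refine (congrArg (tensorCounitX T (tensor M T) n)
      (tensorMapX_tmul T (tensorUnit T M) n i j h m t)).trans ?_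
    exact tensorCounitX_tmul T (tensor M T) n i j h (tensorUnitG T M i m) t
  right_triangle_components Y := by
    ext n : 3
    refine LinearMap.ext fun f => ?_
    apply GHom.ext
    intro p q h t
    refine (GHom.comp_apply (M := T.toDGModule) (tensorUnitG T (homModule T Y) n f)
      (GHom.ofHom (tensorCounit T Y)) (add_zero n) p q q h (add_zero q) t).trans ?_
    rw [GHom.ofHom_apply]
    exact tensorCounitX_tmul T Y q n p (by omega) f t

end HomModule

end DGModule

namespace DGModule

open CochainComplex.HomComplex

variable {k : Type u} [CommRing k] {A B : DGAlgebra k}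

/-! ### Naturality of the contraction of the bar resolution -/

section BarNaturality

variable {X Y : DGModule B} {e : ℤ} (φ : GHom X Y e)

lemma barG_totMk (n : ℕ) (p p' m m' : ℤ) (hp : p + -(n : ℤ) = m) (hm : m + e = m')
    (hpe : p + e = p') (hp' : p' + -(n : ℤ) = m') (x : (barObj X (n + 1)).cx.X p) :
    (barG φ).ap m m' hm (totMk (fun n => barObj X (n + 1)) n p m hp x) =
      barSign n e • totMk (fun n => barObj Y (n + 1)) n p' m' hp'
        ((barMap (n + 1) φ).ap p p' hpe x) := by
  have h : p + (-(n : ℤ) + e) = m' := by omega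
  have e₁ := congr($(barIncl_barG φ n).ap p m' h x)
  rw [GHom.comp_apply _ _ _ p m m' hp hm] at e₁
  refine e₁.trans ?_
  refine (hom_units_smul (((barMap (n + 1) φ).comp (barIncl Y n) (add_comm _ _)).1.v p m' h)
    (barSign n e) x).trans ?_
  congr 1
  exact GHom.comp_apply (barMap (n + 1) φ) (barIncl Y n) _ p p' m' hpe hp' x

/-- The section of the augmentation is natural with respect to graded maps of all degrees. -/
lemma barG_barUnit (p q : ℤ) (h : p + e = q) (x : X.cx.X p) :
    (barG φ).ap p q h (((barUnit X).v p p (add_zero p)).hom x) =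
      ((barUnit Y).v q q (add_zero q)).hom (φ.ap p q h x) := by
  have h₀ (p : ℤ) : p + -((0 : ℕ) : ℤ) = p := by omega
  have e₁ := congr(($(barSec_naturality 0 φ).v p q h).hom x)
  rw [cochain_comp_apply _ _ _ p p q (add_zero p) h,
    cochain_comp_apply _ _ _ p q q h (add_zero q)] at e₁
  have hs : barSign 0 e = 1 := by rw [barSign, Nat.cast_zero, zero_mul, Int.negOnePow_zero]
  rw [barUnit_apply, barUnit_apply, barG_totMk φ 0 p q p q (h₀ p) h h (h₀ q), hs, one_smul]
  exact congrArg _ e₁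

/-- The contracting homotopy is natural up to sign with respect to graded maps of all degrees. -/
lemma barHomotopy_barG (p q p' q' : ℤ) (h : p + e = q) (h' : p' + e = q') (hp : p + -1 = p')
    (hq : q + -1 = q') (x : (bar X).cx.X p) :
    ((barHomotopy Y).v q q' hq).hom ((barG φ).ap p q h x) =
      e.negOnePow • (barG φ).ap p' q' h' (((barHomotopy X).v p p' hp).hom x) := by
  suffices ((barHomotopy Y).v q q' hq).hom.comp ((barG φ).ap p q h) =
      e.negOnePow • ((barG φ).ap p' q' h').comp ((barHomotopy X).v p p' hp).hom from congr($this x)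
  refine tot_hom_ext (Z := fun n => barObj X (n + 1)) fun n m hm x => ?_
  have h₁ : m + e + -(n : ℤ) = q := by omega
  have h₂ : m + -((n + 1 : ℕ) : ℤ) = p' := by push_cast; omega
  have h₃ : m + e + -((n + 1 : ℕ) : ℤ) = q' := by push_cast; omega
  have e₁ := congr(($(barSec_naturality (n + 1) φ).v m (m + e) rfl).hom x)
  rw [cochain_comp_apply _ _ _ m m (m + e) (add_zero m) rfl,
    cochain_comp_apply _ _ _ m (m + e) (m + e) rfl (add_zero (m + e))] at e₁
  simp only [LinearMap.comp_apply, LinearMap.smul_apply]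
  rw [barG_totMk φ n m (m + e) p q hm h rfl h₁, map_zsmul_unit,
    barHomotopy_apply Y n (m + e) q q' hq h₁ h₃, barHomotopy_apply X n m p p' hp hm h₂,
    barG_totMk φ (n + 1) m (m + e) p' q' h₂ h' rfl h₃, smul_smul, barSign_succ, ← mul_assoc,
    ← Int.negOnePow_add, Int.negOnePow_even _ ⟨e, rfl⟩, one_mul]
  exact congrArg (fun y => barSign n e • totMk (fun n => barObj Y (n + 1)) (n + 1) (m + e) q' h₃ y)
    e₁.symm

end BarNaturality

/-! ### Functoriality of the tensor product in the bimodule -/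

section TensorLeft

/-- Morphisms of DG bimodules. -/
structure _root_.DGBimodule.Hom (S T : DGBimodule A B) where
  toHom : S.toDGModule ⟶ T.toDGModule
  map_lact (i j n : ℤ) (h : i + j = n) (a : A.cx.X i) (t : S.cx.X j) :
    (toHom.f.f n).hom (S.lact i j n h a t) = T.lact i j n h a ((toHom.f.f j).hom t)

variable {S T : DGBimodule A B}

/-- A cochain of degree `e` between bimodules is left linear if it commutes with the left
multiplications up to the sign of the Koszul rule. -/
def IsLeftLinear {e : ℤ} (z : Cochain S.cx T.cx e) : Prop :=
  ∀ (i j n j' n' : ℤ) (h : i + j = n) (hj : j + e = j') (hn : n + e = n') (a : A.cx.X i)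
    (t : S.cx.X j), (z.v n n' hn).hom (S.lact i j n h a t) =
      (i * e).negOnePow • T.lact i j' n' (by omega) a ((z.v j j' hj).hom t)

variable (M : DGModule A)

/-- The map `m ⊗ t ↦ (-1) ^ (|m| e) • m ⊗ z t` in degree `p`. -/
def tensorLeftX {e : ℤ} (z : Cochain S.cx T.cx e) (hz : IsLeftLinear z) (p q : ℤ)
    (h : p + e = q) : TensorX M S p →ₗ[k] TensorX M T q :=
  tensorDesc (fun i j hij =>
    (i * e).negOnePow • (tmul M T i (j + e) q (by omega)).compl₂ (z.v j (j + e) rfl).hom) (by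
      intro i j l r s hr hs h₁ h₂ m a t
      simp only [LinearMap.smul_apply, LinearMap.compl₂_apply]
      rw [hz j l s (l + e) (s + e) hs rfl rfl, map_zsmul_unit, smul_smul, ← Int.negOnePow_add,
        ← add_mul, hr, tmul_act M T i j (l + e) r (s + e) q hr (by omega) (by omega) (by omega)])

lemma tensorLeftX_tmul {e : ℤ} (z : Cochain S.cx T.cx e) (hz : IsLeftLinear z) (p q i j j' : ℤ)
    (h : p + e = q) (hij : i + j = p) (hj : j + e = j') (m : M.cx.X i) (t : S.cx.X j) :
    tensorLeftX M z hz p q h (tmul M S i j p hij m t) =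
      (i * e).negOnePow • tmul M T i j' q (by omega) m ((z.v j j' hj).hom t) := by
  subst hj
  exact tensorDesc_tmul _ _ _ _ _ _ _

/-- The map `m ⊗ t ↦ (-1) ^ (|m| e) • m ⊗ z t` for a left linear cochain `z` of degree `e`. -/
def tensorLeft {e : ℤ} (z : Cochain S.cx T.cx e) (hz : IsLeftLinear z) :
    Cochain (tensorCx M S) (tensorCx M T) e :=
  Cochain.mk fun p q h => ModuleCat.ofHom (tensorLeftX M z hz p q h)

lemma tensorLeft_tmul {e : ℤ} (z : Cochain S.cx T.cx e) (hz : IsLeftLinear z) (p q i j j' : ℤ)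
    (h : p + e = q) (hij : i + j = p) (hj : j + e = j') (m : M.cx.X i) (t : S.cx.X j) :
    ((tensorLeft M z hz).v p q h).hom (tmul M S i j p hij m t) =
      (i * e).negOnePow • tmul M T i j' q (by omega) m ((z.v j j' hj).hom t) :=
  tensorLeftX_tmul M z hz p q i j j' h hij hj m t

/-- Cochains out of a tensor product are determined by their values on the `m ⊗ t`. -/
lemma tensor_cochain_ext {K : CochainComplex (ModuleCat.{u} k) ℤ} {n : ℤ}
    {z w : Cochain (tensorCx M S) K n}
    (H : ∀ (p q : ℤ) (h : p + n = q) (i j : ℤ) (hij : i + j = p) (x : M.cx.X i) (t : S.cx.X j),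
      (z.v p q h).hom (tmul M S i j p hij x t) = (w.v p q h).hom (tmul M S i j p hij x t)) :
    z = w := by
  apply cochain_ext
  intro p q h x
  have : (z.v p q h).hom = (w.v p q h).hom :=
    tensor_hom_ext fun i j hij x b => H p q h i j hij x b
  rw [this]

lemma δ_tensorLeft {e e' : ℤ} (he : e + 1 = e') (z : Cochain S.cx T.cx e) (hz : IsLeftLinear z)
    (p q i j j' : ℤ) (h : p + e' = q) (hij : i + j = p) (hj : j + e' = j') (m : M.cx.X i)
    (t : S.cx.X j) :
    ((δ e e' (tensorLeft M z hz)).v p q h).hom (tmul M S i j p hij m t) =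
      (i * e').negOnePow • tmul M T i j' q (by omega) m (((δ e e' z).v j j' hj).hom t) := by
  have e₁ : (i * e).negOnePow * i.negOnePow = (i * e').negOnePow := by
    rw [← he, ← Int.negOnePow_add, mul_add, mul_one]
  have e₂ : e'.negOnePow * ((i + 1) * e).negOnePow = -(i * e).negOnePow := by
    rw [← he, Int.negOnePow_succ, neg_mul, add_mul, one_mul, Int.negOnePow_add, mul_left_comm,
      ← Int.negOnePow_add, Int.negOnePow_even _ ⟨e, rfl⟩, mul_one]
  have e₃ : e'.negOnePow * i.negOnePow * (i * e).negOnePow =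
      (i * e').negOnePow * e'.negOnePow := by
    rw [mul_assoc, mul_comm i.negOnePow, e₁, mul_comm]
  rw [cochain_δ_apply he _ p q (p + 1) (p + e) h rfl (by omega),
    cochain_δ_apply he z j j' (j + 1) (j + e) hj rfl (by omega),
    tensorLeft_tmul M z hz p (p + e) i j (j + e) rfl hij rfl, map_zsmul_unit,
    tensorCx_d_tmul M T (p + e) q (by omega) i (i + 1) (j + e) j' (by omega) rfl (by omega),
    tensorCx_d_tmul M S p (p + 1) rfl i (i + 1) j (j + 1) hij rfl rfl, map_add, map_zsmul_unit,
    tensorLeft_tmul M z hz (p + 1) q (i + 1) j (j + e) (by omega) (by omega) rfl,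
    tensorLeft_tmul M z hz (p + 1) q i (j + 1) j' (by omega) (by omega) (by omega), map_add,
    map_zsmul_unit, smul_add, smul_add, smul_add, smul_smul, smul_smul, smul_smul, smul_smul,
    smul_smul, e₁, e₂, e₃, Units.neg_smul]
  abel

/-- The map `1 ⊗ π` in degree `n`. -/
def tensorRightX (π : S.Hom T) (n : ℤ) : TensorX M S n →ₗ[k] TensorX M T n :=
  tensorDesc (fun i j h => (tmul M T i j n h).compl₂ (π.toHom.f.f j).hom) (by
    intro i j l r s hr hs h₁ h₂ m a t
    simp only [LinearMap.compl₂_apply]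
    rw [π.map_lact, tmul_act M T i j l r s n hr hs h₁ h₂])

lemma tensorRightX_tmul (π : S.Hom T) (n i j : ℤ) (h : i + j = n) (m : M.cx.X i) (t : S.cx.X j) :
    tensorRightX M π n (tmul M S i j n h m t) = tmul M T i j n h m ((π.toHom.f.f j).hom t) :=
  tensorDesc_tmul _ _ _ _ _ _ _

/-- The morphism `1 ⊗ π : M ⊗ S ⟶ M ⊗ T`. -/
def tensorRight (π : S.Hom T) : tensor M S ⟶ tensor M T where
  f :=
    { f := fun n => ModuleCat.ofHom (tensorRightX M π n)
      comm' := by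
        intro n n' hn
        have hn : n + 1 = n' := hn
        ext1
        apply tensor_hom_ext
        intro i j h m t
        have e := congr($(π.toHom.f.comm j (j + 1)).hom t)
        simp only [ModuleCat.hom_comp, LinearMap.comp_apply] at e
        simp only [ModuleCat.hom_comp, ModuleCat.hom_ofHom, LinearMap.comp_apply]
        rw [tensorRightX_tmul, tensorCx_d_tmul M T n n' hn i (i + 1) j (j + 1) h rfl rfl,
          tensorCx_d_tmul M S n n' hn i (i + 1) j (j + 1) h rfl rfl, map_add,
          map_zsmul_unit, tensorRightX_tmul, tensorRightX_tmul, e] }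
  map_act i j n h x b := by
    suffices (tensorRightX M π n).comp ((tensorAct M S i j n h).flip b) =
        ((tensorAct M T i j n h).flip b).comp (tensorRightX M π i) from congr($this x)
    apply tensor_hom_ext
    intro p q hpq m t
    simp only [LinearMap.comp_apply, LinearMap.flip_apply]
    rw [tensorAct_tmul M S i j n _ p q (q + j) hpq rfl, tensorRightX_tmul, tensorRightX_tmul,
      tensorAct_tmul M T i j n _ p q (q + j) hpq rfl, π.toHom.map_act q j (q + j) rfl t b]

lemma tensorRight_tmul (π : S.Hom T) (n i j : ℤ) (h : i + j = n) (m : M.cx.X i) (t : S.cx.X j) :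
    ((tensorRight M π).f.f n).hom (tmul M S i j n h m t) =
      tmul M T i j n h m ((π.toHom.f.f j).hom t) :=
  tensorRightX_tmul M π n i j h m t

/-- The natural transformation `- ⊗ S ⟶ - ⊗ T` induced by a morphism of bimodules. -/
def tensorTrans (π : S.Hom T) : tensorFunctor S ⟶ tensorFunctor T where
  app M := tensorRight M π
  naturality M N f := by
    ext n : 3
    apply tensor_hom_ext
    intro i j h m t
    refine (congrArg ((tensorRight N π).f.f n).hom (tensorMapX_tmul S f n i j h m t)).trans ?_
    refine (tensorRight_tmul N π n i j h _ t).trans ?_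
    refine Eq.trans ?_ (congrArg (tensorMapX T f n) (tensorRight_tmul M π n i j h m t)).symm
    exact (tensorMapX_tmul T f n i j h m _).symm

/-- If a morphism of bimodules has a left linear homotopy inverse, it induces a quasi-isomorphism
of tensor products. -/
lemma quasiIso_tensorRight (π : S.Hom T) (g : Cochain T.cx S.cx 0) (hgl : IsLeftLinear g)
    (hg : δ 0 1 g = 0) (h : Cochain S.cx S.cx (-1)) (hl : IsLeftLinear h)
    (hh : δ (-1) 0 h = Cochain.ofHom (𝟙 S.cx) - (Cochain.ofHom π.toHom.f).comp g (add_zero 0))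
    (hh' : g.comp (Cochain.ofHom π.toHom.f) (add_zero 0) = Cochain.ofHom (𝟙 T.cx)) :
    quasiIso B (tensorRight M π) := by
  refine quasiIso_of_homotopy (tensorRight M π) (tensorLeft M g hgl) ?_ (tensorLeft M h hl) 0 ?_ ?_
  · apply tensor_cochain_ext
    intro p q hpq i j hij x t
    rw [δ_tensorLeft M (zero_add 1) g hgl p q i j (j + 1) hpq hij rfl, hg]
    simp
  · apply tensor_cochain_ext
    intro p q hpq i j hij x t
    obtain rfl : p = q := by omega
    rw [δ_tensorLeft M (by omega) h hl p p i j j hpq hij (add_zero j), hh, Cochain.sub_v,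
      Cochain.sub_v, ModuleCat.hom_sub, ModuleCat.hom_sub, LinearMap.sub_apply,
      LinearMap.sub_apply, cochain_comp_apply _ _ _ j j j (add_zero j) (add_zero j),
      cochain_comp_apply _ _ _ p p p hpq hpq, Cochain.ofHom_v, Cochain.ofHom_v, Cochain.ofHom_v,
      Cochain.ofHom_v, tensorRight_tmul, tensorLeft_tmul M g hgl p p i j j hpq hij (add_zero j),
      mul_zero, Int.negOnePow_zero, one_smul, one_smul, map_sub]
    rfl
  · rw [δ_zero]
    symm
    rw [sub_eq_zero]
    apply tensor_cochain_ext
    intro p q hpq i j hij x t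
    obtain rfl : p = q := by omega
    have e := congr(($(hh').v j j (add_zero j)).hom t)
    rw [cochain_comp_apply _ _ _ j j j (add_zero j) (add_zero j), Cochain.ofHom_v,
      Cochain.ofHom_v] at e
    rw [cochain_comp_apply _ _ _ p p p hpq hpq, Cochain.ofHom_v, Cochain.ofHom_v,
      tensorLeft_tmul M g hgl p p i j j hpq hij (add_zero j), mul_zero, Int.negOnePow_zero,
      one_smul, tensorRight_tmul, e]
    rfl

end TensorLeft

/-! ### The bar resolution of a bimodule -/

section BarBimodule

variable (T : DGBimodule A B)

/-- The bar resolution of a bimodule with respect to the right action, as a bimodule. -/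
abbrev barBimodule : DGBimodule A B := (barFun B).mapBimodule T

/-- The augmentation of the bar resolution of a bimodule. -/
def barBimoduleAug : (barBimodule T).Hom T where
  toHom := barAug T.toDGModule
  map_lact i j n h a t := by
    have h' : j + i = n := by omega
    have e := congr($(barG_barAug (lmul T i a)).ap j n h' t)
    rw [GHom.comp_apply _ _ _ j n n h' (add_zero n), GHom.comp_apply _ _ _ j j n (add_zero j) h',
      GHom.ofHom_apply, GHom.ofHom_apply] at e
    exact e

lemma isLeftLinear_barUnit :
    IsLeftLinear (S := T) (T := barBimodule T) (barUnit T.toDGModule) := by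
  intro i j n j' n' h hj hn a t
  obtain rfl : j = j' := by omega
  obtain rfl : n = n' := by omega
  rw [mul_zero, Int.negOnePow_zero, one_smul]
  exact (barG_barUnit (lmul T i a) j n (by omega) t).symm

lemma isLeftLinear_barHomotopy :
    IsLeftLinear (S := barBimodule T) (T := barBimodule T) (barHomotopy T.toDGModule) := by
  intro i j n j' n' h hj hn a t
  rw [mul_neg, mul_one, Int.negOnePow_neg]
  exact barHomotopy_barG (lmul T i a) j n j' n' (by omega) (by omega) hj hn t

lemma quasiIso_tensorRight_barBimoduleAug (M : DGModule A) :
    quasiIso B (tensorRight M (barBimoduleAug T)) :=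
  quasiIso_tensorRight M (barBimoduleAug T) (barUnit T.toDGModule) (isLeftLinear_barUnit T)
    (δ_barUnit _) (barHomotopy T.toDGModule) (isLeftLinear_barHomotopy T) (δ_barHomotopy _)
    (barUnit_barAug _)

end BarBimodule

end DGModule

namespace DGModule

/-! ### Invertible morphisms of the derived category -/

section Saturation

variable {k : Type u} [CommRing k] {A B : DGAlgebra k}

lemma quasiIso_of_comp_right {M N P : DGModule A} (f : M ⟶ N) (g : N ⟶ P) (hg : quasiIso A g)
    (hfg : quasiIso A (f ≫ g)) : quasiIso A f := by
  have : QuasiIso g.f := hg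
  have : QuasiIso (f.f ≫ g.f) := hfg
  exact _root_.quasiIso_of_comp_right f.f g.f

lemma quasiIso_comp {M N P : DGModule A} (f : M ⟶ N) (g : N ⟶ P) (hf : quasiIso A f)
    (hg : quasiIso A g) : quasiIso A (f ≫ g) := by
  have : QuasiIso g.f := hg
  have : QuasiIso f.f := hf
  exact inferInstanceAs (QuasiIso (f.f ≫ g.f))

/-- A morphism of DG modules is a quasi-isomorphism if and only if it becomes invertible in the
derived category. -/
lemma isIso_Q_map_iff {M N : DGModule A} (f : M ⟶ N) :
    IsIso ((DGDerived.Q A).map f) ↔ quasiIso A f := by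
  refine ⟨fun h => ?_, fun h => Localization.inverts (DGDerived.Q A) (quasiIso A) f h⟩
  change QuasiIso f.f
  rw [_root_.quasiIso_iff]
  intro n
  rw [quasiIsoAt_iff_isIso_homologyMap]
  let H : DGModule A ⥤ ModuleCat.{u} k :=
    forget A ⋙ HomologicalComplex.homologyFunctor (ModuleCat.{u} k) (ComplexShape.up ℤ) n
  have hH : (quasiIso A).IsInvertedBy H := fun M N g hg => by
    have : QuasiIso g.f := hg
    exact inferInstanceAs (IsIso (HomologicalComplex.homologyMap g.f n))
  exact (NatIso.isIso_map_iff (Localization.fac H hH (DGDerived.Q A)) f).1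
    (inferInstanceAs (IsIso ((Localization.lift H hH (DGDerived.Q A)).map
      ((DGDerived.Q A).map f))))

end Saturation

/-! ### A criterion for DG Morita equivalences -/

section Criterion

variable {k : Type u} [Field k] {A B : DGAlgebra k}

lemma isHomotopyEquiv_barFun_map {M N : DGModule A} (f : M ⟶ N) (hf : quasiIso A f) :
    IsHomotopyEquiv ((barFun A).functor.map f) := by
  refine (isKProjective_bar M).isHomotopyEquiv (isKProjective_bar N) _
    (quasiIso_of_comp_right _ (barAug N) (quasiIso_barAug N) ?_)
  rw [barFun_map_barAug]
  exact quasiIso_comp _ _ (quasiIso_barAug M) hf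

variable (S : DGBimodule A B)

/-- The DG functor `M ↦ bar M ⊗ S`. -/
abbrev barTensorFun : DGFun A B := (barFun A).comp (tensorFun S)

lemma barTensorFun_map {M N : DGModule A} (f : M ⟶ N) :
    (barTensorFun S).functor.map f = tensorMap S ((barFun A).functor.map f) := by
  rw [← tensorFun_functor_map]
  apply GHom.ofHom_injective
  refine ((barTensorFun S).ofHom_functor_map f).trans (Eq.symm ?_)
  refine ((tensorFun S).ofHom_functor_map ((barFun A).functor.map f)).trans ?_
  rw [DGFun.ofHom_functor_map]
  rfl

lemma isInvertedBy_barTensorFun :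
    (quasiIso A).IsInvertedBy ((barTensorFun S).functor ⋙ DGDerived.Q B) := fun M N f hf => by
  refine (isIso_Q_map_iff _).2 ?_
  rw [barTensorFun_map, ← tensorFun_functor_map]
  exact ((tensorFun S).isHomotopyEquiv_map (isHomotopyEquiv_barFun_map f hf)).quasiIso

/-- The derived tensor product with `S`, computed by bar resolutions. -/
def derivedTensor : DGDerived A ⥤ DGDerived B :=
  Localization.lift _ (isInvertedBy_barTensorFun S) (DGDerived.Q A)

/-- The isomorphism which computes the derived tensor product by bar resolutions. -/
def derivedTensorIso :
    DGDerived.Q A ⋙ derivedTensor S ≅ (barTensorFun S).functor ⋙ DGDerived.Q B :=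
  Localization.fac _ (isInvertedBy_barTensorFun S) (DGDerived.Q A)

lemma isTriangulated_derivedTensor : DGDerived.IsTriangulated (derivedTensor S) :=
  DGDerived.isTriangulated_of_dgFun _ _ (derivedTensorIso S)

/-- The augmentation of the bar resolutions as a natural transformation. -/
def barTrans (A : DGAlgebra k) : (barFun A).functor ⟶ 𝟭 (DGModule A) where
  app M := barAug M
  naturality _ _ f := barFun_map_barAug f

/-- The comparison `bar M ⊗ S ⟶ M ⊗ S`. -/
def barTensorTrans : (barTensorFun S).functor ⟶ tensorFunctor S where
  app M := tensorMap S (barAug M)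
  naturality M N f := by
    rw [barTensorFun_map]
    exact ((tensorFunctor S).map_comp _ _).symm.trans
      ((congrArg (tensorFunctor S).map (barFun_map_barAug f)).trans
        ((tensorFunctor S).map_comp _ _))

/-- The comparison of the derived tensor product with the tensor product. -/
def derivedTensorCounit :
    DGDerived.Q A ⋙ derivedTensor S ⟶ tensorFunctor S ⋙ DGDerived.Q B :=
  (derivedTensorIso S).hom ≫ Functor.whiskerRight (barTensorTrans S) (DGDerived.Q B)

lemma isIso_derivedTensorCounit_app (X : DGModule A) (hX : IsKProjective X) :
    IsIso ((derivedTensorCounit S).app X) := by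
  have h : quasiIso B (tensorMap S (barAug X)) := by
    rw [← tensorFun_functor_map]
    exact (isKProjective_bar X).quasiIso_map hX (tensorFun S) _ (quasiIso_barAug X)
  have h₁ : IsIso ((DGDerived.Q B).map (tensorMap S (barAug X))) := (isIso_Q_map_iff _).2 h
  have h₂ : IsIso ((derivedTensorIso S).hom.app X) := inferInstance
  exact IsIso.comp_isIso' h₂ h₁

variable {S} {T : DGBimodule A B} (π : S.Hom T)

/-- Let `S ⟶ T` be a resolution of a bimodule such that `S` is K-projective over `B`. Then `T` gives
a DG Morita equivalence if and only if the unit `W ⟶ Hom_B(S, W ⊗ S)` is a quasi-isomorphism for all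
K-projective `W` and `Hom_B(S, -)` reflects quasi-isomorphisms. -/
theorem givesDGMoritaEquivalence_iff (hS : IsKProjective S.toDGModule)
    (hπ : ∀ M, quasiIso B (tensorRight M π)) :
    T.GivesDGMoritaEquivalence ↔
      (∀ W : DGModule A, IsKProjective W → quasiIso A (tensorUnit S W)) ∧
        ∀ ⦃Y Y' : DGModule B⦄ (g : Y ⟶ Y'), quasiIso A (homMap S g) → quasiIso B g := by
  have hR : (quasiIso B).IsInvertedBy (homFunctor S ⋙ DGDerived.Q A) := fun Y Y' g hg =>
    (isIso_Q_map_iff _).2 (quasiIso_homMap S hS g hg)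
  have : (DGDerived.Q A).EssSurj := Localization.essSurj _ (quasiIso A)
  have : (DGDerived.Q B).EssSurj := Localization.essSurj _ (quasiIso B)
  let α : DGDerived.Q A ⋙ derivedTensor S ⟶ tensorFunctor T ⋙ DGDerived.Q B :=
    derivedTensorCounit S ≫ Functor.whiskerRight (tensorTrans π) (DGDerived.Q B)
  have hα (X : DGModule A) : IsIso (α.app (bar X)) :=
    IsIso.comp_isIso' (isIso_derivedTensorCounit_app S _ (isKProjective_bar X))
      ((isIso_Q_map_iff _).2 (hπ (bar X)))
  have : (derivedTensor S).IsLeftDerivedFunctor α (quasiIso A) :=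
    isLeftDerivedFunctor_of_resolution (DGDerived.Q A) (quasiIso A) α
      (barTrans A) quasiIso_barAug hα
  have key : (derivedTensor S).IsEquivalence ↔ _ :=
    isEquivalence_leftDerived_iff (tensorAdjunction S) (DGDerived.Q A)
      (DGDerived.Q B) (quasiIso A) (quasiIso B) (derivedTensorCounit S)
      (Localization.fac (homFunctor S ⋙ DGDerived.Q A) hR (DGDerived.Q B)).symm (barTrans A)
      quasiIso_barAug (fun X => isIso_derivedTensorCounit_app S _ (isKProjective_bar X))
      IsKProjective isKProjective_bar (isIso_derivedTensorCounit_app S)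
  refine Iff.trans ⟨?_, fun h => ?_⟩ (key.trans (and_congr
    (forall₂_congr fun W _ => isIso_Q_map_iff (tensorUnit S W))
    (forall₃_congr fun Y Y' g => imp_congr (isIso_Q_map_iff (homMap S g)) (isIso_Q_map_iff g))))
  · rintro ⟨F, β, _, _, _⟩
    exact Functor.isEquivalence_of_iso (Functor.leftDerivedUnique _ _ β α (quasiIso A))
  · exact ⟨derivedTensor S, α, inferInstance, h, isTriangulated_derivedTensor S⟩

end Criterion

end DGModule

/-! ### Restriction and extension of scalars for linear maps -/

section Linear

variable {k k' : Type u} [CommRing k] [CommRing k'] [Algebra k k']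
  {V U U' : Type u} [AddCommGroup V] [Module k V] [AddCommGroup U] [Module k' U]
  [AddCommGroup U'] [Module k' U']

/-- The `k'`-module `U` considered as a `k`-module. The type synonym `RestrictScalars` carries the
same module structure, for an additive structure which is only assumed to be a monoid. -/
def Res (_k _k' U : Type u) : Type u := U

instance : AddCommGroup (Res k k' U) := inferInstanceAs (AddCommGroup U)

instance : Module k (Res k k' U) := Module.compHom U (algebraMap k k')

variable (k) in
/-- A `k'`-linear map, considered as a `k`-linear map. -/
def LinearMap.res (f : U →ₗ[k'] U') : Res k k' U →ₗ[k] Res k k' U' where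
  toFun x := f x
  map_add' x y := f.map_add x y
  map_smul' c x := f.map_smul (algebraMap k k' c) x

/-- The `k`-linear map `x ↦ f (1 ⊗ x)`. -/
def LinearMap.restrictTensor (f : k' ⊗[k] V →ₗ[k'] U) : V →ₗ[k] Res k k' U where
  toFun x := f (1 ⊗ₜ x)
  map_add' x y := (congrArg f (TensorProduct.tmul_add 1 x y)).trans (f.map_add _ _)
  map_smul' c x := by
    have e : (1 : k') ⊗ₜ[k] (c • x) = algebraMap k k' c • (1 : k') ⊗ₜ[k] x := by
      rw [TensorProduct.tmul_smul, algebraMap_smul]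
    exact (congrArg f e).trans (f.map_smul _ _)

/-- The `k'`-linear map `c ⊗ x ↦ c f x`. -/
def LinearMap.extendTensor (f : V →ₗ[k] Res k k' U) : k' ⊗[k] V →ₗ[k'] U :=
  letI : Module k U := Module.compHom U (algebraMap k k')
  haveI : IsScalarTower k k' U := IsScalarTower.of_compHom k k' U
  LinearMap.liftBaseChange k' (show V →ₗ[k] U from f)

lemma LinearMap.extendTensor_tmul (f : V →ₗ[k] Res k k' U) (c : k') (x : V) :
    f.extendTensor (c ⊗ₜ x) = c • (show U from f x) := by
  let : Module k U := Module.compHom U (algebraMap k k')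
  have : IsScalarTower k k' U := IsScalarTower.of_compHom k k' U
  exact LinearMap.liftBaseChange_tmul k' (show V →ₗ[k] U from f) c x

end Linear

namespace DGModule

open CochainComplex.HomComplex

section Restriction

variable {k k' : Type u} [CommRing k] [CommRing k'] [Algebra k k'] {A B : DGAlgebra k}

variable (k) in
/-- Restriction of scalars for complexes. -/
@[simps, reducible]
def resCx (K : CochainComplex (ModuleCat.{u} k') ℤ) :
    CochainComplex (ModuleCat.{u} k) ℤ where
  X n := ModuleCat.of k (Res k k' (K.X n))
  d i j := ModuleCat.ofHom ((K.d i j).hom.res k)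
  shape i j h := ModuleCat.hom_ext (LinearMap.ext fun x => congr(($(K.shape i j h)).hom x))
  d_comp_d' i j l _ _ :=
    ModuleCat.hom_ext (LinearMap.ext fun x => congr(($(K.d_comp_d i j l)).hom x))

/-- Restriction of scalars along `A ⟶ k' ⊗ A` for right DG modules. -/
@[reducible]
def res (M : DGModule (A.baseChange k')) : DGModule A where
  cx := resCx k M.cx
  act i j n h := LinearMap.mk₂ k
    (fun (m : Res k k' (M.cx.X i)) a => (M.act i j n h m).restrictTensor a)
    (fun m m' a => (M.act i j n h).map_add₂ m m' _)
    (fun c m a => (M.act i j n h).map_smul₂ (algebraMap k k' c) m _)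
    (fun m a a' => (M.act i j n h m).restrictTensor.map_add a a')
    (fun c m a => (M.act i j n h m).restrictTensor.map_smul c a)
  act_one i m := M.act_one i m
  act_mul i j l r s n hr hs h₁ h₂ m a b := by
    refine (M.act_mul i j l r s n hr hs h₁ h₂ m (1 ⊗ₜ a) (1 ⊗ₜ b)).trans ?_
    refine congrArg (M.act i s n h₂ m) ?_
    refine (baseChangeBilin_tmul k' (A.mul j l s hs) 1 1 a b).trans ?_
    rw [one_mul]
  d_act i i' j j' n n' hi hj hn h m a := by
    refine (M.d_act i i' j j' n n' hi hj hn h m (1 ⊗ₜ a)).trans ?_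
    have e : ((A.baseChange k').cx.d j j').hom ((1 : k') ⊗ₜ[k] a) = 1 ⊗ₜ (A.cx.d j j').hom a :=
      LinearMap.baseChange_tmul _ _ _
    rw [e]
    rfl

lemma act_tmul (M : DGModule (A.baseChange k')) (i j n : ℤ) (h : i + j = n)
    (m : M.cx.X i) (c : k') (a : A.cx.X j) :
    M.act i j n h m (c ⊗ₜ a) = c • M.act i j n h m (1 ⊗ₜ a) := by
  rw [← map_smul, TensorProduct.smul_tmul', smul_eq_mul, mul_one]

lemma IsAcyclic.res {M : DGModule (A.baseChange k')} (hM : IsAcyclic M) :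
    IsAcyclic (DGModule.res M) := fun i n j hi hj x hx => hM i n j hi hj x hx

/-- Restriction of scalars for morphisms of right DG modules. -/
def resHom {M N : DGModule (A.baseChange k')} (f : M ⟶ N) : res M ⟶ res N where
  f :=
    { f := fun n => ModuleCat.ofHom ((f.f.f n).hom.res k)
      comm' := fun i j _ =>
        ModuleCat.hom_ext (LinearMap.ext fun x => congr(($(f.f.comm i j)).hom x)) }
  map_act i j n h m a := f.map_act i j n h m (1 ⊗ₜ a)

end Restriction

/-! ### Comparison of quasi-isomorphisms over different rings -/

lemma quasiIso_of_addEquiv {k k' : Type u} [CommRing k] [CommRing k'] {A : DGAlgebra k}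
    {A' : DGAlgebra k'} {M N : DGModule A} {M' N' : DGModule A'} (f : M ⟶ N) (f' : M' ⟶ N')
    (φ : ∀ n, M.cx.X n ≃+ M'.cx.X n) (ψ : ∀ n, N.cx.X n ≃+ N'.cx.X n)
    (hφ : ∀ i j x, i + 1 = j → (M'.cx.d i j).hom (φ i x) = φ j ((M.cx.d i j).hom x))
    (hψ : ∀ i j x, i + 1 = j → (N'.cx.d i j).hom (ψ i x) = ψ j ((N.cx.d i j).hom x))
    (hf : ∀ n x, (f'.f.f n).hom (φ n x) = ψ n ((f.f.f n).hom x)) (h : quasiIso A f) :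
    quasiIso A' f' := by
  rw [quasiIso_iff_elements] at h ⊢
  intro i n j hi hj
  obtain ⟨h₁, h₂⟩ := h i n j hi hj
  refine ⟨fun x hx ⟨y, hy⟩ => ?_, fun y hy => ?_⟩
  · obtain ⟨x, rfl⟩ := (φ n).surjective x
    obtain ⟨y, rfl⟩ := (ψ i).surjective y
    rw [hφ n j x hj, map_eq_zero_iff _ (φ j).injective] at hx
    rw [hψ i n y hi, hf] at hy
    obtain ⟨z, hz⟩ := h₁ x hx ⟨y, (ψ n).injective hy⟩
    exact ⟨φ i z, by rw [hφ i n z hi, hz]⟩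
  · obtain ⟨y, rfl⟩ := (ψ n).surjective y
    rw [hψ n j y hj, map_eq_zero_iff _ (ψ j).injective] at hy
    obtain ⟨x, hx, z, hz⟩ := h₂ y hy
    exact ⟨φ n x, by rw [hφ n j x hj, hx, map_zero], ψ i z, by
      rw [hψ i n z hi, hz, map_sub, hf]⟩

/-! ### Graded maps out of an extension of scalars -/

section Extension

variable {k k' : Type u} [CommRing k] [CommRing k'] [Algebra k k'] {B : DGAlgebra k}
  {X : DGModule B} {N N' : DGModule (B.baseChange k')}

/-- The restriction `x ↦ z (1 ⊗ x)` of a graded map `z` out of `k' ⊗ X`. -/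
def flat {n : ℤ} (z : GHom (X.baseChange k') N n) : GHom X (res N) n :=
  ⟨Cochain.mk fun p q h => ModuleCat.ofHom (z.ap p q h).restrictTensor, by
    intro i j l i' l' h hi hl x b
    have e : (X.baseChange k').act i j l h ((1 : k') ⊗ₜ[k] x) ((1 : k') ⊗ₜ[k] b) =
        1 ⊗ₜ X.act i j l h x b := by
      refine (baseChangeBilin_tmul k' (X.act i j l h) 1 1 x b).trans ?_
      rw [one_mul]
    refine (congrArg (z.ap l l' hl) e.symm).trans ?_
    exact z.map_act i j l i' l' h hi hl (1 ⊗ₜ x) (1 ⊗ₜ b)⟩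

lemma flat_apply {n : ℤ} (z : GHom (X.baseChange k') N n) (p q : ℤ) (h : p + n = q)
    (x : X.cx.X p) : (flat z).ap p q h x = z.ap p q h ((1 : k') ⊗ₜ[k] x) := rfl

/-- The extension `c ⊗ x ↦ c w x` of a graded map `w` to `k' ⊗ X`. -/
def sharp {n : ℤ} (w : GHom X (res N) n) : GHom (X.baseChange k') N n :=
  ⟨Cochain.mk fun p q h => ModuleCat.ofHom
      (LinearMap.extendTensor (U := N.cx.X q) (w.ap p q h)), by
    intro i j l i' l' h hi hl x b
    change LinearMap.extendTensor (U := N.cx.X l') (w.ap l l' hl)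
        (baseChangeBilin k' (X.act i j l h) x b) =
      N.act i' j l' _ (LinearMap.extendTensor (U := N.cx.X i') (w.ap i i' hi) x) b
    induction x using TensorProduct.induction_on with
    | zero => simp
    | add x x' hx hx' => simp only [map_add, LinearMap.add_apply, hx, hx']
    | tmul c x =>
      induction b using TensorProduct.induction_on with
      | zero => simp
      | add b b' hb hb' => simp only [map_add, hb, hb']
      | tmul c' b =>
        rw [baseChangeBilin_tmul, LinearMap.extendTensor_tmul, LinearMap.extendTensor_tmul,
          act_tmul, map_smul, LinearMap.smul_apply, smul_smul, mul_comm c c']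
        exact congrArg ((c' * c) • ·) (w.map_act i j l i' l' h hi hl x b)⟩

lemma sharp_apply {n : ℤ} (w : GHom X (res N) n) (p q : ℤ) (h : p + n = q) (c : k')
    (x : X.cx.X p) : (sharp w).ap p q h (c ⊗ₜ[k] x) = c • (show N.cx.X q from w.ap p q h x) :=
  LinearMap.extendTensor_tmul (U := N.cx.X q) (w.ap p q h) c x

/-- Graded maps out of an extension of scalars are determined by their values on the `1 ⊗ x`. -/
lemma baseChange_ghom_ext {n : ℤ} {z w : GHom (X.baseChange k') N n}
    (H : ∀ (p q : ℤ) (h : p + n = q) (x : X.cx.X p),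
      z.ap p q h ((1 : k') ⊗ₜ[k] x) = w.ap p q h ((1 : k') ⊗ₜ[k] x)) : z = w := by
  apply GHom.ext
  intro p q h x
  induction x using TensorProduct.induction_on with
  | zero => rw [map_zero, map_zero]
  | add x y hx hy => rw [map_add, map_add, hx, hy]
  | tmul c x =>
    have e : c ⊗ₜ[k] x = c • (1 : k') ⊗ₜ[k] x := by
      rw [TensorProduct.smul_tmul', smul_eq_mul, mul_one]
    rw [e, map_smul, map_smul, H]

/-- The adjunction between extension and restriction of scalars, on graded maps. -/
def flatEquiv (n : ℤ) : GHom (X.baseChange k') N n ≃+ GHom X (res N) n where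
  toFun := flat
  invFun := sharp
  left_inv z := baseChange_ghom_ext fun p q h x => by
    rw [sharp_apply, one_smul]
    rfl
  right_inv w := by
    apply GHom.ext
    intro p q h x
    rw [flat_apply, sharp_apply, one_smul]
  map_add' z w := rfl

lemma flat_δ {a b : ℤ} (h : a + 1 = b) (z : GHom (X.baseChange k') N a) :
    flat (GHom.δ a b z) = GHom.δ a b (flat z) := by
  apply GHom.ext
  intro p q hpq x
  rw [flat_apply, GHom.δ_apply h z p q (p + 1) (p + a) hpq rfl (by omega),
    GHom.δ_apply h (flat z) p q (p + 1) (p + a) hpq rfl (by omega), flat_apply, flat_apply]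
  have e : ((X.baseChange k').cx.d p (p + 1)).hom ((1 : k') ⊗ₜ[k] x) =
    1 ⊗ₜ (X.cx.d p (p + 1)).hom x := LinearMap.baseChange_tmul _ _ _
  rw [e]
  rfl

lemma flat_comp {n : ℤ} (z : GHom (X.baseChange k') N n) (g : N ⟶ N') :
    flat (z.comp (GHom.ofHom g) (add_zero n)) =
      (flat z).comp (GHom.ofHom (resHom g)) (add_zero n) := by
  apply GHom.ext
  intro p q h x
  rw [flat_apply, GHom.comp_apply _ _ _ p q q h (add_zero q),
    GHom.comp_apply _ _ _ p q q h (add_zero q), GHom.ofHom_apply, GHom.ofHom_apply]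
  rfl

/-- The extension of scalars of a K-projective DG module is K-projective. -/
lemma IsKProjective.baseChange (hX : IsKProjective X) : IsKProjective (X.baseChange k') := by
  intro N hN i n j hi hj z hz
  obtain ⟨w, hw⟩ := hX (res N) hN.res i n j hi hj (flat z) (by
    rw [← flat_δ hj, hz]
    exact map_zero (flatEquiv j))
  refine ⟨(flatEquiv i).symm w, (flatEquiv n).injective ?_⟩
  refine (flat_δ hi _).trans (Eq.trans ?_ hw)
  exact congrArg _ ((flatEquiv i).apply_symm_apply w)

end Extension

/-- If `Hom_B(S, -)` reflects quasi-isomorphisms, so does the functor of graded maps out of the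
extension of scalars of `S`. -/
lemma quasiIso_of_homMap_baseChange {k k' : Type u} [CommRing k] [CommRing k'] [Algebra k k']
    {A B : DGAlgebra k} (S : DGBimodule A B)
    (hS : ∀ ⦃Y Y' : DGModule B⦄ (g : Y ⟶ Y'), quasiIso A (homMap S g) → quasiIso B g)
    ⦃Y Y' : DGModule (B.baseChange k')⦄ (g : Y ⟶ Y')
    (hg : quasiIso (A.baseChange k') (homMap (S.baseChange k') g)) :
    quasiIso (B.baseChange k') g := by
  have h : quasiIso B (resHom g) := hS _ (quasiIso_of_addEquiv (homMap (S.baseChange k') g)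
    (homMap S (resHom g)) flatEquiv flatEquiv (fun i j z h => (flat_δ h z).symm)
    (fun i j z h => (flat_δ h z).symm) (fun n z => (flat_comp z g).symm) hg)
  exact quasiIso_of_addEquiv (resHom g) g (fun _ => AddEquiv.refl _) (fun _ => AddEquiv.refl _)
    (fun _ _ _ _ => rfl) (fun _ _ _ _ => rfl) (fun _ _ => rfl) h

end DGModule

namespace DGModule

open CochainComplex.HomComplex

/-! ### Extension of scalars for cochains and morphisms of bimodules -/

section BaseChangeCochain

variable {k : Type u} (k' : Type u) [CommRing k] [CommRing k'] [Algebra k k']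
  {K L P : CochainComplex (ModuleCat.{u} k) ℤ}

/-- The extension of scalars of a cochain. -/
def baseChangeCochain {e : ℤ} (z : Cochain K L e) :
    Cochain (baseChangeCx k' K) (baseChangeCx k' L) e :=
  Cochain.mk fun p q h => ModuleCat.ofHom ((z.v p q h).hom.baseChange k')

variable {k'}

lemma baseChangeCochain_tmul {e : ℤ} (z : Cochain K L e) (p q : ℤ) (h : p + e = q) (c : k')
    (x : K.X p) : ((baseChangeCochain k' z).v p q h).hom (c ⊗ₜ[k] x) =
      c ⊗ₜ[k] (z.v p q h).hom x :=
  LinearMap.baseChange_tmul _ _ _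

lemma baseChangeCochain_ext {N : CochainComplex (ModuleCat.{u} k') ℤ} {e : ℤ}
    {z w : Cochain (baseChangeCx k' K) N e}
    (H : ∀ (p q : ℤ) (h : p + e = q) (c : k') (x : K.X p),
      (z.v p q h).hom (c ⊗ₜ[k] x) = (w.v p q h).hom (c ⊗ₜ[k] x)) : z = w := by
  apply cochain_ext
  intro p q h x
  induction x using TensorProduct.induction_on with
  | zero => rw [map_zero, map_zero]
  | add x y hx hy => rw [map_add, map_add, hx, hy]
  | tmul c x => exact H p q h c x

lemma baseChange_d_tmul (K : CochainComplex (ModuleCat.{u} k) ℤ) (i j : ℤ) (c : k') (x : K.X i) :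
    ((baseChangeCx k' K).d i j).hom (c ⊗ₜ[k] x) = c ⊗ₜ[k] (K.d i j).hom x :=
  LinearMap.baseChange_tmul _ _ _

lemma units_smul_tmul {V : Type u} [AddCommGroup V] [Module k V] (e : ℤˣ) (c : k') (x : V) :
    e • c ⊗ₜ[k] x = c ⊗ₜ[k] (e • x) := by
  rcases Int.units_eq_one_or e with rfl | rfl <;> simp [TensorProduct.tmul_neg]

lemma δ_baseChangeCochain {e e' : ℤ} (h : e + 1 = e') (z : Cochain K L e) :
    δ e e' (baseChangeCochain k' z) = baseChangeCochain k' (δ e e' z) := by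
  apply baseChangeCochain_ext
  intro p q hpq c x
  rw [cochain_δ_apply h _ p q (p + 1) (p + e) hpq rfl (by omega), baseChangeCochain_tmul,
    baseChangeCochain_tmul, baseChange_d_tmul, baseChange_d_tmul, baseChangeCochain_tmul,
    cochain_δ_apply h z p q (p + 1) (p + e) hpq rfl (by omega), TensorProduct.tmul_add,
    units_smul_tmul]

lemma baseChangeCochain_comp {a b c : ℤ} (z : Cochain K L a) (w : Cochain L P b) (h : a + b = c) :
    (baseChangeCochain k' z).comp (baseChangeCochain k' w) h =
      baseChangeCochain k' (z.comp w h) := by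
  apply baseChangeCochain_ext
  intro p q hpq c x
  rw [cochain_comp_apply _ _ h p (p + a) q rfl (by omega), baseChangeCochain_tmul,
    baseChangeCochain_tmul, baseChangeCochain_tmul,
    cochain_comp_apply _ _ h p (p + a) q rfl (by omega)]

lemma baseChangeCochain_id (K : CochainComplex (ModuleCat.{u} k) ℤ) :
    baseChangeCochain k' (Cochain.ofHom (𝟙 K)) = Cochain.ofHom (𝟙 (baseChangeCx k' K)) := by
  apply baseChangeCochain_ext
  intro p q hpq c x
  obtain rfl : p = q := by omega
  rw [baseChangeCochain_tmul, Cochain.ofHom_v, Cochain.ofHom_v]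
  rfl

lemma baseChangeCochain_sub {e : ℤ} (z w : Cochain K L e) :
    baseChangeCochain k' (z - w) = baseChangeCochain k' z - baseChangeCochain k' w := by
  apply baseChangeCochain_ext
  intro p q hpq c x
  rw [baseChangeCochain_tmul, Cochain.sub_v, Cochain.sub_v, ModuleCat.hom_sub, ModuleCat.hom_sub,
    LinearMap.sub_apply, LinearMap.sub_apply, baseChangeCochain_tmul, baseChangeCochain_tmul,
    TensorProduct.tmul_sub]

variable {A B : DGAlgebra k} {S T : DGBimodule A B}

lemma IsLeftLinear.baseChange {e : ℤ} {z : Cochain S.cx T.cx e} (hz : IsLeftLinear z) :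
    IsLeftLinear (S := S.baseChange k') (T := T.baseChange k') (baseChangeCochain k' z) := by
  intro i j n j' n' h hj hn a t
  change ((baseChangeCochain k' z).v n n' hn).hom (baseChangeBilin k' (S.lact i j n h) a t) =
    (i * e).negOnePow • baseChangeBilin k' (T.lact i j' n' _) a
      (((baseChangeCochain k' z).v j j' hj).hom t)
  induction a using TensorProduct.induction_on with
  | zero => simp
  | add a a' ha ha' => simp only [map_add, LinearMap.add_apply, ha, ha', smul_add]
  | tmul c a =>
    induction t using TensorProduct.induction_on with
    | zero => simp
    | add t t' ht ht' => simp only [map_add, ht, ht', smul_add]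
    | tmul c' t =>
      rw [baseChangeBilin_tmul, baseChangeCochain_tmul, baseChangeCochain_tmul,
        baseChangeBilin_tmul, units_smul_tmul, hz i j n j' n' h hj hn]

variable (k') in
/-- The extension of scalars of a morphism of bimodules. -/
def _root_.DGBimodule.Hom.baseChange (π : S.Hom T) : (S.baseChange k').Hom (T.baseChange k') where
  toHom :=
    { f :=
        { f := fun n => ModuleCat.ofHom ((π.toHom.f.f n).hom.baseChange k')
          comm' := fun i j _ => by
            ext1
            change ((T.cx.d i j).hom.baseChange k').comp ((π.toHom.f.f i).hom.baseChange k') =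
              ((π.toHom.f.f j).hom.baseChange k').comp ((S.cx.d i j).hom.baseChange k')
            rw [← LinearMap.baseChange_comp, ← LinearMap.baseChange_comp, ← ModuleCat.hom_comp,
              ← ModuleCat.hom_comp, π.toHom.f.comm] }
      map_act := fun i j n h t b => by
        change (π.toHom.f.f n).hom.baseChange k' (baseChangeBilin k' (S.act i j n h) t b) =
          baseChangeBilin k' (T.act i j n h) ((π.toHom.f.f i).hom.baseChange k' t) b
        induction t using TensorProduct.induction_on with
        | zero => simp
        | add t t' ht ht' => simp only [map_add, LinearMap.add_apply, ht, ht']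
        | tmul c t =>
          induction b using TensorProduct.induction_on with
          | zero => simp
          | add b b' hb hb' => simp only [map_add, hb, hb']
          | tmul c' b => simp only [baseChangeBilin_tmul, LinearMap.baseChange_tmul, Hom.map_act] }
  map_lact i j n h a t := by
    change (π.toHom.f.f n).hom.baseChange k' (baseChangeBilin k' (S.lact i j n h) a t) =
      baseChangeBilin k' (T.lact i j n h) a ((π.toHom.f.f j).hom.baseChange k' t)
    induction a using TensorProduct.induction_on with
    | zero => simp
    | add a a' ha ha' => simp only [map_add, LinearMap.add_apply, ha, ha']
    | tmul c a =>
      induction t using TensorProduct.induction_on with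
      | zero => simp
      | add t t' ht ht' => simp only [map_add, ht, ht']
      | tmul c' t => simp only [baseChangeBilin_tmul, LinearMap.baseChange_tmul, π.map_lact]

lemma baseChangeCochain_ofHom (π : S.Hom T) :
    baseChangeCochain k' (Cochain.ofHom π.toHom.f) =
      Cochain.ofHom (π.baseChange k').toHom.f := by
  apply baseChangeCochain_ext
  intro p q hpq c x
  obtain rfl : p = q := by omega
  rw [baseChangeCochain_tmul, Cochain.ofHom_v, Cochain.ofHom_v]
  rfl

/-- The extension of scalars of the bar resolution of a bimodule remains a resolution after
tensoring with any DG module. -/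
lemma quasiIso_tensorRight_baseChange (T : DGBimodule A B) (M : DGModule (A.baseChange k')) :
    quasiIso (B.baseChange k') (tensorRight M ((barBimoduleAug T).baseChange k')) := by
  refine quasiIso_tensorRight M _ (baseChangeCochain k' (barUnit T.toDGModule))
    (isLeftLinear_barUnit T).baseChange ?_ (baseChangeCochain k' (barHomotopy T.toDGModule))
    (isLeftLinear_barHomotopy T).baseChange ?_ ?_
  · rw [δ_baseChangeCochain (zero_add 1), δ_barUnit]
    apply baseChangeCochain_ext
    intro p q hpq c x
    rw [baseChangeCochain_tmul]
    simp
  · rw [δ_baseChangeCochain (by omega), δ_barHomotopy, baseChangeCochain_sub, baseChangeCochain_id,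
      ← baseChangeCochain_ofHom, baseChangeCochain_comp]
    rfl
  · rw [← baseChangeCochain_ofHom, baseChangeCochain_comp, ← baseChangeCochain_id]
    exact congrArg _ (barUnit_barAug T.toDGModule)

end BaseChangeCochain

end DGModule

namespace DGModule

open CochainComplex.HomComplex

/-! ### Restriction of scalars and tensor products -/

section TensorRes

/-- The elements of a tensor product are sums of elements `m ⊗ t`. -/
lemma tensor_induction {k : Type u} [CommRing k] {A B : DGAlgebra k} {M : DGModule A}
    {T : DGBimodule A B} {n : ℤ} {p : TensorX M T n → Prop} (x : TensorX M T n) (zero : p 0)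
    (tmul : ∀ (i j : ℤ) (h : i + j = n) (m : M.cx.X i) (t : T.cx.X j), p (tmul M T i j n h m t))
    (add : ∀ x y, p x → p y → p (x + y)) : p x := by
  obtain ⟨x, rfl⟩ := Submodule.mkQ_surjective _ x
  induction x using DirectSum.induction_on with
  | zero => rwa [map_zero]
  | add x y hx hy => rw [map_add]; exact add _ _ hx hy
  | of ij y =>
    induction y using TensorProduct.induction_on with
    | zero => rwa [map_zero, map_zero]
    | add x y hx hy => rw [map_add, map_add]; exact add _ _ hx hy
    | tmul m t => exact tmul _ _ ij.2 m t

variable {k k' : Type u} [CommRing k] [CommRing k'] [Algebra k k'] {A B : DGAlgebra k}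
  (M : DGModule (A.baseChange k')) (S : DGBimodule A B)

/-- Multiplication by a scalar `c` of `k'`, as an endomorphism of the restriction of `M`. -/
def resScale (c : k') : res M ⟶ res M where
  f :=
    { f := fun n => ModuleCat.ofHom ((LinearMap.lsmul k' (M.cx.X n) c).res k)
      comm' := fun i j _ => ModuleCat.hom_ext
        (LinearMap.ext fun x => (M.cx.d i j).hom.map_smul c x) }
  map_act i j n h m a := ((M.act i j n h).map_smul₂ c m ((1 : k') ⊗ₜ a)).symm

/-- The action of `k'` on `M ⊗_A S` by `c (m ⊗ s) = c m ⊗ s`. -/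
def tensorScale (n : ℤ) : k' →+* Module.End k (TensorX (res M) S n) where
  toFun c := tensorMapX S (resScale M c) n
  map_one' := by
    apply tensor_hom_ext
    intro i j h m s
    rw [tensorMapX_tmul]
    exact congrArg (fun m => tmul (res M) S i j n h m s) (one_smul k' (show M.cx.X i from m))
  map_mul' c c' := by
    apply tensor_hom_ext
    intro i j h m s
    rw [Module.End.mul_apply, tensorMapX_tmul, tensorMapX_tmul, tensorMapX_tmul]
    exact congrArg (fun m => tmul (res M) S i j n h m s) (mul_smul c c' (show M.cx.X i from m))
  map_zero' := by
    apply tensor_hom_ext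
    intro i j h m s
    rw [tensorMapX_tmul]
    refine (congrArg (fun m => tmul (res M) S i j n h m s)
      (zero_smul k' (show M.cx.X i from m))).trans ?_
    exact (tmul (res M) S i j n h).map_zero₂ s
  map_add' c c' := by
    apply tensor_hom_ext
    intro i j h m s
    rw [LinearMap.add_apply, tensorMapX_tmul, tensorMapX_tmul, tensorMapX_tmul]
    refine (congrArg (fun m => tmul (res M) S i j n h m s)
      (add_smul c c' (show M.cx.X i from m))).trans ?_
    exact (tmul (res M) S i j n h).map_add₂ _ _ s

instance (n : ℤ) : Module k' (TensorX (res M) S n) :=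
  Module.compHom (TensorX (res M) S n) (tensorScale M S n)

lemma smul_tmul_res (n i j : ℤ) (h : i + j = n) (c : k') (m : M.cx.X i) (s : S.cx.X j) :
    c • tmul (res M) S i j n h m s =
      tmul (res M) S i j n h (show M.cx.X i from c • m) s :=
  tensorMapX_tmul S (resScale M c) n i j h m s

instance (n : ℤ) : IsScalarTower k k' (TensorX (res M) S n) :=
  IsScalarTower.of_algebraMap_smul fun c x => by
    suffices tensorScale M S n (algebraMap k k' c) = c • LinearMap.id from congr($this x)
    apply tensor_hom_ext
    intro i j h m s
    rw [LinearMap.smul_apply, LinearMap.id_apply, ← (tmul (res M) S i j n h).map_smul₂]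
    exact tensorMapX_tmul S (resScale M (algebraMap k k' c)) n i j h m s

/-- The comparison `m ⊗ s ↦ m ⊗ (1 ⊗ s)` in degree `n`. -/
def tensorResX (n : ℤ) :
    TensorX (res M) S n →ₗ[k] Res k k' (TensorX M (S.baseChange k') n) :=
  tensorDesc (fun i j h => LinearMap.mk₂ k
      (fun (m : Res k k' (M.cx.X i)) s =>
        (tmul M (S.baseChange k') i j n h m).restrictTensor s)
      (fun m m' s => (tmul M (S.baseChange k') i j n h).map_add₂ m m' _)
      (fun c m s => (tmul M (S.baseChange k') i j n h).map_smul₂ (algebraMap k k' c) m _)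
      (fun m s s' => (tmul M (S.baseChange k') i j n h m).restrictTensor.map_add s s')
      (fun c m s => (tmul M (S.baseChange k') i j n h m).restrictTensor.map_smul c s)) (by
    intro i j l r s hr hs h₁ h₂ m a t
    refine (tmul_act M (S.baseChange k') i j l r s n hr hs h₁ h₂ m ((1 : k') ⊗ₜ[k] a)
      ((1 : k') ⊗ₜ[k] t)).trans ?_
    refine congrArg (tmul M (S.baseChange k') i s n h₂ m) ?_
    refine (baseChangeBilin_tmul k' (S.lact j l s hs) 1 1 a t).trans ?_
    rw [one_mul])

lemma tensorResX_tmul (n i j : ℤ) (h : i + j = n) (m : (res M).cx.X i) (s : S.cx.X j) :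
    tensorResX M S n (tmul (res M) S i j n h m s) =
      tmul M (S.baseChange k') i j n h m ((1 : k') ⊗ₜ[k] s) :=
  tensorDesc_tmul _ _ _ _ _ _ _

/-- The comparison `res M ⊗ S ⟶ res (M ⊗ (k' ⊗ S))`. -/
def tensorRes : tensor (res M) S ⟶ res (tensor M (S.baseChange k')) where
  f :=
    { f := fun n => ModuleCat.ofHom (tensorResX M S n)
      comm' := by
        intro n n' hn
        have hn : n + 1 = n' := hn
        ext1
        apply tensor_hom_ext
        intro i j h m s
        have e := tensorCx_d_tmul M (S.baseChange k') n n' hn i (i + 1) j (j + 1) h rfl rfl m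
          ((1 : k') ⊗ₜ[k] s)
        rw [baseChange_d_tmul] at e
        have e' := congrArg (tensorResX M S n') (tensorCx_d_tmul (res M) S n n' hn i (i + 1) j
          (j + 1) h rfl rfl m s)
        rw [map_add, map_zsmul_unit, tensorResX_tmul, tensorResX_tmul] at e'
        refine Eq.trans ?_ e'.symm
        refine Eq.trans ?_ e
        exact congrArg ((tensorCx M (S.baseChange k')).d n n').hom
          (tensorResX_tmul M S n i j h m s) }
  map_act i j n h x b := by
    suffices (tensorResX M S n).comp ((tensorAct (res M) S i j n h).flip b) =
        (((res (tensor M (S.baseChange k'))).act i j n h).flip b).comp (tensorResX M S i) from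
      congr($this x)
    apply tensor_hom_ext
    intro p q hpq m s
    simp only [LinearMap.comp_apply, LinearMap.flip_apply]
    refine (congrArg (tensorResX M S n)
      (tensorAct_tmul (res M) S i j n h p q (q + j) hpq rfl m s b)).trans ?_
    refine (tensorResX_tmul M S n p (q + j) (by omega) m (S.act q j (q + j) rfl s b)).trans ?_
    refine Eq.trans ?_ (congrArg (fun x => (res (tensor M (S.baseChange k'))).act i j n h x b)
      (tensorResX_tmul M S i p q hpq m s)).symm
    refine Eq.trans ?_ (tensorAct_tmul M (S.baseChange k') i j n h p q (q + j) hpq rfl m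
      ((1 : k') ⊗ₜ[k] s) ((1 : k') ⊗ₜ[k] b)).symm
    refine congrArg (tmul M (S.baseChange k') p (q + j) n (by omega) m) ?_
    refine Eq.trans ?_ (baseChangeBilin_tmul k' (S.act q j (q + j) rfl) 1 1 s b).symm
    rw [one_mul]

/-- The bilinear map `(m, c ⊗ s) ↦ c m ⊗ s`. -/
def tensorResInvAux (n i j : ℤ) (h : i + j = n) :
    M.cx.X i →ₗ[k'] (S.baseChange k').cx.X j →ₗ[k'] TensorX (res M) S n :=
  LinearMap.mk₂ k'
    (fun m t => LinearMap.liftBaseChange k' (tmul (res M) S i j n h m) t)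
    (fun m m' t => by
      induction t using TensorProduct.induction_on with
      | zero => simp
      | add t t' ht ht' => simp only [map_add, ht, ht']; abel
      | tmul c s =>
        simp only [LinearMap.liftBaseChange_tmul]
        rw [← smul_add]
        exact congrArg (c • ·) ((tmul (res M) S i j n h).map_add₂ m m' s))
    (fun c m t => by
      induction t using TensorProduct.induction_on with
      | zero => simp
      | add t t' ht ht' => simp only [map_add, ht, ht', smul_add]
      | tmul c' s =>
        simp only [LinearMap.liftBaseChange_tmul]
        rw [smul_comm]
        exact congrArg (c' • ·) (smul_tmul_res M S n i j h c m s).symm)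
    (fun m t t' => map_add _ t t')
    (fun c m t => map_smul _ c t)

lemma tensorResInvAux_tmul (n i j : ℤ) (h : i + j = n) (m : M.cx.X i) (c : k') (s : S.cx.X j) :
    tensorResInvAux M S n i j h m (c ⊗ₜ[k] s) = c • tmul (res M) S i j n h m s :=
  LinearMap.liftBaseChange_tmul k' (tmul (res M) S i j n h m) c s

/-- The inverse of the comparison, `m ⊗ (c ⊗ s) ↦ c m ⊗ s`. -/
def tensorResInv (n : ℤ) : TensorX M (S.baseChange k') n →ₗ[k'] TensorX (res M) S n :=
  tensorDesc (tensorResInvAux M S n) (by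
    intro i j l r s hr hs h₁ h₂ m a t
    change _ = tensorResInvAux M S n i s h₂ m (baseChangeBilin k' (S.lact j l s hs) a t)
    induction a using TensorProduct.induction_on with
    | zero => simp
    | add a a' ha ha' => simp only [map_add, LinearMap.add_apply, ha, ha']
    | tmul c a =>
      induction t using TensorProduct.induction_on with
      | zero => simp
      | add t t' ht ht' => simp only [map_add, ht, ht']
      | tmul c' t =>
        rw [baseChangeBilin_tmul, tensorResInvAux_tmul, tensorResInvAux_tmul, act_tmul,
          mul_comm, mul_smul]
        refine congrArg (c' • ·) ?_
        refine (smul_tmul_res M S n r l h₁ c _ t).symm.trans ?_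
        exact congrArg (c • ·) (tmul_act (res M) S i j l r s n hr hs h₁ h₂ m a t))

lemma tensorResInv_tmul (n i j : ℤ) (h : i + j = n) (m : M.cx.X i) (c : k') (s : S.cx.X j) :
    tensorResInv M S n (tmul M (S.baseChange k') i j n h m (c ⊗ₜ[k] s)) =
      c • tmul (res M) S i j n h m s :=
  (tensorDesc_tmul _ _ _ _ _ _ _).trans (tensorResInvAux_tmul M S n i j h m c s)

lemma tensorResX_bijective (n : ℤ) : Function.Bijective (tensorResX M S n) := by
  refine Function.bijective_iff_has_inverse.2 ⟨tensorResInv M S n, fun x => ?_, fun x => ?_⟩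
  · induction x using tensor_induction with
    | zero => exact (congrArg _ (map_zero _)).trans (map_zero (tensorResInv M S n))
    | add x y hx hy =>
      refine (congrArg _ (map_add (tensorResX M S n) x y)).trans ?_
      exact (map_add (tensorResInv M S n) _ _).trans (congrArg₂ (· + ·) hx hy)
    | tmul i j h m s =>
      rw [tensorResX_tmul]
      exact (tensorResInv_tmul M S n i j h m 1 s).trans (one_smul k' _)
  · revert x
    change ∀ x : TensorX M (S.baseChange k') n, _
    intro x
    induction x using tensor_induction with
    | zero => exact (congrArg _ (map_zero (tensorResInv M S n))).trans (map_zero _)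
    | add x y hx hy =>
      refine (congrArg _ (map_add (tensorResInv M S n) x y)).trans ?_
      exact (map_add (tensorResX M S n) _ _).trans (congrArg₂ (· + ·) hx hy)
    | tmul i j h m t =>
      induction t using TensorProduct.induction_on with
      | zero =>
        rw [map_zero, map_zero, map_zero]
        rfl
      | add t t' ht ht' =>
        rw [map_add, map_add, map_add]
        exact congrArg₂ (· + ·) ht ht'
      | tmul c s =>
        have e : c ⊗ₜ[k] s = c • (1 : k') ⊗ₜ[k] s := by
          rw [TensorProduct.smul_tmul', smul_eq_mul, mul_one]
        refine (congrArg (tensorResX M S n) ((tensorResInv_tmul M S n i j h m c s).trans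
          (smul_tmul_res M S n i j h c m s))).trans ?_
        refine (tensorResX_tmul M S n i j h _ s).trans ?_
        rw [e]
        exact ((tmul M (S.baseChange k') i j n h).map_smul₂ c m _).trans
          (map_smul (tmul M (S.baseChange k') i j n h m) c _).symm

/-- The comparison `res M ⊗ S ⟶ res (M ⊗ (k' ⊗ S))` is bijective. -/
lemma quasiIso_tensorRes : quasiIso B (tensorRes M S) :=
  quasiIso_of_addEquiv (𝟙 (tensor (res M) S)) (tensorRes M S) (fun _ => AddEquiv.refl _)
    (fun n => AddEquiv.ofBijective (tensorResX M S n) (tensorResX_bijective M S n))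
    (fun _ _ _ _ => rfl)
    (fun i j x _ => congr(($((tensorRes M S).f.comm i j)).hom x))
    (fun _ _ => rfl) (inferInstanceAs (QuasiIso (𝟙 (tensorCx (res M) S))))

end TensorRes

end DGModule

/-! ### Coinduction -/

section CoindMod

/-- The `k`-linear maps `k' → V`, with the `k'`-module structure `(c f) x = f (x c)`. -/
def CoindMod (k k' V : Type u) [CommRing k] [CommRing k'] [Algebra k k'] [AddCommGroup V]
    [Module k V] : Type u := k' →ₗ[k] V

variable {k k' V U : Type u} [CommRing k] [CommRing k'] [Algebra k k'] [AddCommGroup V]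
  [Module k V] [AddCommGroup U] [Module k U]

instance : AddCommGroup (CoindMod k k' V) := inferInstanceAs (AddCommGroup (k' →ₗ[k] V))

instance : FunLike (CoindMod k k' V) k' V := inferInstanceAs (FunLike (k' →ₗ[k] V) k' V)

namespace CoindMod

@[ext]
lemma ext {f g : CoindMod k k' V} (h : ∀ x, f x = g x) : f = g := DFunLike.ext f g h

instance : Module k' (CoindMod k k' V) where
  smul c f := LinearMap.comp (show k' →ₗ[k] V from f) (LinearMap.mulRight k c)
  one_smul f := ext fun x => congrArg f (mul_one x)
  mul_smul c c' f := ext fun x => congrArg f (mul_assoc x c c').symm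
  smul_zero _ := rfl
  smul_add _ _ _ := rfl
  add_smul c c' f := ext fun x => (congrArg f (mul_add x c c')).trans
    (LinearMap.map_add (show k' →ₗ[k] V from f) _ _)
  zero_smul f := ext fun x => (congrArg f (mul_zero x)).trans
    (LinearMap.map_zero (show k' →ₗ[k] V from f))

lemma smul_apply (c : k') (f : CoindMod k k' V) (x : k') : (c • f) x = f (x * c) := rfl

@[simp] lemma add_apply (f g : CoindMod k k' V) (x : k') : (f + g) x = f x + g x := rfl

variable (k') in
/-- Post-composition with a linear map. -/
def map (φ : V →ₗ[k] U) : CoindMod k k' V →ₗ[k'] CoindMod k k' U where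
  toFun f := φ.comp (show k' →ₗ[k] V from f)
  map_add' _ _ := LinearMap.comp_add _ _ φ
  map_smul' _ _ := rfl

variable (k k') in
/-- The linear map `c ↦ c y` to a `k'`-module. -/
def orbit (Y : Type u) [AddCommGroup Y] [Module k' Y] (y : Y) : k' →ₗ[k] Res k k' Y where
  toFun c := show Y from c • y
  map_add' c c' := add_smul c c' y
  map_smul' e c := by
    rw [Algebra.smul_def]
    exact mul_smul (algebraMap k k' e) c y

/-- The linear map which sends `y` to `x ↦ φ (f x) y`. -/
def applyAt {Y : Type u} [AddCommGroup Y] [Module k Y] (φ : V →ₗ[k] Y →ₗ[k] U)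
    (f : CoindMod k k' V) : Y →ₗ[k] Res k k' (CoindMod k k' U) where
  toFun y := map k' (φ.flip y) f
  map_add' y y' := ext fun x => map_add (φ (f x)) y y'
  map_smul' c y := ext fun x => by
    have e : f (x * algebraMap k k' c) = c • f x := by
      rw [mul_comm, ← Algebra.smul_def]
      exact LinearMap.map_smul (show k' →ₗ[k] V from f) c x
    change φ (f x) (c • y) = φ (f (x * algebraMap k k' c)) y
    rw [e, map_smul, LinearMap.map_smul₂]

/-- The map which sends `c ⊗ y` to `x ↦ φ (f (x c)) y`. -/
def extendAt {Y : Type u} [AddCommGroup Y] [Module k Y] (φ : V →ₗ[k] Y →ₗ[k] U)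
    (f : CoindMod k k' V) : k' ⊗[k] Y →ₗ[k'] CoindMod k k' U :=
  (applyAt φ f).extendTensor

lemma extendAt_tmul {Y : Type u} [AddCommGroup Y] [Module k Y] (φ : V →ₗ[k] Y →ₗ[k] U)
    (f : CoindMod k k' V) (c : k') (y : Y) (x : k') :
    extendAt φ f (c ⊗ₜ[k] y) x = φ (f (x * c)) y :=
  congrArg (fun g : CoindMod k k' U => g x)
    (LinearMap.extendTensor_tmul (U := CoindMod k k' U) (applyAt φ f) c y)

/-- The bilinear map which sends `f` and `c ⊗ y` to `x ↦ φ (f (x c)) y`. -/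
def bilin {Y : Type u} [AddCommGroup Y] [Module k Y] (φ : V →ₗ[k] Y →ₗ[k] U) :
    CoindMod k k' V →ₗ[k'] k' ⊗[k] Y →ₗ[k'] CoindMod k k' U :=
  LinearMap.mk₂ k' (fun f t => extendAt φ f t)
    (fun f f' t => by
      induction t using TensorProduct.induction_on with
      | zero => simp
      | add t t' ht ht' => rw [map_add, map_add, map_add, ht, ht', add_add_add_comm]
      | tmul c y =>
        ext x
        rw [add_apply, extendAt_tmul, extendAt_tmul, extendAt_tmul, add_apply,
          LinearMap.map_add₂])
    (fun e f t => by
      induction t using TensorProduct.induction_on with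
      | zero => simp
      | add t t' ht ht' => rw [map_add, map_add, ht, ht', smul_add]
      | tmul c y =>
        ext x
        rw [smul_apply, extendAt_tmul, extendAt_tmul, smul_apply, mul_right_comm])
    (fun f t t' => map_add _ t t') (fun c f t => map_smul _ c t)

lemma bilin_tmul {Y : Type u} [AddCommGroup Y] [Module k Y] (φ : V →ₗ[k] Y →ₗ[k] U)
    (f : CoindMod k k' V) (c : k') (y : Y) (x : k') :
    bilin φ f (c ⊗ₜ[k] y) x = φ (f (x * c)) y :=
  extendAt_tmul φ f c y x

lemma units_smul_apply (e : ℤˣ) (f : CoindMod k k' V) (x : k') : (e • f) x = e • f x := rfl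

end CoindMod

end CoindMod

namespace DGModule

open CochainComplex.HomComplex

section Coind

variable {k : Type u} (k' : Type u) [CommRing k] [CommRing k'] [Algebra k k'] {A : DGAlgebra k}

/-- The complex of `k`-linear maps out of `k'`. -/
@[reducible]
def coindCx (K : CochainComplex (ModuleCat.{u} k) ℤ) : CochainComplex (ModuleCat.{u} k') ℤ where
  X n := ModuleCat.of k' (CoindMod k k' (K.X n))
  d i j := ModuleCat.ofHom (CoindMod.map k' (K.d i j).hom)
  shape i j h := ModuleCat.hom_ext (LinearMap.ext fun f => CoindMod.ext fun x =>
    congr(($(K.shape i j h)).hom (f x)))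
  d_comp_d' i j l _ _ := ModuleCat.hom_ext (LinearMap.ext fun f => CoindMod.ext fun x =>
    congr(($(K.d_comp_d i j l)).hom (f x)))

/-- The right DG module of `k`-linear maps from `k'` to `N`: the right adjoint of the restriction
of scalars. -/
@[reducible]
def coind (N : DGModule A) : DGModule (A.baseChange k') where
  cx := coindCx k' N.cx
  act i j n h := CoindMod.bilin (N.act i j n h)
  act_one i f := CoindMod.ext fun x => by
    rw [CoindMod.bilin_tmul, mul_one, N.act_one]
  act_mul i j l r s n hr hs h₁ h₂ f a b := by
    change _ = CoindMod.bilin (N.act i s n h₂) f (baseChangeBilin k' (A.mul j l s hs) a b)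
    induction a using TensorProduct.induction_on with
    | zero => simp
    | add a a' ha ha' => simp only [map_add, LinearMap.add_apply, ha, ha']
    | tmul c a =>
      induction b using TensorProduct.induction_on with
      | zero => simp
      | add b b' hb hb' => simp only [map_add, hb, hb']
      | tmul c' b =>
        refine CoindMod.ext fun x => ?_
        rw [baseChangeBilin_tmul, CoindMod.bilin_tmul, CoindMod.bilin_tmul, CoindMod.bilin_tmul,
          N.act_mul i j l r s n hr hs h₁ h₂, mul_assoc, mul_comm c c']
  d_act i i' j j' n n' hi hj hn h f a := by
    induction a using TensorProduct.induction_on with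
    | zero => simp
    | add a a' ha ha' => simp only [map_add, ha, ha', smul_add]; abel
    | tmul c a =>
      refine CoindMod.ext fun x => ?_
      rw [baseChange_d_tmul, CoindMod.add_apply, CoindMod.units_smul_apply]
      rw [CoindMod.bilin_tmul, CoindMod.bilin_tmul]
      change (N.cx.d n n').hom (CoindMod.bilin (N.act i j n h) f (c ⊗ₜ[k] a) x) = _
      rw [CoindMod.bilin_tmul]
      exact N.d_act i i' j j' n n' hi hj hn h _ a

variable {k'}

/-- The graded map `m ↦ (c ↦ z (c m))` to a coinduced module. -/
def coindLift {M : DGModule (A.baseChange k')} {N : DGModule A} {n : ℤ} (z : GHom (res M) N n) :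
    GHom M (coind k' N) n :=
  ⟨Cochain.mk fun p q h => ModuleCat.ofHom
    { toFun := fun m => LinearMap.comp (z.ap p q h)
        (CoindMod.orbit k k' (M.cx.X p) m)
      map_add' := fun m m' => CoindMod.ext fun c =>
        (congrArg (z.ap p q h) (smul_add c m m')).trans (map_add (z.ap p q h) _ _)
      map_smul' := fun e m => CoindMod.ext fun c =>
        congrArg (z.ap p q h) (mul_smul c e m).symm }, by
    intro i j l i' l' h hi hl m a
    induction a using TensorProduct.induction_on with
    | zero => simp
    | add a a' ha ha' => simp only [map_add, ha, ha']
    | tmul e a =>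
      refine CoindMod.ext fun c => ?_
      refine Eq.trans ?_ (CoindMod.bilin_tmul (N.act i' j l' (by omega)) _ e a c).symm
      refine Eq.trans ?_ (z.map_act i j l i' l' h hi hl (show M.cx.X i from (c * e) • m) a)
      refine congrArg (z.ap l l' hl) ?_
      change c • M.act i j l h m (e ⊗ₜ a) = M.act i j l h ((c * e) • m) (1 ⊗ₜ a)
      rw [act_tmul, smul_smul, LinearMap.map_smul₂]⟩

lemma coindLift_zero {M : DGModule (A.baseChange k')} {N : DGModule A} {n : ℤ} :
    coindLift (0 : GHom (res M) N n) = 0 := rfl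

lemma coindLift_δ {M : DGModule (A.baseChange k')} {N : DGModule A} {a b : ℤ} (h : a + 1 = b)
    (z : GHom (res M) N a) : coindLift (GHom.δ a b z) = GHom.δ a b (coindLift z) := by
  apply GHom.ext
  intro p q hpq m
  refine CoindMod.ext fun c => ?_
  rw [GHom.δ_apply h (coindLift z) p q (p + 1) (p + a) hpq rfl (by omega), CoindMod.add_apply,
    CoindMod.units_smul_apply]
  refine (GHom.δ_apply h z p q (p + 1) (p + a) hpq rfl (by omega) _).trans ?_
  refine congrArg₂ (· + ·) rfl (congrArg (b.negOnePow • ·) ?_)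
  exact congrArg (z.ap (p + 1) q (by omega)) ((M.cx.d p (p + 1)).hom.map_smul c m)

/-- The graded map `m ↦ u m 1` obtained from a graded map `u` to a coinduced module. -/
def coindEval {M : DGModule (A.baseChange k')} {N : DGModule A} {n : ℤ}
    (u : GHom M (coind k' N) n) : GHom (res M) N n :=
  ⟨Cochain.mk fun p q h => ModuleCat.ofHom
    { toFun := fun m => (show CoindMod k k' (N.cx.X q) from u.ap p q h m) 1
      map_add' := fun m m' => congrArg (fun f : CoindMod k k' (N.cx.X q) => f 1)
        (map_add (u.ap p q h) m m')
      map_smul' := fun e m => by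
        refine (congrArg (fun f : CoindMod k k' (N.cx.X q) => f 1)
          ((u.ap p q h).map_smul (algebraMap k k' e) (show M.cx.X p from m))).trans ?_
        change (show CoindMod k k' (N.cx.X q) from u.ap p q h m) (1 * algebraMap k k' e) = _
        rw [mul_comm, ← Algebra.smul_def]
        exact LinearMap.map_smul (show k' →ₗ[k] N.cx.X q from u.ap p q h m) e 1 }, by
    intro i j l i' l' h hi hl m a
    refine (congrArg (fun f : CoindMod k k' (N.cx.X l') => f 1)
      (u.map_act i j l i' l' h hi hl m (1 ⊗ₜ a))).trans ?_
    refine (CoindMod.bilin_tmul (N.act i' j l' (by omega)) _ 1 a 1).trans ?_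
    rw [mul_one]
    rfl⟩

lemma coindEval_δ {M : DGModule (A.baseChange k')} {N : DGModule A} {a b : ℤ} (h : a + 1 = b)
    (u : GHom M (coind k' N) a) : coindEval (GHom.δ a b u) = GHom.δ a b (coindEval u) := by
  apply GHom.ext
  intro p q hpq m
  rw [GHom.δ_apply h (coindEval u) p q (p + 1) (p + a) hpq rfl (by omega)]
  exact congrArg (fun f : CoindMod k k' (N.cx.X q) => f 1)
    (GHom.δ_apply h u p q (p + 1) (p + a) hpq rfl (by omega) m)

lemma coindEval_coindLift {M : DGModule (A.baseChange k')} {N : DGModule A} {n : ℤ}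
    (z : GHom (res M) N n) : coindEval (coindLift z) = z := by
  apply GHom.ext
  intro p q h m
  exact congrArg (z.ap p q h) (one_smul k' (show M.cx.X p from m))

end Coind

/-- Over a field, coinduction preserves acyclicity: an acyclic complex of vector spaces has a
linear contraction, which can be applied to the values of linear maps. -/
lemma IsAcyclic.coind {k : Type u} (k' : Type u) [Field k] [CommRing k'] [Algebra k k']
    {A : DGAlgebra k} {N : DGModule A} (hN : IsAcyclic N) : IsAcyclic (DGModule.coind k' N) := by
  obtain ⟨s, hs⟩ := hN.exists_contraction
  intro i n j hi hj f hf
  refine ⟨CoindMod.map k' (s.v n i (by omega)).hom f, CoindMod.ext fun x => ?_⟩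
  have e := cochain_δ_apply (by omega : (-1 : ℤ) + 1 = 0) s n n j i (add_zero n) hj hi
    ((show CoindMod k k' (N.cx.X n) from f) x)
  have hf' : (N.cx.d n j).hom ((show CoindMod k k' (N.cx.X n) from f) x) = 0 :=
    congrArg (fun g : CoindMod k k' (N.cx.X j) => g x) hf
  rw [hs, hf', map_zero, smul_zero, add_zero] at e
  exact e.symm.trans (by simp)

/-- Over a field, restriction of scalars preserves K-projectivity, because its right adjoint
preserves acyclicity. -/
lemma IsKProjective.res {k k' : Type u} [Field k] [CommRing k'] [Algebra k k'] {A : DGAlgebra k}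
    {M : DGModule (A.baseChange k')} (hM : IsKProjective M) : IsKProjective (DGModule.res M) := by
  intro N hN i n j hi hj z hz
  obtain ⟨w, hw⟩ := hM (DGModule.coind k' N) (hN.coind k') i n j hi hj (coindLift z) (by
    rw [← coindLift_δ hj, hz, coindLift_zero])
  exact ⟨coindEval w, by rw [← coindEval_δ hi, hw, coindEval_coindLift]⟩

/-! ### The unit over the extension -/

/-- The unit condition for the extension of scalars of `S` follows from that for `S`: up to the
identification of `Hom_B(S, res (W ⊗ (k' ⊗ S)))` with the graded maps out of `k' ⊗ S`, the unit at `W`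
is the unit at `res W` followed by the comparison `res W ⊗ S ⟶ res (W ⊗ (k' ⊗ S))`. -/
lemma quasiIso_tensorUnit_baseChange {k k' : Type u} [Field k] [CommRing k'] [Algebra k k']
    {A B : DGAlgebra k} (S : DGBimodule A B) (hS : IsKProjective S.toDGModule)
    (hU : ∀ W : DGModule A, IsKProjective W → quasiIso A (tensorUnit S W))
    (W : DGModule (A.baseChange k')) (hW : IsKProjective W) :
    quasiIso (A.baseChange k') (tensorUnit (S.baseChange k') W) := by
  have h : quasiIso A (tensorUnit S (DGModule.res W) ≫ homMap S (tensorRes W S)) :=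
    quasiIso_comp _ _ (hU _ hW.res) (quasiIso_homMap S hS _ (quasiIso_tensorRes W S))
  refine quasiIso_of_addEquiv (tensorUnit S (DGModule.res W) ≫ homMap S (tensorRes W S))
    (tensorUnit (S.baseChange k') W) (fun n => AddEquiv.refl (W.cx.X n))
    (fun n => (flatEquiv (X := S.toDGModule) (N := tensor W (S.baseChange k')) n).symm)
    (fun _ _ _ _ => rfl) (fun i j z hij => ?_) (fun n m => ?_) h
  · refine (flatEquiv j).injective ((flat_δ hij _).trans ?_)
    refine (congrArg (GHom.δ i j) ((flatEquiv i).apply_symm_apply z)).trans ?_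
    exact ((flatEquiv j).apply_symm_apply _).symm
  · refine (flatEquiv n).injective (Eq.trans ?_ ((flatEquiv n).apply_symm_apply _).symm)
    apply GHom.ext
    intro p q hpq s
    refine Eq.trans ?_ (GHom.comp_apply (tensorUnitG S (DGModule.res W) n m)
      (GHom.ofHom (tensorRes W S)) (add_zero n) p q q hpq (add_zero q) s).symm
    rw [GHom.ofHom_apply]
    exact (tensorResX_tmul W S q n p (by omega) m s).symm

end DGModule

end
theorem proposition4p2 {k : Type u} [Field k] {k' : Type u} [Field k'] [Algebra k k']
    {A B : DGAlgebra k} (T : DGBimodule A B) (hT : T.GivesDGMoritaEquivalence) :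
    (T.baseChange k').GivesDGMoritaEquivalence := by
  have hS := DGModule.isKProjective_bar T.toDGModule
  obtain ⟨hU, hC⟩ := (DGModule.givesDGMoritaEquivalence_iff (DGModule.barBimoduleAug T) hS
    (DGModule.quasiIso_tensorRight_barBimoduleAug T)).1 hT
  exact (DGModule.givesDGMoritaEquivalence_iff ((DGModule.barBimoduleAug T).baseChange k')
    hS.baseChange (DGModule.quasiIso_tensorRight_baseChange T)).2
    ⟨DGModule.quasiIso_tensorUnit_baseChange _ hS hU,
      DGModule.quasiIso_of_homMap_baseChange _ hC⟩
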